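/- Let $\ell>1$ and $s$ be integers, let $\kappa=(\kappa_1,\dots,\kappa_s)$ be integers with $\kappa_i\ge -1$ and $\sum_i\kappa_i=-4$, and let $a=(a_1,\dots,a_s)\in(\mathbb Z/2\ell)^s$ be such that $\sum_i a_i=0$ and the $a_i$ generate $\mathbb Z/2\ell$. Assume that $\kappa$ and $a$ define a generalized Eierlegende-Wollmilchsau: $\kappa_i$ and $a_i$ have the same parity for each $i$, and for each $I\subset\{1,\dots,s\}$ with $\sum_{i\in I}\kappa_i=-2$, the sum $\sum_{i\in I}a_i$ is a generator of the subgroup $\mathbb Z/\ell\subset\mathbb Z/2\ell$. Let $q$ be a meromorphic quadratic differential on $\mathbb P^1$ that has order $\kappa_i$ at $z_i$, for distinct points $z_1,\dots,z_s\in\mathbb P^1$, and no other zeros or poles. Let $\pi:X\to\mathbb P^1$ be the connected cyclic cover with deck group $\mathbb Z/2\ell$ branched over the points $z_i$ with local monodromy $a_i$ around $z_i$ (the unbranched cover of $\mathbb P^1\setminus\{z_1,\dots,z_s\}$ with the punctures filled in), endowed with the flat structure of the pull-back $\pi^*q$ (which is the square $\omega^2$ of an Abelian differential). A regular point of $X$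 is a point that is neither a zero nor a pole of $\pi^*q$; a line segment is a straight path of positive length for this flat structure, all of whose interior points are regular. Then every regular point $p\in X$ is finitely blocked from itself by $B=\pi^{-1}(\pi(p))\setminus\{p\}$, the set of the other points of the deck group orbit of $p$: the set $B$ is finite, does not contain $p$, and every line segment from $p$ to itself passes through a point of $B$. -/

import Mathlib

open Set Filter Topology Manifold
open scoped ContDiff

/-! ### The Riemann sphere -/

namespace RiemannSphere

/-- The inversion `z ↦ 1 / z` of the Riemann sphere `ℂ ∪ {∞}`, exchanging `0` and `∞`. -/
noncomputable def inv : OnePoint ℂ → OnePoint ℂ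
  | OnePoint.infty => ((0 : ℂ) : OnePoint ℂ)
  | OnePoint.some z => if z = 0 then OnePoint.infty else ((z⁻¹ : ℂ) : OnePoint ℂ)

@[simp] theorem inv_infty : inv OnePoint.infty = ((0 : ℂ) : OnePoint ℂ) := rfl

@[simp] theorem inv_zero : inv ((0 : ℂ) : OnePoint ℂ) = OnePoint.infty := if_pos rfl

theorem inv_coe {z : ℂ} (hz : z ≠ 0) : inv (z : OnePoint ℂ) = ((z⁻¹ : ℂ) : OnePoint ℂ) :=
  if_neg hz

theorem inv_inv (x : OnePoint ℂ) : inv (inv x) = x := by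
  induction x using OnePoint.rec with
  | infty => simp
  | coe z =>
    by_cases hz : z = 0
    · subst hz; simp
    · rw [inv_coe hz, inv_coe (inv_ne_zero hz), _root_.inv_inv]

theorem continuous_inv : Continuous inv := by
  rw [continuous_iff_continuousAt]
  intro x
  induction x using OnePoint.rec with
  | infty =>
    rw [OnePoint.continuousAt_infty', inv_infty]
    have h : Tendsto (fun z : ℂ => ((z⁻¹ : ℂ) : OnePoint ℂ)) (coclosedCompact ℂ)
        (𝓝 ((0 : ℂ) : OnePoint ℂ)) := by
      rw [coclosedCompact_eq_cocompact, ← Metric.cobounded_eq_cocompact]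
      exact (OnePoint.continuous_coe.tendsto 0).comp tendsto_inv₀_cobounded
    refine h.congr' ?_
    have h0 : ∀ᶠ z : ℂ in coclosedCompact ℂ, z ∈ ({0} : Set ℂ)ᶜ := by
      rw [coclosedCompact_eq_cocompact]
      exact isCompact_singleton.compl_mem_cocompact
    filter_upwards [h0] with z hz
    exact (inv_coe hz).symm
  | coe z =>
    rw [OnePoint.continuousAt_coe]
    by_cases hz : z = 0
    · subst hz
      rw [continuousAt_iff_punctured_nhds]
      simp only [Function.comp_apply, inv_zero]
      have h : Tendsto (fun z : ℂ => ((z⁻¹ : ℂ) : OnePoint ℂ)) (𝓝[≠] 0) (𝓝 OnePoint.infty) := by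
        refine OnePoint.tendsto_coe_infty.comp ?_
        rw [coclosedCompact_eq_cocompact, ← Metric.cobounded_eq_cocompact]
        exact tendsto_inv₀_nhdsNE_zero
      refine h.congr' ?_
      filter_upwards [self_mem_nhdsWithin] with w hw
      exact (inv_coe hw).symm
    · have h : ContinuousAt (fun w : ℂ => ((w⁻¹ : ℂ) : OnePoint ℂ)) z :=
        OnePoint.continuous_coe.continuousAt.comp (continuousAt_inv₀ hz)
      refine h.congr ?_
      filter_upwards [isOpen_ne.mem_nhds hz] with w hw
      exact (inv_coe hw).symm

/-- The inversion as a homeomorphism of the Riemann sphere. -/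
noncomputable def invHomeo : OnePoint ℂ ≃ₜ OnePoint ℂ where
  toFun := inv
  invFun := inv
  left_inv := inv_inv
  right_inv := inv_inv
  continuous_toFun := continuous_inv
  continuous_invFun := continuous_inv

/-- The affine chart `z` of the Riemann sphere, defined away from `∞`. -/
noncomputable def affineChart : OpenPartialHomeomorph (OnePoint ℂ) ℂ :=
  (OnePoint.isOpenEmbedding_coe.toOpenPartialHomeomorph ((↑) : ℂ → OnePoint ℂ)).symm

/-- The chart `w = 1 / z` of the Riemann sphere, defined away from `0`. -/
noncomputable def inftyChart : OpenPartialHomeomorph (OnePoint ℂ) ℂ :=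
  invHomeo.transOpenPartialHomeomorph affineChart

theorem affineChart_source : affineChart.source = range ((↑) : ℂ → OnePoint ℂ) := by
  simp [affineChart]

theorem affineChart_coe (z : ℂ) : affineChart (z : OnePoint ℂ) = z :=
  OnePoint.isOpenEmbedding_coe.toOpenPartialHomeomorph_left_inv _

theorem affineChart_symm (z : ℂ) : affineChart.symm z = (z : OnePoint ℂ) := rfl

theorem inftyChart_apply (x : OnePoint ℂ) : inftyChart x = affineChart (inv x) := rfl

theorem inftyChart_symm (w : ℂ) : inftyChart.symm w = inv (w : OnePoint ℂ) := rfl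

open Classical in
noncomputable instance : ChartedSpace ℂ (OnePoint ℂ) where
  atlas := {affineChart, inftyChart}
  chartAt x := if x = OnePoint.infty then inftyChart else affineChart
  mem_chart_source x := by
    induction x using OnePoint.rec with
    | infty =>
      rw [if_pos rfl]
      change inv OnePoint.infty ∈ affineChart.source
      rw [affineChart_source, inv_infty]
      exact mem_range_self _
    | coe z =>
      rw [if_neg (OnePoint.coe_ne_infty z), affineChart_source]
      exact mem_range_self _
  chart_mem_atlas x := by
    split_ifs <;> simp

theorem contDiffOn_transition (f : ℂ → ℂ) (s : Set ℂ) (hf : ∀ z ∈ s, z ≠ 0 ∧ f z = z⁻¹) :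
    ContDiffOn ℂ ω f s := by
  have h : ContDiffOn ℂ ω (fun z : ℂ => z⁻¹) s :=
    contDiffOn_id.inv fun z hz => (hf z hz).1
  exact h.congr fun z hz => (hf z hz).2

noncomputable instance : IsManifold 𝓘(ℂ) ω (OnePoint ℂ) := by
  refine isManifold_of_contDiffOn _ _ _ ?_
  have key : ∀ (e : OpenPartialHomeomorph (OnePoint ℂ) ℂ),
      ContDiffOn ℂ ω (e.symm ≫ₕ e) (e.symm ≫ₕ e).source := by
    intro e
    refine contDiffOn_id.congr fun z hz => ?_
    rw [OpenPartialHomeomorph.trans_source] at hz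
    exact e.right_inv hz.1
  have hne : ∀ z : ℂ, inv (z : OnePoint ℂ) ∈ affineChart.source → z ≠ 0 := by
    rintro z hz rfl
    rw [affineChart_source, inv_zero] at hz
    obtain ⟨w, hw⟩ := hz
    exact OnePoint.coe_ne_infty w hw
  have hval : ∀ z : ℂ, z ≠ 0 → affineChart (inv (z : OnePoint ℂ)) = z⁻¹ := by
    intro z hz
    rw [inv_coe hz, affineChart_coe]
  intro e e' he he'
  simp only [modelWithCornersSelf_coe, modelWithCornersSelf_coe_symm, Function.comp_id,
    Function.id_comp, preimage_id, range_id, inter_univ]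
  rcases he with rfl | rfl <;> rcases he' with rfl | rfl
  · exact key _
  · refine contDiffOn_transition _ _ fun z hz => ?_
    have hz' : inv (z : OnePoint ℂ) ∈ affineChart.source := by
      rw [OpenPartialHomeomorph.trans_source] at hz
      exact hz.2
    exact ⟨hne z hz', hval z (hne z hz')⟩
  · refine contDiffOn_transition _ _ fun z hz => ?_
    have hz' : inv (z : OnePoint ℂ) ∈ affineChart.source := by
      rw [OpenPartialHomeomorph.trans_source] at hz
      exact hz.2
    exact ⟨hne z hz', hval z (hne z hz')⟩
  · exact key _

end RiemannSphere

/-! ### Quadratic differentials on Riemann surfaces and their flat geometry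

A Riemann surface is a space `M` with a `ChartedSpace ℂ M` and an `IsManifold 𝓘(ℂ) ω M` structure.
-/

/-- A (not necessarily continuous) quadratic differential on `M`: a function on tangent vectors
that is homogeneous of degree two on every tangent line. Its values at isolated points, such as
poles, play no role. -/
structure QuadDiff (M : Type*) [TopologicalSpace M] [ChartedSpace ℂ M] where
  /-- The value of the differential on a tangent vector. -/
  toFun : ∀ x : M, TangentSpace 𝓘(ℂ) x → ℂ
  /-- The differential is homogeneous of degree two. -/
  map_smul : ∀ (x : M) (c : ℂ) (v : TangentSpace 𝓘(ℂ) x), toFun x (c • v) = c ^ 2 * toFun x v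

namespace QuadDiff

section

variable {M : Type*} [TopologicalSpace M] [ChartedSpace ℂ M]

/-- The coefficient of `q` in the coordinate `ζ` given by `e`: there, `q = q.coeff e ζ * dζ²`. -/
noncomputable def coeff (q : QuadDiff M) (e : OpenPartialHomeomorph M ℂ) (ζ : ℂ) : ℂ :=
  q.toFun (e.symm ζ) (mfderiv 𝓘(ℂ) 𝓘(ℂ) e.symm ζ (1 : ℂ))

/-- The pull-back `f^* q`, that is, `(f^* q)(v) = q (df v)`. -/
noncomputable def pullback {N : Type*} [TopologicalSpace N] [ChartedSpace ℂ N]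
    (q : QuadDiff N) (f : M → N) : QuadDiff M where
  toFun x v := q.toFun (f x) (mfderiv 𝓘(ℂ) 𝓘(ℂ) f x v)
  map_smul x c v := by
    rw [ContinuousLinearMap.map_smul]
    exact q.map_smul _ _ _

/-- `q` is a meromorphic quadratic differential on `M` which has order `κ i` at the point `z i`
(a zero of that order, a marked point if `κ i = 0`, a pole if `κ i < 0`), the points `z i` being
distinct, and which is holomorphic without zeros elsewhere. -/
structure HasDivisor (q : QuadDiff M) {s : ℕ} (z : Fin s → M) (κ : Fin s → ℤ) : Prop where
  injective : Function.Injective z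
  meromorphicAt : ∀ i, MeromorphicAt (q.coeff (chartAt ℂ (z i))) (chartAt ℂ (z i) (z i))
  order_eq : ∀ i, meromorphicOrderAt (q.coeff (chartAt ℂ (z i))) (chartAt ℂ (z i) (z i)) = κ i
  analyticAt : ∀ x ∉ range z, AnalyticAt ℂ (q.coeff (chartAt ℂ x)) (chartAt ℂ x x)
  ne_zero : ∀ x ∉ range z, q.coeff (chartAt ℂ x) (chartAt ℂ x x) ≠ 0

/-- `e` is a natural (flat) coordinate of the half-translation surface `(M, q)`: a holomorphic
coordinate `ζ` in which `q = dζ²`, up to the meaningless values of `q` at isolated points. -/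
def IsNaturalChart [IsManifold 𝓘(ℂ) ω M] (q : QuadDiff M) (e : OpenPartialHomeomorph M ℂ) :
    Prop :=
  e ∈ IsManifold.maximalAtlas 𝓘(ℂ) ω M ∧
    ∀ ζ₀ ∈ e.target, ∀ᶠ ζ in 𝓝[≠] ζ₀, q.coeff e ζ = 1

/-- A regular point of `(M, q)`: one that lies in a natural coordinate, that is, neither a zero
nor a pole of `q`. -/
def IsRegularPoint [IsManifold 𝓘(ℂ) ω M] (q : QuadDiff M) (p : M) : Prop :=
  ∃ e : OpenPartialHomeomorph M ℂ, q.IsNaturalChart e ∧ p ∈ e.source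

/-- `γ`, restricted to `[0, T]`, is a line segment of length `T > 0` from `p` to `p'` on `(M, q)`,
parametrized by arc length: its interior consists of regular points, and near each of these it is
a straight line in a natural coordinate. -/
structure IsLineSegment [IsManifold 𝓘(ℂ) ω M] (q : QuadDiff M) (p p' : M) (T : ℝ)
    (γ : ℝ → M) : Prop where
  pos : 0 < T
  continuousOn : ContinuousOn γ (Icc 0 T)
  source : γ 0 = p
  target : γ T = p'
  straight : ∀ t ∈ Ioo 0 T, ∃ e : OpenPartialHomeomorph M ℂ, q.IsNaturalChart e ∧
    γ t ∈ e.source ∧ ∃ v : ℂ, ‖v‖ = 1 ∧ ∀ᶠ r in 𝓝 t, e (γ r) = e (γ t) + ((r - t : ℝ) : ℂ) * v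

/-- The points `p` and `p'` of `(M, q)` are finitely blocked by `B`: the set `B` is finite, does
not contain `p` or `p'`, and meets every line segment from `p` to `p'`. -/
structure IsFinitelyBlockedBy [IsManifold 𝓘(ℂ) ω M] (q : QuadDiff M) (p p' : M)
    (B : Set M) : Prop where
  finite : B.Finite
  source_notMem : p ∉ B
  target_notMem : p' ∉ B
  blocks : ∀ (T : ℝ) (γ : ℝ → M), q.IsLineSegment p p' T γ → ∃ t ∈ Icc 0 T, γ t ∈ B

end

end QuadDiff

/-! ### Cyclic covers of the sphere and generalized Eierlegende-Wollmilchsaus -/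

/-- The positively oriented circle of radius `r` around the point `z` of a Riemann surface,
drawn in the preferred chart at `z`. -/
noncomputable def smallCircle {M : Type*} [TopologicalSpace M] [ChartedSpace ℂ M] (z : M)
    (r : ℝ) (t : ℝ) : M :=
  (chartAt ℂ z).symm (chartAt ℂ z z + r * Complex.exp (2 * Real.pi * Complex.I * t))

/-- The compact Riemann surface `X`, with the action of `ℤ/k` and the holomorphic map `π` to the
Riemann sphere, is the `ℤ/k`-cover branched over the points `z i` with local monodromy `a i`:
`π` is the quotient by `ℤ/k`, over the complement of the points `z i` it is a covering map and the
action is free, and lifting a small positive loop around `z i` leads from any starting point `x`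
in the fibre to `a i +ᵥ x`. -/
structure IsCyclicCover (k : ℕ) {s : ℕ} (a : Fin s → ZMod k) (z : Fin s → OnePoint ℂ)
    {X : Type*} [TopologicalSpace X] [ChartedSpace ℂ X] [AddAction (ZMod k) X]
    (π : X → OnePoint ℂ) : Prop where
  holomorphic : MDifferentiable 𝓘(ℂ) 𝓘(ℂ) π
  surjective : Function.Surjective π
  holomorphic_vadd : ∀ g : ZMod k, MDifferentiable 𝓘(ℂ) 𝓘(ℂ) (fun x : X => g +ᵥ x)
  fiber : ∀ x y : X, π x = π y ↔ ∃ g : ZMod k, g +ᵥ x = y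
  free : ∀ (g : ZMod k) (x : X), π x ∉ range z → g +ᵥ x = x → g = 0
  isCoveringMapOn : IsCoveringMapOn π (range z)ᶜ
  monodromy : ∀ i, ∀ᶠ r in 𝓝[>] (0 : ℝ), ∀ c : ℝ → X, ContinuousOn c (Icc 0 1) →
    (∀ t ∈ Icc (0 : ℝ) 1, π (c t) = smallCircle (z i) r t) → c 1 = a i +ᵥ c 0

/-- The data `κ`, `a` define a generalized Eierlegende-Wollmilchsau `𝓔(κ, a)` of `ℤ/2ℓ`-covers:
`κ` is the type of a genus zero stratum of quadratic differentials with at most simple poles,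
`a` defines connected `ℤ/2ℓ`-covers of the surfaces in it, and the three conditions in the
definition of a generalized Eierlegende-Wollmilchsau hold. The subgroup `ℤ/ℓ ⊂ ℤ/2ℓ` is the one
generated by `2`. -/
structure IsGeneralizedEW (ℓ : ℕ) {s : ℕ} (κ : Fin s → ℤ) (a : Fin s → ZMod (2 * ℓ)) :
    Prop where
  neg_one_le : ∀ i, -1 ≤ κ i
  sum_order : ∑ i, κ i = -4
  sum_monodromy : ∑ i, a i = 0
  generate : AddSubgroup.closure (range a) = ⊤
  one_lt : 1 < ℓ
  parity : ∀ i, Even (κ i) ↔ Even (a i)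
  generator : ∀ I : Finset (Fin s), ∑ i ∈ I, κ i = -2 →
    AddSubgroup.zmultiples (∑ i ∈ I, a i) = AddSubgroup.zmultiples (2 : ZMod (2 * ℓ))

/-! ### Continuous logarithms and winding numbers -/

/-! Suppose that a segment from p to itself misses the other points of the orbit of p. On X the
pull-back of q is a square ω², so a straight line keeps one direction, and at its first return to p
the segment closes up without a corner. This gives a closed geodesic γ that meets the orbit of p
once per period (`FlatCover.exists_closed_line`).

The deck group acts on ω through signs. Let g carry some point of γ to a point of γ. If its sign is
+1, then gγ is γ with time shifted; since γ meets the orbit of p only once, the shift is a period,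
so g fixes γ pointwise and g = 0. If its sign is -1, then gγ is γ run backwards, and g fixes two
points of γ half a period apart. Regular points with non-trivial stabilizer lie over simple poles,
where the local monodromy a_i is odd and killed by 2, hence equal to ℓ. Two such poles have total
order -2 and total monodromy 0, against the hypothesis (`FlatCover.eq_zero_of_vadd_eq`). So γ
projects to a simple closed curve w on the sphere, and the projection is unramified along γ.

Take a coordinate U of the sphere whose pole is off w. There q = C ∏ (U - c)^κ(c) dU², and q(w') is
constant, so its winding number is 0. Since the tangent of w turns by ±1 (Umlaufsatz), the orders κ
of the points enclosed by w add up to -2. As w lifts to the closed curve γ, the monodromies of these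
points add up to 0 in ℤ/2ℓ. By hypothesis this sum generates ℤ/ℓ, which is non-trivial because ℓ >
1: a contradiction (`FlatCover.false_of_closed_line`).

Two tools carry the argument. The winding numbers of a simple closed curve and of its derivative are
both read off from one difference quotient on the torus (`IsSimpleClosedCurve.exists_winding`). The
monodromy is encoded in a Kummer function F on X, a root of order k = 2ℓ of ∏ (U - c)^α(c) on which
the deck group acts through the standard character (`IsCyclicCover.exists_kummer`). Its power F^ℓ
supplies ω (`FlatCover.exists_isSqrtCoeff`), and continuing F along γ shows that the enclosed
monodromy vanishes (`FlatCover.dvd_sum_of_hasWinding`). -/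

theorem exists_int_of_exp_eq {A : Type*} [TopologicalSpace A] [PreconnectedSpace A] [Nonempty A]
    {f g : A → ℂ} (hf : Continuous f) (hg : Continuous g)
    (h : ∀ x, Complex.exp (f x) = Complex.exp (g x)) :
    ∃ n : ℤ, ∀ x, f x = g x + n * (2 * Real.pi * Complex.I) := by
  obtain ⟨x₀⟩ := ‹Nonempty A›
  obtain ⟨n, hn⟩ := Complex.exp_eq_exp_iff_exists_int.1 (h x₀)
  refine ⟨n, fun x => ?_⟩
  have := Complex.isCoveringMap_exp.eq_of_comp_eq (g₁ := f)
    (g₂ := fun x => g x + n * (2 * Real.pi * Complex.I)) hf (by fun_prop) ?_ x₀ hn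
  · exact congrFun this x
  · funext y
    simp only [Function.comp_apply, Subtype.mk.injEq]
    rw [Complex.exp_add, Complex.exp_int_mul_two_pi_mul_I, mul_one, h]

theorem exists_continuousOn_log {E : Type*} [NormedAddCommGroup E] [NormedSpace ℝ E] {U : Set E}
    (hU : Convex ℝ U) (hUo : IsOpen U) (hUn : U.Nonempty) {g : E → ℂ} (hg : ContinuousOn g U)
    (h0 : ∀ x ∈ U, g x ≠ 0) :
    ∃ f : E → ℂ, ContinuousOn f U ∧ ∀ x ∈ U, Complex.exp (f x) = g x := by
  have : ContractibleSpace U := hU.contractibleSpace hUn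
  have hs : IsSimplyConnected U := (inferInstance : SimplyConnectedSpace U)
  obtain ⟨f, hf, hfg⟩ := Complex.exists_continuousOn_eqOn_exp_comp hs hUo hg
    (by rintro ⟨x, hx, h⟩; exact h0 x hx h)
  exact ⟨f, hf, hfg⟩

theorem exists_continuous_log {E : Type*} [NormedAddCommGroup E] [NormedSpace ℝ E]
    {g : E → ℂ} (hg : Continuous g) (h0 : ∀ x, g x ≠ 0) :
    ∃ f : E → ℂ, Continuous f ∧ ∀ x, Complex.exp (f x) = g x := by
  obtain ⟨f, hf, h⟩ := exists_continuousOn_log convex_univ isOpen_univ univ_nonempty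
    hg.continuousOn (fun x _ => h0 x)
  exact ⟨f, continuousOn_univ.1 hf, fun x => h x trivial⟩

/-- The nowhere vanishing continuous `2π`-periodic function `G` has winding number `n`
around `0`. -/
def HasWinding (G : ℝ → ℂ) (n : ℤ) : Prop :=
  ∃ L : ℝ → ℂ, Continuous L ∧ (∀ s, Complex.exp (L s) = G s) ∧
    ∀ s, L (s + 2 * Real.pi) = L s + n * (2 * Real.pi * Complex.I)

namespace HasWinding

variable {G H : ℝ → ℂ} {n m : ℤ}

theorem unique (h : HasWinding G n) (h' : HasWinding G m) : n = m := by
  obtain ⟨L, hL, hG, hn⟩ := h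
  obtain ⟨L', hL', hG', hm⟩ := h'
  obtain ⟨j, hj⟩ := exists_int_of_exp_eq hL hL' (fun s => (hG s).trans (hG' s).symm)
  have h1 := hj (0 + 2 * Real.pi)
  rw [hn, hm, hj 0] at h1
  have h2 : (n : ℂ) * (2 * Real.pi * Complex.I) = m * (2 * Real.pi * Complex.I) := by
    linear_combination h1
  exact_mod_cast mul_right_cancel₀ Complex.two_pi_I_ne_zero h2

theorem mul (h : HasWinding G n) (h' : HasWinding H m) :
    HasWinding (fun s => G s * H s) (n + m) := by
  obtain ⟨L, hL, hG, hn⟩ := h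
  obtain ⟨L', hL', hG', hm⟩ := h'
  refine ⟨fun s => L s + L' s, hL.add hL', fun s => ?_, fun s => ?_⟩
  · rw [Complex.exp_add, hG, hG']
  · simp only [hn, hm]; push_cast; ring

theorem zpow (h : HasWinding G n) (j : ℤ) : HasWinding (fun s => G s ^ j) (j * n) := by
  obtain ⟨L, hL, hG, hn⟩ := h
  refine ⟨fun s => j * L s, by fun_prop, fun s => ?_, fun s => ?_⟩
  · rw [Complex.exp_int_mul, hG]
  · simp only [hn]; push_cast; ring

theorem pow (h : HasWinding G n) (j : ℕ) : HasWinding (fun s => G s ^ j) (j * n) := by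
  simpa using h.zpow j

theorem const {c : ℂ} (hc : c ≠ 0) : HasWinding (fun _ => c) 0 :=
  ⟨fun _ => Complex.log c, continuous_const, fun _ => Complex.exp_log hc, fun _ => by simp⟩

theorem congr (h : HasWinding G n) (hGH : ∀ s, H s = G s) : HasWinding H n := by
  rwa [show H = G from funext hGH]

theorem prod {ι : Type*} (t : Finset ι) {G : ι → ℝ → ℂ} {n : ι → ℤ}
    (h : ∀ i ∈ t, HasWinding (G i) (n i)) :
    HasWinding (fun s => ∏ i ∈ t, G i s) (∑ i ∈ t, n i) := by
  classical
  induction t using Finset.induction_on with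
  | empty => simpa using const one_ne_zero
  | insert i t hi ih =>
    rw [Finset.sum_insert hi]
    refine ((h i (by simp)).mul (ih fun j hj => h j (by simp [hj]))).congr fun s => ?_
    rw [Finset.prod_insert hi]

theorem exists_of_periodic (hG : Continuous G) (h0 : ∀ s, G s ≠ 0)
    (hp : ∀ s, G (s + 2 * Real.pi) = G s) : ∃ n, HasWinding G n := by
  obtain ⟨L, hL, hLG⟩ := exists_continuous_log hG h0
  obtain ⟨n, hn⟩ := exists_int_of_exp_eq (f := fun s => L (s + 2 * Real.pi)) (g := L)
    (by fun_prop) hL (fun s => by rw [hLG, hLG, hp])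
  exact ⟨n, L, hL, hLG, hn⟩

/-- The values stay in the slit plane, where the principal logarithm is continuous, and so the
logarithm is itself periodic. -/
theorem of_norm_sub_one_lt (hG : Continuous G) (h1 : ∀ s, ‖G s - 1‖ < 1)
    (hp : ∀ s, G (s + 2 * Real.pi) = G s) : HasWinding G 0 := by
  have hs : ∀ s, G s ∈ Complex.slitPlane := fun s => by
    simpa using Complex.mem_slitPlane_of_norm_lt_one (h1 s)
  refine ⟨fun s => Complex.log (G s), hG.clog hs, fun s => Complex.exp_log ?_, fun s => ?_⟩
  · exact Complex.slitPlane_ne_zero (hs s)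
  · simp [hp]

theorem ne_zero (h : HasWinding G n) (s : ℝ) : G s ≠ 0 := by
  obtain ⟨L, -, hG, -⟩ := h
  rw [← hG]; exact Complex.exp_ne_zero _

theorem continuous (h : HasWinding G n) : Continuous G := by
  obtain ⟨L, hL, hG, -⟩ := h
  rw [show G = fun s => Complex.exp (L s) from funext fun s => (hG s).symm]
  fun_prop

theorem periodic (h : HasWinding G n) (s : ℝ) : G (s + 2 * Real.pi) = G s := by
  obtain ⟨L, hL, hG, hn⟩ := h
  rw [← hG, hn, Complex.exp_add, Complex.exp_int_mul_two_pi_mul_I, mul_one, hG]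

/-- Rouché's theorem for winding numbers. -/
theorem of_norm_sub_lt (h : HasWinding G n) (hH : Continuous H)
    (hp : ∀ s, H (s + 2 * Real.pi) = H s) (hlt : ∀ s, ‖H s - G s‖ < ‖G s‖) : HasWinding H n := by
  have h1 : HasWinding (fun s => H s / G s) 0 := by
    refine of_norm_sub_one_lt (hH.div h.continuous h.ne_zero) (fun s => ?_) (fun s => ?_)
    · rw [div_sub_one (h.ne_zero s), norm_div, div_lt_one (norm_pos_iff.2 (h.ne_zero s))]
      exact hlt s
    · rw [hp, h.periodic]
  have h2 := h.mul h1
  rw [add_zero] at h2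
  exact h2.congr fun s => (mul_div_cancel₀ _ (h.ne_zero s)).symm

theorem exp_I : HasWinding (fun s => Complex.exp (Complex.I * s)) 1 :=
  ⟨fun s => Complex.I * s, by fun_prop, fun _ => rfl, fun s => by push_cast; ring⟩

/-- Homotopy invariance: a logarithm on the whole (s, τ)-plane gains the same multiple of 2πi over a
period for every τ. -/
theorem of_segment {u : ℝ → ℂ} (hu : Continuous u) {c c' : ℂ}
    (hd : ∀ τ ∈ Icc (0 : ℝ) 1, ∀ s, u s ≠ c + τ * (c' - c))
    (h : HasWinding (fun s => u s - c) n) : HasWinding (fun s => u s - c') n := by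
  have hp : ∀ s, u (s + 2 * Real.pi) = u s := fun s => by
    have := h.periodic s
    simpa using this
  -- Clamping τ to [0, 1] makes the homotopy nowhere zero on all of ℝ × ℝ, where a continuous
  -- logarithm exists.
  let cl : ℝ → ℝ := fun τ => max 0 (min 1 τ)
  have hcl : ∀ τ, cl τ ∈ Icc (0 : ℝ) 1 := fun τ =>
    ⟨le_max_left _ _, max_le zero_le_one (min_le_left _ _)⟩
  obtain ⟨L, hL, hLG⟩ := exists_continuous_log
    (g := fun p : ℝ × ℝ => u p.1 - (c + (cl p.2 : ℝ) * (c' - c)))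
    (by simp only [cl]; fun_prop) (fun p => sub_ne_zero.2 (hd _ (hcl p.2) p.1))
  obtain ⟨j, hj⟩ := exists_int_of_exp_eq (f := fun p : ℝ × ℝ => L (p.1 + 2 * Real.pi, p.2))
    (g := L) (by fun_prop) hL (fun p => by rw [hLG, hLG]; simp only [hp])
  have h0 : HasWinding (fun s => u s - c) j :=
    ⟨fun s => L (s, 0), by fun_prop, fun s => by rw [hLG]; simp [cl], fun s => hj (s, 0)⟩
  rw [h.unique h0]
  exact ⟨fun s => L (s, 1), by fun_prop, fun s => by rw [hLG]; simp [cl], fun s => hj (s, 1)⟩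

end HasWinding

/-! ### Simple closed curves in the plane -/

/-- The difference quotient of a `C¹` function is jointly continuous on the diagonal. -/
theorem tendsto_slope_diagonal {u u' : ℝ → ℂ} (hu : ∀ s, HasDerivAt u (u' s) s)
    (hu' : Continuous u') (t : ℝ) :
    Tendsto (fun p : ℝ × ℝ => if p.1 = p.2 then u' p.1 else (u p.1 - u p.2) / ((p.1 - p.2 : ℝ) : ℂ))
      (𝓝 (t, t)) (𝓝 (u' t)) := by
  have hst : HasStrictDerivAt u (u' t) t :=
    hasStrictDerivAt_of_hasDerivAt_of_continuousAt (Eventually.of_forall hu) hu'.continuousAt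
  rw [hasStrictDerivAt_iff_hasStrictFDerivAt] at hst
  have ho := hst.isLittleO
  rw [Metric.tendsto_nhds]
  intro ε hε
  have h1 := ho.bound (half_pos hε)
  have h2 : ∀ᶠ p : ℝ × ℝ in 𝓝 (t, t), dist (u' p.1) (u' t) < ε :=
    (hu'.comp continuous_fst).continuousAt.eventually (Metric.ball_mem_nhds _ hε)
  filter_upwards [h1, h2] with p hp hp2
  split_ifs with h
  · exact hp2
  · have hne : ((p.1 - p.2 : ℝ) : ℂ) ≠ 0 := by exact_mod_cast sub_ne_zero.2 h
    rw [dist_eq_norm, div_sub' hne, norm_div, div_lt_iff₀ (norm_pos_iff.2 hne)]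
    refine lt_of_le_of_lt ?_ (mul_lt_mul_of_pos_right (half_lt_self hε) (norm_pos_iff.2 hne))
    simpa [← Complex.ofReal_sub] using hp

theorem exp_I_eq_iff {s t : ℝ} :
    Complex.exp (Complex.I * s) = Complex.exp (Complex.I * t) ↔
      ∃ n : ℤ, s = t + n * (2 * Real.pi) := by
  rw [Complex.exp_eq_exp_iff_exists_int]
  refine exists_congr fun n => ?_
  rw [show Complex.I * t + n * (2 * Real.pi * Complex.I) =
      Complex.I * (t + n * (2 * Real.pi)) by ring,
    mul_right_inj' Complex.I_ne_zero]
  norm_cast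

theorem hasDerivAt_exp_I (s : ℝ) : HasDerivAt (fun s : ℝ => Complex.exp (Complex.I * s))
    (Complex.I * Complex.exp (Complex.I * s)) s := by
  have h1 : HasDerivAt (fun s : ℝ => Complex.I * (s : ℂ)) Complex.I s := by
    simpa using (Complex.ofRealCLM.hasDerivAt (x := s)).const_mul Complex.I
  have := h1.cexp
  rwa [mul_comm] at this

/-- A simple closed regular plane curve of class `C¹`, parametrized with period `2π`. -/
structure IsSimpleClosedCurve (u u' : ℝ → ℂ) : Prop where
  hasDerivAt : ∀ s, HasDerivAt u (u' s) s
  continuous_deriv : Continuous u'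
  deriv_ne_zero : ∀ s, u' s ≠ 0
  periodic : ∀ s, u (s + 2 * Real.pi) = u s
  injective : ∀ s t, u s = u t → ∃ n : ℤ, s = t + n * (2 * Real.pi)

namespace IsSimpleClosedCurve

variable {u u' : ℝ → ℂ} (h : IsSimpleClosedCurve u u')
include h

theorem continuous : Continuous u :=
  continuous_iff_continuousAt.2 fun s => (h.hasDerivAt s).continuousAt

theorem periodic_int (s : ℝ) (n : ℤ) : u (s + n * (2 * Real.pi)) = u s :=
  (show Function.Periodic u (2 * Real.pi) from h.periodic).int_mul n s

theorem periodic_deriv (s : ℝ) : u' (s + 2 * Real.pi) = u' s := by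
  have h1 := (h.hasDerivAt (s + 2 * Real.pi)).comp_add_const s (2 * Real.pi)
  simp only [h.periodic] at h1
  exact h1.unique (h.hasDerivAt s)

theorem periodic_deriv_int (s : ℝ) (n : ℤ) : u' (s + n * (2 * Real.pi)) = u' s :=
  (show Function.Periodic u' (2 * Real.pi) from h.periodic_deriv).int_mul n s

end IsSimpleClosedCurve

open Classical in
/-- The difference quotient of `u` with respect to the standard parametrization of the circle. -/
noncomputable def circleSlope (u u' : ℝ → ℂ) (p : ℝ × ℝ) : ℂ :=
  if Complex.exp (Complex.I * p.1) = Complex.exp (Complex.I * p.2) then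
    u' p.1 / (Complex.I * Complex.exp (Complex.I * p.1))
  else (u p.1 - u p.2) / (Complex.exp (Complex.I * p.1) - Complex.exp (Complex.I * p.2))

namespace IsSimpleClosedCurve

variable {u u' : ℝ → ℂ} (h : IsSimpleClosedCurve u u')
include h

theorem circleSlope_mul (s t : ℝ) :
    circleSlope u u' (s, t) * (Complex.exp (Complex.I * s) - Complex.exp (Complex.I * t)) =
      u s - u t := by
  simp only [circleSlope]
  split_ifs with hst
  · obtain ⟨n, rfl⟩ := exp_I_eq_iff.1 hst
    rw [hst, h.periodic_int]; simp
  · exact div_mul_cancel₀ _ (sub_ne_zero.2 hst)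

theorem circleSlope_ne_zero (p : ℝ × ℝ) : circleSlope u u' p ≠ 0 := by
  rw [circleSlope]
  split_ifs with hp
  · exact div_ne_zero (h.deriv_ne_zero _) (mul_ne_zero Complex.I_ne_zero (Complex.exp_ne_zero _))
  · refine div_ne_zero (sub_ne_zero.2 fun he => hp ?_) (sub_ne_zero.2 hp)
    exact exp_I_eq_iff.2 (h.injective _ _ he)

theorem circleSlope_periodic (s t : ℝ) (n : ℤ) :
    circleSlope u u' (s + n * (2 * Real.pi), t) = circleSlope u u' (s, t) := by
  have : Complex.exp (Complex.I * ((s + n * (2 * Real.pi) : ℝ) : ℂ)) =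
      Complex.exp (Complex.I * s) :=
    exp_I_eq_iff.2 ⟨n, rfl⟩
  simp only [circleSlope, this, h.periodic_int, h.periodic_deriv_int]

theorem circleSlope_symm (s t : ℝ) : circleSlope u u' (s, t) = circleSlope u u' (t, s) := by
  simp only [circleSlope, eq_comm (a := Complex.exp (Complex.I * t))]
  split_ifs with hst
  · obtain ⟨n, rfl⟩ := exp_I_eq_iff.1 hst
    rw [hst, h.periodic_deriv_int]
  · rw [← neg_sub, ← neg_sub (Complex.exp (Complex.I * t)), neg_div_neg_eq]

/-- Near the diagonal this is the ratio of the difference quotients of `u` and of `exp (I * s)`;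
both extend continuously and the second has a non-zero limit. -/
theorem continuousAt_circleSlope_diag (t : ℝ) : ContinuousAt (circleSlope u u') (t, t) := by
  have h1 := tendsto_slope_diagonal h.hasDerivAt h.continuous_deriv t
  have h2 := tendsto_slope_diagonal hasDerivAt_exp_I (by fun_prop) t
  have h3 := h1.div h2 (mul_ne_zero Complex.I_ne_zero (Complex.exp_ne_zero _))
  have hval : circleSlope u u' (t, t) = u' t / (Complex.I * Complex.exp (Complex.I * t)) := by
    simp [circleSlope]
  rw [ContinuousAt, hval]
  refine h3.congr' ?_
  -- At distance less than 2π, equality on the circle means equality of the parameters.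
  have hnear : ∀ᶠ p : ℝ × ℝ in 𝓝 (t, t), |p.1 - p.2| < 2 * Real.pi := by
    have : Continuous fun p : ℝ × ℝ => |p.1 - p.2| := by fun_prop
    exact this.continuousAt.eventually_lt_const (by simp [Real.pi_pos])
  filter_upwards [hnear] with p hp
  simp only [Pi.div_apply, circleSlope]
  by_cases hpe : p.1 = p.2
  · simp [hpe]
  · have hne : Complex.exp (Complex.I * p.1) ≠ Complex.exp (Complex.I * p.2) := by
      intro he
      obtain ⟨n, hn⟩ := exp_I_eq_iff.1 he
      rw [hn, add_sub_cancel_left, abs_mul, abs_of_pos Real.two_pi_pos] at hp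
      have h1 : |(n : ℝ)| < 1 := by
        have := Real.two_pi_pos
        nlinarith
      have h2 : n = 0 := by
        rw [← Int.abs_lt_one_iff]; exact_mod_cast h1
      exact hpe (by rw [hn, h2]; simp)
    have hne' : ((p.1 - p.2 : ℝ) : ℂ) ≠ 0 := by exact_mod_cast sub_ne_zero.2 hpe
    rw [if_neg hpe, if_neg hpe, if_neg hne, div_div_div_cancel_right₀ hne']

theorem continuous_circleSlope : Continuous (circleSlope u u') := by
  rw [continuous_iff_continuousAt]
  rintro ⟨s, t⟩
  by_cases hst : Complex.exp (Complex.I * s) = Complex.exp (Complex.I * t)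
  · obtain ⟨n, rfl⟩ := exp_I_eq_iff.1 hst
    have h1 : circleSlope u u' =
        circleSlope u u' ∘ fun p : ℝ × ℝ => (p.1 - n * (2 * Real.pi), p.2) := by
      funext p
      have := h.circleSlope_periodic (p.1 - n * (2 * Real.pi)) p.2 n
      simpa using this
    rw [h1]
    refine ContinuousAt.comp ?_ (by fun_prop)
    simpa using h.continuousAt_circleSlope_diag t
  · have hd : ∀ᶠ p : ℝ × ℝ in 𝓝 (s, t),
        Complex.exp (Complex.I * p.1) - Complex.exp (Complex.I * p.2) ≠ 0 := by
      have : Continuous fun p : ℝ × ℝ =>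
        Complex.exp (Complex.I * p.1) - Complex.exp (Complex.I * p.2) := by fun_prop
      exact this.continuousAt.eventually_ne (sub_ne_zero.2 hst)
    have hu := h.continuous
    have h2 : ContinuousAt (fun p : ℝ × ℝ => (u p.1 - u p.2) /
        (Complex.exp (Complex.I * p.1) - Complex.exp (Complex.I * p.2))) (s, t) :=
      ContinuousAt.div (by fun_prop) (by fun_prop) (sub_ne_zero.2 hst)
    refine h2.congr ?_
    filter_upwards [hd] with p hp
    rw [circleSlope, if_neg (sub_ne_zero.1 hp)]

/-- The common winding number `m` of the difference quotient in each of its variables. -/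
theorem exists_winding_circleSlope : ∃ m : ℤ, HasWinding u' (2 * m + 1) ∧
    ∀ t, HasWinding (fun s => circleSlope u u' (s, t)) m := by
  obtain ⟨L, hL, hLK⟩ := exists_continuous_log h.continuous_circleSlope h.circleSlope_ne_zero
  obtain ⟨m, hm⟩ := exists_int_of_exp_eq (f := fun p : ℝ × ℝ => L (p.1 + 2 * Real.pi, p.2))
    (g := L) (by fun_prop) hL (fun p => by
      rw [hLK, hLK]; simpa using h.circleSlope_periodic p.1 p.2 1)
  obtain ⟨j, hj⟩ := exists_int_of_exp_eq (f := fun p : ℝ × ℝ => L (p.2, p.1))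
    (g := L) (by fun_prop) hL (fun p => by rw [hLK, hLK]; exact h.circleSlope_symm _ _)
  -- The two logarithms of the symmetric quotient differ by a constant, which is 0 because they
  -- agree at (0, 0).
  have hsymm : ∀ s t, L (t, s) = L (s, t) := by
    intro s t
    have h0 := hj (0, 0)
    simp only [left_eq_add] at h0
    have := hj (s, t)
    rwa [h0, add_zero] at this
  have hm1 : ∀ s t, L (s + 2 * Real.pi, t) = L (s, t) + m * (2 * Real.pi * Complex.I) :=
    fun s t => hm (s, t)
  refine ⟨m, ?_, fun t => ⟨fun s => L (s, t), by fun_prop, fun s => hLK _, fun s => hm1 s t⟩⟩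
  -- Along the diagonal both variables advance by a period, and by symmetry each contributes m.
  have h1 : HasWinding (fun s => circleSlope u u' (s, s)) (2 * m) := by
    refine ⟨fun s => L (s, s), by fun_prop, fun s => hLK _, fun s => ?_⟩
    simp only
    rw [hm1, hsymm, hm1]; push_cast; ring
  -- On the diagonal the quotient is u' / (i e^{is}); the denominator accounts for the extra 1 in 2m
  -- + 1.
  have h2 := (h1.mul HasWinding.exp_I).mul (HasWinding.const Complex.I_ne_zero)
  rw [add_zero] at h2
  refine h2.congr fun s => ?_
  simp only [circleSlope, if_true]
  field_simp [Complex.exp_ne_zero]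

end IsSimpleClosedCurve

theorem continuous_exp_I : Continuous fun s : ℝ => Complex.exp (Complex.I * s) := by fun_prop

theorem exp_I_periodic (s : ℝ) : Complex.exp (Complex.I * ((s + 2 * Real.pi : ℝ) : ℂ)) =
    Complex.exp (Complex.I * s) :=
  exp_I_eq_iff.2 ⟨1, by simp⟩

theorem norm_exp_I (s : ℝ) : ‖Complex.exp (Complex.I * s)‖ = 1 := by
  rw [mul_comm, Complex.norm_exp_ofReal_mul_I]

theorem hasWinding_circle_sub_of_lt {c : ℂ} (hc : ‖c‖ < 1) :
    HasWinding (fun s => Complex.exp (Complex.I * s) - c) 1 :=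
  HasWinding.exp_I.of_norm_sub_lt (by fun_prop) (fun s => by simp only [exp_I_periodic])
    fun s => by simpa [norm_exp_I] using hc

theorem hasWinding_sub_of_norm_lt {u : ℝ → ℂ} (hu : Continuous u)
    (hp : ∀ s, u (s + 2 * Real.pi) = u s) {c : ℂ} (hc : ∀ s, ‖u s‖ < ‖c‖) :
    HasWinding (fun s => u s - c) 0 := by
  have hc0 : c ≠ 0 := by
    rintro rfl
    exact absurd (hc 0) (by simp)
  exact (HasWinding.const (neg_ne_zero.2 hc0)).of_norm_sub_lt (by fun_prop)
    (fun s => by simp only [hp]) fun s => by simpa using hc s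

theorem exists_mem_Icc_of_periodic (t s : ℝ) :
    ∃ s' ∈ Icc (t - Real.pi) (t + Real.pi), ∃ n : ℤ, s = s' + n * (2 * Real.pi) := by
  have := existsUnique_add_zsmul_mem_Ico Real.two_pi_pos s (t - Real.pi)
  obtain ⟨n, hn, -⟩ := this
  refine ⟨_, ⟨hn.1, hn.2.le.trans (by linarith)⟩, -n, ?_⟩
  push_cast; simp

namespace IsSimpleClosedCurve

variable {u u' : ℝ → ℂ} (h : IsSimpleClosedCurve u u')
include h

/-- With K the quotient at `t` and E the circle, u s - u t = K s (E s - E t). Moving the base point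
by τ i u'(t) replaces E t by (1 - τ) E t up to the error τ E t (K t - K s), because K t E t = -i
u'(t). The error is dominated near `t` by continuity of K and elsewhere by smallness of τ. By Rouché
the winding number is m plus that of the circle around (1 - τ) E t, which is 0 or 1 according to the
side. -/
theorem hasWinding_near {m : ℤ}
    (hm : ∀ t, HasWinding (fun s => circleSlope u u' (s, t)) m) (t : ℝ) :
    ∃ δ > 0, ∀ τ : ℝ, τ ≠ 0 → |τ| < δ →
      HasWinding (fun s => u s - (u t + τ * (Complex.I * u' t))) m ∨
      HasWinding (fun s => u s - (u t + τ * (Complex.I * u' t))) (m + 1) := by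
  set K : ℝ → ℂ := fun s => circleSlope u u' (s, t) with hK
  set E : ℝ → ℂ := fun s => Complex.exp (Complex.I * s) with hE
  have hKc : Continuous K := h.continuous_circleSlope.comp (by fun_prop)
  have hEc : Continuous E := continuous_exp_I
  have hKp : ∀ s (n : ℤ), K (s + n * (2 * Real.pi)) = K s := fun s n => h.circleSlope_periodic s t n
  have hEp : ∀ s (n : ℤ), E (s + n * (2 * Real.pi)) = E s := fun s n => exp_I_eq_iff.2 ⟨n, rfl⟩
  have hEn : ∀ s, ‖E s‖ = 1 := norm_exp_I
  have hKt : K t * E t = - (Complex.I * u' t) := by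
    simp only [hK, hE, circleSlope, if_true]
    field_simp [Complex.exp_ne_zero, Complex.I_ne_zero]
    simp
  have hI : IsCompact (Icc (t - Real.pi) (t + Real.pi)) := isCompact_Icc
  have hIn : (Icc (t - Real.pi) (t + Real.pi)).Nonempty :=
    ⟨t, by linarith [Real.pi_pos], by linarith [Real.pi_pos]⟩
  obtain ⟨a, ha, hmin⟩ := hI.exists_isMinOn hIn (f := fun s => ‖K s‖) (by fun_prop)
  obtain ⟨b, hb, hmax⟩ := hI.exists_isMaxOn hIn (f := fun s => ‖K t - K s‖) (by fun_prop)
  have hk : 0 < ‖K a‖ := norm_pos_iff.2 (h.circleSlope_ne_zero _)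
  -- By compactness, K differs from K t by less than its minimal modulus as soon as E s is within d
  -- of E t.
  have hd : ∃ d > 0, ∀ s ∈ Icc (t - Real.pi) (t + Real.pi), ‖E s - E t‖ < d →
      ‖K t - K s‖ < ‖K a‖ := by
    by_cases hne : (Icc (t - Real.pi) (t + Real.pi) ∩ {s | ‖K a‖ ≤ ‖K t - K s‖}).Nonempty
    · have hc : IsCompact (Icc (t - Real.pi) (t + Real.pi) ∩ {s | ‖K a‖ ≤ ‖K t - K s‖}) :=
        hI.inter_right (isClosed_le (by fun_prop) (by fun_prop))
      obtain ⟨c, hc, hcmin⟩ := hc.exists_isMinOn hne (f := fun s => ‖E s - E t‖) (by fun_prop)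
      refine ⟨‖E c - E t‖, norm_pos_iff.2 (sub_ne_zero.2 fun he => ?_), fun s hs hlt => ?_⟩
      · obtain ⟨n, hn⟩ := exp_I_eq_iff.1 he
        have h2 : ‖K a‖ ≤ ‖K t - K c‖ := hc.2
        rw [hn, hKp] at h2
        simp only [sub_self, norm_zero] at h2
        linarith
      · by_contra hcon
        exact absurd (hcmin ⟨hs, not_lt.1 hcon⟩) (not_le.2 hlt)
    · refine ⟨1, one_pos, fun s hs _ => ?_⟩
      by_contra hcon
      exact hne ⟨s, hs, not_lt.1 hcon⟩
  obtain ⟨d, hd0, hd⟩ := hd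
  set M := ‖K t - K b‖ with hM
  have hM0 : 0 ≤ M := norm_nonneg _
  -- For E s at distance at least d from E t, the required estimate is |τ| M < ‖K a‖ (d - |τ|); this
  -- is the origin of the second bound.
  refine ⟨min 1 (d * ‖K a‖ / (M + ‖K a‖ + 1)), by positivity, fun τ hτ0 hτ => ?_⟩
  have hτ1 : |τ| < 1 := hτ.trans_le (min_le_left _ _)
  have hτ2 : |τ| * (M + ‖K a‖ + 1) < d * ‖K a‖ := by
    rw [← lt_div_iff₀ (by positivity)]
    exact hτ.trans_le (min_le_right _ _)
  have h1τ : 0 < 1 - τ := by linarith [(abs_lt.1 hτ1).2]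
  -- the comparison curve
  have hcomp : ∀ n, HasWinding (fun s => E s - ((1 - τ : ℝ) : ℂ) * E t) n →
      HasWinding (fun s => u s - (u t + τ * (Complex.I * u' t))) (m + n) := by
    intro n hn
    refine ((hm t).mul hn).of_norm_sub_lt (by have := h.continuous; fun_prop)
      (fun s => by simp only [h.periodic]) fun s => ?_
    change ‖u s - (u t + τ * (Complex.I * u' t)) - K s * (E s - ((1 - τ : ℝ) : ℂ) * E t)‖ <
      ‖K s * (E s - ((1 - τ : ℝ) : ℂ) * E t)‖
    have e1 : u s - (u t + τ * (Complex.I * u' t)) - K s * (E s - ((1 - τ : ℝ) : ℂ) * E t) =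
        τ * E t * (K t - K s) := by
      have e2 : K s * (E s - E t) = u s - u t := h.circleSlope_mul s t
      push_cast
      linear_combination -e2 - τ * hKt
    rw [e1, norm_mul, norm_mul, norm_mul, hEn, mul_one, Complex.norm_real, Real.norm_eq_abs]
    obtain ⟨s', hs', j, rfl⟩ := exists_mem_Icc_of_periodic t s
    rw [hKp, hEp]
    have hkK : ‖K a‖ ≤ ‖K s'‖ := hmin hs'
    have hMK : ‖K t - K s'‖ ≤ M := hmax hs'
    have hlow1 : |τ| ≤ ‖E s' - ((1 - τ : ℝ) : ℂ) * E t‖ := by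
      have := abs_norm_sub_norm_le (E s') (((1 - τ : ℝ) : ℂ) * E t)
      rw [norm_mul, hEn, hEn, mul_one, Complex.norm_real, Real.norm_eq_abs, abs_of_pos h1τ] at this
      simpa using this
    have hpos : 0 < |τ| := abs_pos.2 hτ0
    by_cases hnear : ‖E s' - E t‖ < d
    · calc |τ| * ‖K t - K s'‖ < |τ| * ‖K a‖ := by
            have := hd s' hs' hnear
            gcongr
        _ ≤ ‖E s' - ((1 - τ : ℝ) : ℂ) * E t‖ * ‖K s'‖ := by gcongr
        _ = _ := mul_comm _ _
    · have hlow2 : d - |τ| ≤ ‖E s' - ((1 - τ : ℝ) : ℂ) * E t‖ := by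
        have e3 : E s' - ((1 - τ : ℝ) : ℂ) * E t = (E s' - E t) - (-(τ : ℂ)) * E t := by
          push_cast; ring
        have := norm_sub_norm_le (E s' - E t) (-(τ : ℂ) * E t)
        rw [norm_mul, norm_neg, hEn, mul_one, Complex.norm_real, Real.norm_eq_abs] at this
        rw [e3]
        linarith [not_lt.1 hnear]
      calc |τ| * ‖K t - K s'‖ ≤ |τ| * M := by gcongr
        _ < ‖K a‖ * (d - |τ|) := by nlinarith
        _ ≤ ‖K s'‖ * ‖E s' - ((1 - τ : ℝ) : ℂ) * E t‖ := by
            have : 0 ≤ d - |τ| := by nlinarith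
            gcongr
  rcases lt_or_gt_of_ne hτ0 with hneg | hpos
  · left
    have := hcomp 0 (hasWinding_sub_of_norm_lt hEc (fun s => exp_I_periodic s) fun s => by
      rw [norm_mul, hEn, hEn, Complex.norm_real, Real.norm_eq_abs, abs_of_pos h1τ]; linarith)
    rwa [add_zero] at this
  · right
    refine hcomp 1 (hasWinding_circle_sub_of_lt ?_)
    rw [norm_mul, hEn, Complex.norm_real, Real.norm_eq_abs, abs_of_pos h1τ]; linarith

theorem exists_closest (c : ℂ) : ∃ t, ∀ s, ‖u t - c‖ ≤ ‖u s - c‖ := by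
  obtain ⟨t, -, ht⟩ := (isCompact_Icc (a := 0 - Real.pi) (b := 0 + Real.pi)).exists_isMinOn
    ⟨0, by linarith [Real.pi_pos], by linarith [Real.pi_pos]⟩ (f := fun s => ‖u s - c‖)
    (by have := h.continuous; fun_prop)
  refine ⟨t, fun s => ?_⟩
  obtain ⟨s', hs', n, rfl⟩ := exists_mem_Icc_of_periodic 0 s
  rw [h.periodic_int]
  exact ht hs'

/-- The squared distance to `c` is critical at `t`, so c - u t is orthogonal to the tangent. -/
theorem exists_normal {c : ℂ} {t : ℝ} (ht : ∀ s, ‖u t - c‖ ≤ ‖u s - c‖) :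
    ∃ l : ℝ, c = u t + l * (Complex.I * u' t) := by
  have h1 : HasDerivAt (fun s => ‖u s - c‖ ^ 2) (2 * inner ℝ (u t - c) (u' t)) t :=
    ((h.hasDerivAt t).sub_const c).norm_sq
  have h2 : IsLocalMin (fun s => ‖u s - c‖ ^ 2) t :=
    Eventually.of_forall fun s => by
      have := ht s
      simp only
      gcongr
  have h3 := h2.hasDerivAt_eq_zero h1
  have h4 : inner ℝ (u t - c) (u' t) = 0 := by linarith
  have h5 := h.deriv_ne_zero t
  have h6 : ((c - u t) / u' t).re = 0 := by
    rw [Complex.div_re, ← add_div]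
    rw [Complex.inner] at h4
    simp only [Complex.mul_re, Complex.conj_re, Complex.conj_im, Complex.sub_re,
      Complex.sub_im] at h4
    rw [div_eq_zero_iff]; left
    simp only [Complex.sub_re, Complex.sub_im]
    linarith
  refine ⟨((c - u t) / u' t).im, ?_⟩
  have h7 : (c - u t) / u' t = (((c - u t) / u' t).im : ℂ) * Complex.I := by
    conv_lhs => rw [← Complex.re_add_im ((c - u t) / u' t), h6]
    simp
  rw [div_eq_iff h5] at h7
  linear_combination h7

/-- The Jordan curve theorem with orientation and Hopf's Umlaufsatz: the winding numbers of a
simple closed curve and of its derivative. -/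
theorem exists_winding : ∃ m : ℤ, (m = 0 ∨ m = -1) ∧ HasWinding u' (2 * m + 1) ∧
    ∀ c, (∀ s, u s ≠ c) → HasWinding (fun s => u s - c) m ∨
      HasWinding (fun s => u s - c) (m + 1) := by
  obtain ⟨m, hm', hm⟩ := h.exists_winding_circleSlope
  have key : ∀ c, (∀ s, u s ≠ c) →
      HasWinding (fun s => u s - c) m ∨ HasWinding (fun s => u s - c) (m + 1) := by
    intro c hc
    obtain ⟨t, ht⟩ := h.exists_closest c
    obtain ⟨l, hl⟩ := h.exists_normal ht
    obtain ⟨δ, hδ, hnear⟩ := h.hasWinding_near hm t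
    have hl0 : l ≠ 0 := by
      rintro rfl
      exact hc t (by simp [hl])
    have hv : 0 < ‖(l : ℂ) * (Complex.I * u' t)‖ := by
      refine norm_pos_iff.2 (mul_ne_zero (by exact_mod_cast hl0)
        (mul_ne_zero Complex.I_ne_zero (h.deriv_ne_zero t)))
    -- The point u t + σ l i u'(t) lies between the nearest point u t and c, close enough to the
    -- curve for `hasWinding_near`.
    set σ : ℝ := min 1 (δ / (2 * |l|)) with hσ
    have hlpos : 0 < |l| := abs_pos.2 hl0
    have hσ0 : 0 < σ := by positivity
    have hσ1 : σ ≤ 1 := min_le_left _ _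
    have hσl : |σ * l| < δ := by
      rw [abs_mul, abs_of_pos hσ0]
      calc σ * |l| ≤ δ / (2 * |l|) * |l| := by gcongr; exact min_le_right _ _
        _ = δ / 2 := by field_simp
        _ < δ := half_lt_self hδ
    -- On the rest of the way to c the distance to c is below the minimal distance from c to the
    -- curve, so the segment misses the curve.
    have hseg : ∀ τ ∈ Icc (0 : ℝ) 1, ∀ s, u s ≠ (u t + (σ * l : ℝ) * (Complex.I * u' t)) +
        τ * (c - (u t + (σ * l : ℝ) * (Complex.I * u' t))) := by
      rintro τ ⟨h0, h1⟩ s hs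
      have h2 := ht s
      rw [hs, hl] at h2
      have e1 : u t - (u t + l * (Complex.I * u' t)) = -(l * (Complex.I * u' t)) := by ring
      have e2 : (u t + (σ * l : ℝ) * (Complex.I * u' t)) +
        τ * ((u t + l * (Complex.I * u' t)) - (u t + (σ * l : ℝ) * (Complex.I * u' t))) -
          (u t + l * (Complex.I * u' t)) =
          -(((1 - τ) * (1 - σ) : ℝ) * (l * (Complex.I * u' t))) := by push_cast; ring
      rw [e1, e2, norm_neg, norm_neg, norm_mul (((1 - τ) * (1 - σ) : ℝ) : ℂ), Complex.norm_real,
        Real.norm_eq_abs,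
        abs_of_nonneg (mul_nonneg (by linarith) (by linarith))] at h2
      have h3 : (1 - τ) * (1 - σ) < 1 := by nlinarith
      nlinarith
    rcases hnear (σ * l) (mul_ne_zero hσ0.ne' hl0) hσl with h3 | h3
    · exact Or.inl (h3.of_segment h.continuous hseg)
    · exact Or.inr (h3.of_segment h.continuous hseg)
  refine ⟨m, ?_, hm', key⟩
  -- A point far from the curve has winding number 0, which must be m or m + 1.
  obtain ⟨t, -, ht⟩ := (isCompact_Icc (a := 0 - Real.pi) (b := 0 + Real.pi)).exists_isMaxOn
    ⟨0, by linarith [Real.pi_pos], by linarith [Real.pi_pos]⟩ (f := fun s => ‖u s‖)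
    (by have := h.continuous; fun_prop)
  have hmax : ∀ s, ‖u s‖ < ‖((‖u t‖ + 1 : ℝ) : ℂ)‖ := by
    intro s
    obtain ⟨s', hs', n, rfl⟩ := exists_mem_Icc_of_periodic 0 s
    have h1 : ‖u s'‖ ≤ ‖u t‖ := ht hs'
    rw [h.periodic_int, Complex.norm_real, Real.norm_eq_abs, abs_of_nonneg (by positivity)]
    linarith
  have h0 := hasWinding_sub_of_norm_lt h.continuous h.periodic hmax
  rcases key _ (fun s hs => (hmax s).ne (by rw [hs])) with h1 | h1
  · exact Or.inl (h1.unique h0)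
  · right
    have := h1.unique h0
    omega

end IsSimpleClosedCurve

/-! ### Kummer functions on cyclic covers -/

theorem exists_stdAddChar_eq {k : ℕ} [NeZero k] {y : ℂ} (hy : y ^ k = 1) :
    ∃ j : ZMod k, y = ZMod.stdAddChar j := by
  obtain ⟨i, -, hi⟩ := (Complex.isPrimitiveRoot_exp k (NeZero.ne k)).eq_pow_of_pow_eq_one hy
  refine ⟨((i : ℤ) : ZMod k), ?_⟩
  rw [ZMod.stdAddChar_coe, ← hi, ← Complex.exp_nat_mul]
  congr 1
  push_cast
  ring

theorem stdAddChar_pow_self {k : ℕ} [NeZero k] (g : ZMod k) :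
    (ZMod.stdAddChar g : ℂ) ^ k = 1 := by
  rw [← AddChar.map_nsmul_eq_pow]
  simp

/-- Over the domain `D₀` of the plane, `π` is a covering map which is the quotient by a free
action of `ℤ/k`. -/
structure IsTorsorOver (k : ℕ) {X : Type*} [TopologicalSpace X] [AddAction (ZMod k) X]
    (π : X → OnePoint ℂ) (D₀ : Set ℂ) : Prop where
  isCoveringMapOn : IsCoveringMapOn π ((↑) '' D₀)
  surjective : ∀ w ∈ D₀, ∃ x, π x = (w : OnePoint ℂ)
  fiber : ∀ x y : X, π x = π y ↔ ∃ g : ZMod k, g +ᵥ x = y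
  free : ∀ (g : ZMod k) (x : X), ∀ w ∈ D₀, π x = (w : OnePoint ℂ) → g +ᵥ x = x → g = 0
  continuous_vadd : ∀ g : ZMod k, Continuous fun x : X => g +ᵥ x

/-- `φ` is, over `D`, a `k`-th root of `R` on which `ℤ/k` acts through the standard character. -/
structure IsKummerOn (k : ℕ) [NeZero k] {X : Type*} [TopologicalSpace X] [AddAction (ZMod k) X]
    (π : X → OnePoint ℂ) (R : ℂ → ℂ) (D : Set ℂ) (φ : X → ℂ) : Prop where
  continuousAt : ∀ x, ∀ w ∈ D, π x = (w : OnePoint ℂ) → ContinuousAt φ x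
  pow_eq : ∀ x, ∀ w ∈ D, π x = (w : OnePoint ℂ) → φ x ^ k = R w
  vadd : ∀ (g : ZMod k) (x : X), ∀ w ∈ D, π x = (w : OnePoint ℂ) →
    φ (g +ᵥ x) = ZMod.stdAddChar g * φ x

section

variable {k : ℕ} {X : Type*} [TopologicalSpace X] [AddAction (ZMod k) X]
  {π : X → OnePoint ℂ} {D₀ : Set ℂ} {R : ℂ → ℂ}

namespace IsTorsorOver

variable (hT : IsTorsorOver k π D₀)
include hT

theorem map_vadd (g : ZMod k) (x : X) : π (g +ᵥ x) = π x := ((hT.fiber x _).2 ⟨g, rfl⟩).symm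

theorem continuousAt {x : X} {w : ℂ} (hw : w ∈ D₀) (hx : π x = (w : OnePoint ℂ)) :
    ContinuousAt π x :=
  hT.isCoveringMapOn.continuousAt (by rw [hx]; exact mem_image_of_mem _ hw)

theorem map_nhds {x : X} {w : ℂ} (hw : w ∈ D₀) (hx : π x = (w : OnePoint ℂ)) :
    map π (𝓝 x) = 𝓝 (w : OnePoint ℂ) := by
  rw [← hx]
  exact hT.isCoveringMapOn.isLocalHomeomorphOn.map_nhds_eq
    (by rw [mem_preimage, hx]; exact mem_image_of_mem _ hw)

theorem exists_mem_nhds_injOn {x : X} {w : ℂ} (hw : w ∈ D₀) (hx : π x = (w : OnePoint ℂ)) :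
    ∃ N ∈ 𝓝 x, InjOn π N := by
  obtain ⟨e, he, heq⟩ := hT.isCoveringMapOn.isLocalHomeomorphOn x
    (by rw [mem_preimage, hx]; exact mem_image_of_mem _ hw)
  exact ⟨e.source, e.open_source.mem_nhds he, by rw [heq]; exact e.injOn⟩

theorem exists_lift {A : Type*} [TopologicalSpace A] [SimplyConnectedSpace A]
    [LocallyPathConnectedSpace A] {θ : A → ℂ} (hθ : Continuous θ) (hD : ∀ a, θ a ∈ D₀) :
    ∃ σ : A → X, Continuous σ ∧ ∀ a, π (σ a) = (θ a : OnePoint ℂ) := by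
  obtain ⟨a₀⟩ : Nonempty A := inferInstance
  obtain ⟨x₀, hx₀⟩ := hT.surjective _ (hD a₀)
  obtain ⟨σ, ⟨-, hσ⟩, -⟩ := hT.isCoveringMapOn.existsUnique_continuousMap_lifts
    (⟨fun a => (θ a : OnePoint ℂ), OnePoint.continuous_coe.comp hθ⟩ : C(A, OnePoint ℂ)) (a₀ := a₀)
    (e₀ := x₀) hx₀ (fun a => mem_image_of_mem _ (hD a))
  exact ⟨σ, σ.continuous, fun a => congrFun hσ a⟩

theorem lift_unique {A : Type*} [TopologicalSpace A] [PreconnectedSpace A] {θ : A → ℂ}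
    (hD : ∀ a, θ a ∈ D₀) {σ σ' : A → X} (hσ : Continuous σ) (hσ' : Continuous σ')
    (h : ∀ a, π (σ a) = (θ a : OnePoint ℂ)) (h' : ∀ a, π (σ' a) = (θ a : OnePoint ℂ)) {a₀ : A}
    (h0 : σ a₀ = σ' a₀) : σ = σ' := by
  have hcov := hT.isCoveringMapOn.isCoveringMap_restrictPreimage
  have hm : ∀ a, σ a ∈ π ⁻¹' ((↑) '' D₀) := fun a => by
    rw [mem_preimage, h]; exact mem_image_of_mem _ (hD a)
  have hm' : ∀ a, σ' a ∈ π ⁻¹' ((↑) '' D₀) := fun a => by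
    rw [mem_preimage, h']; exact mem_image_of_mem _ (hD a)
  have := hcov.eq_of_comp_eq (g₁ := fun a => (⟨σ a, hm a⟩ : π ⁻¹' ((↑) '' D₀)))
    (g₂ := fun a => ⟨σ' a, hm' a⟩) (by fun_prop) (by fun_prop)
    (by funext a; exact Subtype.ext ((h a).trans (h' a).symm)) a₀ (Subtype.ext h0)
  funext a
  exact congrArg Subtype.val (congrFun this a)

variable [NeZero k]

open Classical in
-- Every point over the range of `θ` is a deck translate g +ᵥ σ a, and the character forces the
-- value χ(g) Φ(a) there; `hcompat` makes this independent of the choices. The map `θ` need not be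
-- injective, so that `A` may be the universal cover of a punctured disc.
theorem exists_isKummerOn_range {A : Type*} [TopologicalSpace A] {θ : A → ℂ}
    (hθ : IsLocalHomeomorph θ) (hD : ∀ a, θ a ∈ D₀) {σ : A → X} (hσ : Continuous σ)
    (hπσ : ∀ a, π (σ a) = (θ a : OnePoint ℂ)) {Φ : A → ℂ} (hΦ : Continuous Φ)
    (hpow : ∀ a, Φ a ^ k = R (θ a))
    (hcompat : ∀ a a' (g : ZMod k), g +ᵥ σ a = σ a' → Φ a' = ZMod.stdAddChar g * Φ a) :
    ∃ φ, IsKummerOn k π R (range θ) φ := by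
  let φ : X → ℂ := fun x => if h : ∃ p : ZMod k × A, x = p.1 +ᵥ σ p.2 then
    ZMod.stdAddChar h.choose.1 * Φ h.choose.2 else 0
  have hφ : ∀ (g : ZMod k) a, φ (g +ᵥ σ a) = ZMod.stdAddChar g * Φ a := by
    intro g a
    have h : ∃ p : ZMod k × A, g +ᵥ σ a = p.1 +ᵥ σ p.2 := ⟨(g, a), rfl⟩
    simp only [φ, dif_pos h]
    have h1 := h.choose_spec
    generalize h.choose = q at h1 ⊢
    have h2 := hcompat a q.2 (-q.1 + g) (by rw [add_vadd, h1, neg_vadd_vadd])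
    rw [h2, ← mul_assoc, ← AddChar.map_add_eq_mul]
    simp
  have hex : ∀ x, ∀ w ∈ range θ, π x = (w : OnePoint ℂ) →
      ∃ g : ZMod k, ∃ a, θ a = w ∧ g +ᵥ σ a = x := by
    rintro x w ⟨a, rfl⟩ hx
    obtain ⟨g, hg⟩ := (hT.fiber (σ a) x).1 ((hπσ a).trans hx.symm)
    exact ⟨g, a, rfl, hg⟩
  refine ⟨φ, fun x w hw hx => ?_, fun x w hw hx => ?_, fun g x w hw hx => ?_⟩
  · obtain ⟨g, a, rfl, rfl⟩ := hex x w hw hx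
    obtain ⟨e, hea, rfl⟩ := hθ a
    have hπ := hT.continuousAt (hD a) hx
    have haff : ContinuousAt RiemannSphere.affineChart (π (g +ᵥ σ a)) := by
      refine RiemannSphere.affineChart.continuousAt ?_
      rw [RiemannSphere.affineChart_source, hx]
      exact mem_range_self _
    have hw0 : RiemannSphere.affineChart (π (g +ᵥ σ a)) = e a := by
      rw [hx, RiemannSphere.affineChart_coe]
    have h1 : ContinuousAt (fun y => RiemannSphere.affineChart (π y)) (g +ᵥ σ a) := haff.comp hπ
    have h1e : e.symm (RiemannSphere.affineChart (π (g +ᵥ σ a))) = a := by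
      rw [hw0, e.left_inv hea]
    have h2 : ContinuousAt (fun y => e.symm (RiemannSphere.affineChart (π y))) (g +ᵥ σ a) := by
      refine ContinuousAt.comp (g := e.symm) (e.symm.continuousAt ?_) h1
      rw [hw0]; exact e.map_source hea
    have h3 : ContinuousAt (fun y => g +ᵥ σ (e.symm (RiemannSphere.affineChart (π y))))
        (g +ᵥ σ a) :=
      ((hT.continuous_vadd g).comp hσ).continuousAt.comp h2
    -- Local injectivity of π identifies a nearby y with g +ᵥ σ (e⁻¹ (π y)), so φ is locally χ(g) Φ
    -- (e⁻¹ (π y)).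
    obtain ⟨N, hN, hinj⟩ := hT.exists_mem_nhds_injOn (hD a) hx
    have h4 : ∀ᶠ y in 𝓝 (g +ᵥ σ a), g +ᵥ σ (e.symm (RiemannSphere.affineChart (π y))) ∈ N :=
      h3.eventually_mem (by simpa only [h1e] using hN)
    have h5 : ∀ᶠ y in 𝓝 (g +ᵥ σ a), RiemannSphere.affineChart (π y) ∈ e.target :=
      h1.eventually_mem (by simpa only [hw0] using e.open_target.mem_nhds (e.map_source hea))
    have h6 : ∀ᶠ y in 𝓝 (g +ᵥ σ a), π y ∈ RiemannSphere.affineChart.source := by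
      refine hπ.eventually (RiemannSphere.affineChart.open_source.mem_nhds ?_)
      rw [RiemannSphere.affineChart_source, hx]
      exact mem_range_self _
    have h7 : ContinuousAt (fun y => ZMod.stdAddChar g *
        Φ (e.symm (RiemannSphere.affineChart (π y)))) (g +ᵥ σ a) :=
      continuousAt_const.mul (hΦ.continuousAt.comp h2)
    refine h7.congr ?_
    filter_upwards [h4, h5, h6, hN] with y hy4 hy5 hy6 hyN
    rw [← hφ]
    congr 1
    refine hinj hy4 hyN ?_
    rw [hT.map_vadd, hπσ, e.right_inv hy5]
    rw [RiemannSphere.affineChart_source] at hy6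
    obtain ⟨w, hw⟩ := hy6
    rw [← hw, RiemannSphere.affineChart_coe]
  · obtain ⟨g, a, rfl, rfl⟩ := hex x w hw hx
    rw [hφ, mul_pow, stdAddChar_pow_self, one_mul, hpow]
  · obtain ⟨g', a, rfl, rfl⟩ := hex x w hw hx
    rw [← add_vadd, hφ, hφ, AddChar.map_add_eq_mul, mul_assoc]

/-- Over a disc there is a section of π and a logarithm L of R, and exp (L / k) serves as the root
on the section. Compatibility holds because the action is free. -/
theorem exists_isKummerOn_ball {b : ℂ} {r : ℝ} (hr : 0 < r) (hb : Metric.ball b r ⊆ D₀)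
    (hR : ContinuousOn R (Metric.ball b r)) (hR0 : ∀ w ∈ Metric.ball b r, R w ≠ 0) :
    ∃ φ, IsKummerOn k π R (Metric.ball b r) φ := by
  have hne : (Metric.ball b r).Nonempty := ⟨b, Metric.mem_ball_self hr⟩
  have : ContractibleSpace (Metric.ball b r) := (convex_ball b r).contractibleSpace hne
  have : LocallyPathConnectedSpace (Metric.ball b r) := Metric.isOpen_ball.locallyPathConnectedSpace
  obtain ⟨L, hL, hLR⟩ := exists_continuousOn_log (convex_ball b r) Metric.isOpen_ball hne hR hR0
  obtain ⟨σ, hσ, hπσ⟩ := hT.exists_lift (A := Metric.ball b r) (θ := Subtype.val)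
    continuous_subtype_val (fun a => hb a.2)
  have hk : (k : ℂ) ≠ 0 := by exact_mod_cast NeZero.ne k
  have := hT.exists_isKummerOn_range (R := R)
    Metric.isOpen_ball.isOpenEmbedding_subtypeVal.isLocalHomeomorph (fun a => hb a.2) hσ hπσ
    (Φ := fun a => Complex.exp (L a / k))
    (Complex.continuous_exp.comp ((continuousOn_iff_continuous_domRestrict.1 hL).div_const _))
    (fun a => by
      rw [← Complex.exp_nat_mul, mul_div_cancel₀ _ hk, hLR _ a.2])
    (fun a a' g hg => by
      have h1 : (a : ℂ) = a' := by
        have := hT.map_vadd g (σ a)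
        rw [hg, hπσ, hπσ] at this
        exact (OnePoint.coe_injective this).symm
      obtain rfl : a = a' := Subtype.ext h1
      rw [hT.free g _ _ (hb a.2) (hπσ a) hg]
      simp)
  rwa [Subtype.range_coe] at this

end IsTorsorOver

theorem IsKummerOn.mono [NeZero k] {D D' : Set ℂ} {φ : X → ℂ}
    (h : IsKummerOn k π R D φ) (hD : D' ⊆ D) :
    IsKummerOn k π R D' φ :=
  ⟨fun x w hw => h.1 x w (hD hw), fun x w hw => h.2 x w (hD hw), fun g x w hw => h.3 g x w (hD hw)⟩

end

/-! ### Kummer functions on punctured discs -/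

theorem isLocalHomeomorph_cexp : IsLocalHomeomorph Complex.exp := by
  rw [isLocalHomeomorph_iff_isLocalHomeomorphOn_univ]
  convert Complex.isCoveringMapOn_exp.isLocalHomeomorphOn
  ext x
  simp

namespace IsTorsorOver

variable {k : ℕ} {X : Type*} [TopologicalSpace X] [AddAction (ZMod k) X]
  {π : X → OnePoint ℂ} {D₀ : Set ℂ} {R : ℂ → ℂ} (hT : IsTorsorOver k π D₀) [NeZero k]
include hT

/-- The half-plane H covers the punctured disc by s ↦ c + e^s, and π lifts to it. The root exp ((α s
+ L) / k) is multiplied by e^{2πiα/k} = χ(α) when s moves by 2πi, while the lift moves by α: the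
root and the lift have matching monodromy. -/
theorem exists_isKummerOn_punctured {c : ℂ} {r : ℝ} (hr : 0 < r)
    (hb : Metric.ball c r \ {c} ⊆ D₀) (α : ℤ) {R₁ : ℂ → ℂ}
    (hR₁ : ContinuousOn R₁ (Metric.ball c r)) (hR₁0 : ∀ w ∈ Metric.ball c r, R₁ w ≠ 0)
    (hR : ∀ w ∈ Metric.ball c r \ {c}, R w = (w - c) ^ α * R₁ w) {r₀ : ℝ} (hr₀ : 0 < r₀)
    (hr₀r : r₀ < r)
    (hmono : ∀ γ : ℝ → X, ContinuousOn γ (Icc 0 1) → (∀ t ∈ Icc (0 : ℝ) 1, π (γ t) =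
      ((c + r₀ * Complex.exp (2 * Real.pi * Complex.I * t) : ℂ) : OnePoint ℂ)) →
      γ 1 = (α : ZMod k) +ᵥ γ 0) :
    ∃ φ, IsKummerOn k π R (Metric.ball c r \ {c}) φ := by
  let H : Set ℂ := {s | s.re < Real.log r}
  have hHo : IsOpen H := isOpen_lt Complex.continuous_re continuous_const
  have hs₀ : ((Real.log r₀ : ℝ) : ℂ) ∈ H := by
    simp only [H, mem_ofPred_eq, Complex.ofReal_re]
    exact Real.log_lt_log hr₀ hr₀r
  have hHc : Convex ℝ H := convex_halfSpace_re_lt _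
  have : ContractibleSpace H := hHc.contractibleSpace ⟨_, hs₀⟩
  have : LocallyPathConnectedSpace H := hHo.locallyPathConnectedSpace
  have hk : (k : ℂ) ≠ 0 := by exact_mod_cast NeZero.ne k
  let θ : H → ℂ := fun s => c + Complex.exp s
  have hθc : Continuous θ := by fun_prop
  have hθ : ∀ s : H, θ s ∈ Metric.ball c r \ {c} := by
    intro s
    have h1 : Real.exp (s : ℂ).re < r := by rw [← Real.lt_log_iff_exp_lt hr]; exact s.2
    simpa [θ, Complex.norm_exp, Complex.exp_ne_zero] using h1
  have hrange : range θ = Metric.ball c r \ {c} := by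
    refine Subset.antisymm (range_subset_iff.2 hθ) fun w hw => ?_
    have hw0 : w - c ≠ 0 := sub_ne_zero.2 hw.2
    refine ⟨⟨Complex.log (w - c), ?_⟩, ?_⟩
    · simp only [H, mem_ofPred_eq, Complex.log_re]
      exact Real.log_lt_log (norm_pos_iff.2 hw0) (by simpa [dist_eq_norm] using hw.1)
    · simp [θ, Complex.exp_log hw0]
  obtain ⟨σ, hσ, hπσ⟩ := hT.exists_lift hθc fun s => hb (hθ s)
  have hθn : ∀ (a b : H), θ a = θ b ↔
      ∃ n : ℤ, (b : ℂ) = a + n * (2 * Real.pi * Complex.I) := by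
    intro a b
    simp only [θ, add_right_inj]
    rw [eq_comm, Complex.exp_eq_exp_iff_exists_int]
  -- monodromy of the lift
  have hmem : ∀ (a : H) (y : ℝ), (a : ℂ) + y * Complex.I ∈ H := by
    intro a y
    have h1 : (a : ℂ).re < Real.log r := a.2
    simpa [H] using h1
  -- The monodromy is known on a single circle only. The lifts a ↦ σ (a + 2πi) and a ↦ α +ᵥ σ a
  -- agree at log r₀, hence everywhere on H.
  have hone : ∀ a b : H, (b : ℂ) = a + 2 * Real.pi * Complex.I → σ b = (α : ZMod k) +ᵥ σ a := by
    have hshift : ∀ a : H, (a : ℂ) + ((2 * Real.pi : ℝ) : ℂ) * Complex.I ∈ H := fun a => hmem a _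
    have huniq := hT.lift_unique (θ := θ) (fun s => hb (hθ s))
      (σ := fun a => σ ⟨_, hshift a⟩) (σ' := fun a => (α : ZMod k) +ᵥ σ a) (by fun_prop)
      ((hT.continuous_vadd _).comp hσ)
      (fun a => by
        rw [hπσ]; congr 1
        exact ((hθn _ _).2 ⟨1, by push_cast; ring⟩).symm)
      (fun a => by rw [hT.map_vadd, hπσ]) (a₀ := ⟨_, hs₀⟩)
      (by
        have h1 := hmono (fun t => σ ⟨_, hmem ⟨_, hs₀⟩ (2 * Real.pi * t)⟩)
          (by fun_prop) (fun t _ => by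
            rw [hπσ]
            simp only [θ]
            rw [Complex.exp_add, ← Complex.ofReal_exp, Real.exp_log hr₀]
            push_cast
            ring_nf)
        simpa using h1)
    intro a b hab
    have h2 := congrFun huniq a
    rw [← h2]
    congr 1
    exact Subtype.ext (by rw [hab]; push_cast; ring)
  have hint : ∀ n : ℤ, ∀ a b : H, (b : ℂ) = a + n * (2 * Real.pi * Complex.I) →
      σ b = ((n * α : ℤ) : ZMod k) +ᵥ σ a := by
    intro n
    induction n using Int.induction_on with
    | zero =>
      intro a b hab
      obtain rfl : b = a := Subtype.ext (by simpa using hab)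
      simp
    | succ n ih =>
      intro a b hab
      have h1 : (a : ℂ) + ((n * (2 * Real.pi) : ℝ) : ℂ) * Complex.I ∈ H := hmem a _
      rw [hone ⟨_, h1⟩ b (by rw [hab]; push_cast; ring), ih a ⟨_, h1⟩ (by push_cast; ring),
        ← add_vadd]
      congr 1
      push_cast; ring
    | pred n ih =>
      intro a b hab
      have h1 : (b : ℂ) + ((2 * Real.pi : ℝ) : ℂ) * Complex.I ∈ H := hmem b _
      have h2 := hone b ⟨_, h1⟩ (by push_cast; ring)
      rw [ih a ⟨_, h1⟩ (by simp only [hab]; push_cast; ring)] at h2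
      rw [← neg_vadd_vadd (α : ZMod k) (σ b), ← h2, ← add_vadd]
      congr 1
      push_cast; ring
  obtain ⟨L, hL, hLR⟩ := exists_continuousOn_log (convex_ball c r) Metric.isOpen_ball
    ⟨c, Metric.mem_ball_self hr⟩ hR₁ hR₁0
  have hLc : Continuous fun s : H => L (θ s) := hL.comp_continuous hθc fun s => (hθ s).1
  rw [← hrange]
  refine hT.exists_isKummerOn_range (θ := θ)
    ((Homeomorph.addLeft c).isLocalHomeomorph.comp
      (isLocalHomeomorph_cexp.comp hHo.isOpenEmbedding_subtypeVal.isLocalHomeomorph))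
    (fun a => hb (hθ a)) hσ hπσ (Φ := fun s => Complex.exp ((α * s + L (θ s)) / k))
    (Complex.continuous_exp.comp (((by fun_prop : Continuous fun s : H => (α : ℂ) * s).add
      hLc).div_const _)) (fun a => ?_) (fun a b g hg => ?_)
  · rw [← Complex.exp_nat_mul, mul_div_cancel₀ _ hk, Complex.exp_add, hLR _ (hθ a).1,
      Complex.exp_int_mul, hR _ (hθ a)]
    simp [θ]
  · have h1 : θ a = θ b := by
      have := hT.map_vadd g (σ a)
      rw [hg, hπσ, hπσ] at this
      exact (OnePoint.coe_injective this).symm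
    obtain ⟨n, hn⟩ := (hθn a b).1 h1
    have h2 : g = ((n * α : ℤ) : ZMod k) := by
      have h3 := hint n a b hn
      rw [← hg] at h3
      have h4 := hT.free (-((n * α : ℤ) : ZMod k) + g) _ _ (hb (hθ a)) (hπσ a)
        (by rw [add_vadd, h3, neg_vadd_vadd])
      rw [neg_add_eq_zero] at h4
      exact h4.symm
    rw [h2, ZMod.stdAddChar_coe, ← h1, ← Complex.exp_add]
    congr 1
    rw [hn]
    push_cast
    field_simp
    ring

end IsTorsorOver

/-! ### Comparison and gluing of Kummer functions -/

section

variable {k : ℕ} [NeZero k] {X : Type*} [TopologicalSpace X] [AddAction (ZMod k) X]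
  {π : X → OnePoint ℂ} {D₀ : Set ℂ} {R : ℂ → ℂ}

theorem eventually_eq_of_mem_finite {A : Type*} [TopologicalSpace A] {y : A → ℂ} {x : A}
    (hy : ContinuousAt y x) {F : Set ℂ} (hF : F.Finite) (h : ∀ᶠ a in 𝓝 x, y a ∈ F) :
    ∀ᶠ a in 𝓝 x, y a = y x := by
  have h1 : ∀ᶠ a in 𝓝 x, y a ∈ (F \ {y x})ᶜ :=
    hy.eventually_mem ((hF.subset sdiff_subset).isClosed.isOpen_compl.mem_nhds (by simp))
  filter_upwards [h, h1] with a ha ha1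
  by_contra hne
  exact ha1 ⟨ha, hne⟩

namespace IsKummerOn

variable {D D' : Set ℂ} {φ φ' : X → ℂ}

theorem ne_zero (h : IsKummerOn k π R D φ) {x : X} {w : ℂ} (hw : w ∈ D)
    (hx : π x = (w : OnePoint ℂ)) (hR : R w ≠ 0) : φ x ≠ 0 := by
  intro h0
  have := h.pow_eq x w hw hx
  rw [h0, zero_pow (NeZero.ne k)] at this
  exact hR this.symm

variable (hT : IsTorsorOver k π D₀) (hR0 : ∀ w ∈ D₀, R w ≠ 0)
include hT hR0

/-- The quotient of two k-th roots of the same number is a k-th root of unity, and it is constant on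
the fibre because both roots transform by the same character. -/
theorem exists_transition (h : IsKummerOn k π R D φ) (h' : IsKummerOn k π R D' φ') {w : ℂ}
    (hw : w ∈ D) (hw' : w ∈ D') (hw0 : w ∈ D₀) :
    ∃! j : ZMod k, ∀ x, π x = (w : OnePoint ℂ) → φ x = ZMod.stdAddChar j * φ' x := by
  obtain ⟨x₀, hx₀⟩ := hT.surjective w hw0
  have hne := h'.ne_zero hw' hx₀ (hR0 w hw0)
  obtain ⟨j, hj⟩ := exists_stdAddChar_eq (k := k) (y := φ x₀ / φ' x₀) (by
    rw [div_pow, h.pow_eq x₀ w hw hx₀, h'.pow_eq x₀ w hw' hx₀, div_self (hR0 w hw0)])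
  rw [div_eq_iff hne] at hj
  refine ⟨j, fun x hx => ?_, fun j' hj' => ?_⟩
  · obtain ⟨g, rfl⟩ := (hT.fiber x₀ x).1 (hx₀.trans hx.symm)
    rw [h.vadd g x₀ w hw hx₀, h'.vadd g x₀ w hw' hx₀, hj]
    ring
  · have h1 := hj' x₀ hx₀
    rw [hj] at h1
    exact (ZMod.injective_stdAddChar (mul_right_cancel₀ hne h1)).symm

/-- The quotient is continuous with values in a finite set, hence locally constant upstairs; as π is
open, the exponent is locally constant downstairs. -/
theorem eventually_transition (hD₀ : IsOpen D₀) (hD : IsOpen D) (hD' : IsOpen D')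
    (h : IsKummerOn k π R D φ) (h' : IsKummerOn k π R D' φ') {w : ℂ} (hw : w ∈ D) (hw' : w ∈ D')
    (hw0 : w ∈ D₀) {j : ZMod k}
    (hj : ∀ x, π x = (w : OnePoint ℂ) → φ x = ZMod.stdAddChar j * φ' x) :
    ∀ᶠ v : ℂ in 𝓝 w, ∀ x, π x = (v : OnePoint ℂ) → φ x = ZMod.stdAddChar j * φ' x := by
  obtain ⟨x₀, hx₀⟩ := hT.surjective w hw0
  have hne := h'.ne_zero hw' hx₀ (hR0 w hw0)
  have hopen : IsOpen (D ∩ D' ∩ D₀) := (hD.inter hD').inter hD₀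
  have hnear : ∀ᶠ x in 𝓝 x₀, ∃ v ∈ D ∩ D' ∩ D₀, π x = (v : OnePoint ℂ) := by
    have h1 := hT.continuousAt hw0 hx₀
    have h2 : ((↑) '' (D ∩ D' ∩ D₀) : Set (OnePoint ℂ)) ∈ 𝓝 (π x₀) := by
      rw [hx₀]
      exact (OnePoint.isOpenEmbedding_coe.isOpenMap _ hopen).mem_nhds ⟨w, ⟨⟨hw, hw'⟩, hw0⟩, rfl⟩
    filter_upwards [h1.eventually_mem h2] with x hx
    obtain ⟨v, hv, hvx⟩ := hx
    exact ⟨v, hv, hvx.symm⟩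
  have hcont : ContinuousAt (fun x => φ x / φ' x) x₀ :=
    (h.continuousAt x₀ w hw hx₀).div (h'.continuousAt x₀ w hw' hx₀) hne
  have hconst := eventually_eq_of_mem_finite hcont
    (finite_range (fun j : ZMod k => (ZMod.stdAddChar j : ℂ))) (by
      filter_upwards [hnear] with x hx
      obtain ⟨v, ⟨⟨hv, hv'⟩, hv0⟩, hx⟩ := hx
      obtain ⟨i, hi, -⟩ := h.exists_transition hT hR0 h' hv hv' hv0
      exact ⟨i, by
        simp only
        rw [hi x hx, mul_div_cancel_right₀ _ (h'.ne_zero hv' hx (hR0 v hv0))]⟩)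
  have himg : π '' {x | φ x / φ' x = φ x₀ / φ' x₀} ∈ 𝓝 (w : OnePoint ℂ) := by
    rw [← hT.map_nhds hw0 hx₀]
    exact image_mem_map hconst
  filter_upwards [hopen.mem_nhds ⟨⟨hw, hw'⟩, hw0⟩,
    OnePoint.continuous_coe.continuousAt.eventually_mem himg] with v hv hvimg x hx
  obtain ⟨y, hy, hyv⟩ := hvimg
  obtain ⟨i, hi, -⟩ := h.exists_transition hT hR0 h' hv.1.1 hv.1.2 hv.2
  have hy1 : φ y / φ' y = φ x₀ / φ' x₀ := hy
  rw [hi y hyv, hj x₀ hx₀, mul_div_cancel_right₀ _ hne,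
    mul_div_cancel_right₀ _ (h'.ne_zero hv.1.2 hyv (hR0 v hv.2))] at hy1
  rw [← ZMod.injective_stdAddChar hy1]
  exact hi x hx

end IsKummerOn

open Classical in
/-- Local Kummer functions, defined over punctured discs around all points of the plane, can be
corrected by locally constant factors so as to give a global one. -/
theorem IsTorsorOver.exists_isKummerOn_of_local (hT : IsTorsorOver k π D₀)
    (hR0 : ∀ w ∈ D₀, R w ≠ 0) (hD₀ : IsOpen D₀)
    (hloc : ∀ b : ℂ, ∃ r > 0, Metric.ball b r \ {b} ⊆ D₀ ∧
      ∃ φ, IsKummerOn k π R (Metric.ball b r ∩ D₀) φ) :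
    ∃ φ, IsKummerOn k π R D₀ φ := by
  choose r hr hball φ hφ using hloc
  let U : ℂ → Set ℂ := fun b => Metric.ball b (r b)
  have hU : ∀ b, IsOpen (U b) := fun b => Metric.isOpen_ball
  have hbU : ∀ b, b ∈ U b := fun b => Metric.mem_ball_self (hr b)
  have hex : ∀ b b' w, w ∈ U b → w ∈ U b' → w ∈ D₀ →
      ∃! j : ZMod k, ∀ x, π x = (w : OnePoint ℂ) → φ b x = ZMod.stdAddChar j * φ b' x :=
    fun b b' w hb hb' hw => (hφ b).exists_transition hT hR0 (hφ b') ⟨hb, hw⟩ ⟨hb', hw⟩ hw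
  let j : ℂ → ℂ → ℂ → ZMod k := fun b b' w =>
    if h : w ∈ U b ∧ w ∈ U b' ∧ w ∈ D₀ then (hex b b' w h.1 h.2.1 h.2.2).choose else 0
  have hj : ∀ b b' w, w ∈ U b → w ∈ U b' → w ∈ D₀ → ∀ x, π x = (w : OnePoint ℂ) →
      φ b x = ZMod.stdAddChar (j b b' w) * φ b' x := by
    intro b b' w hb hb' hw
    simp only [j, dif_pos (show w ∈ U b ∧ w ∈ U b' ∧ w ∈ D₀ from ⟨hb, hb', hw⟩)]
    exact (hex b b' w hb hb' hw).choose_spec.1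
  have hjuniq : ∀ b b' w i, w ∈ U b → w ∈ U b' → w ∈ D₀ → (∀ x, π x = (w : OnePoint ℂ) →
      φ b x = ZMod.stdAddChar i * φ b' x) → j b b' w = i := fun b b' w i hb hb' hw hi =>
    (hex b b' w hb hb' hw).unique (hj b b' w hb hb' hw) hi
  -- A point outside D₀ lies in one disc only, the one centred at it. There the only transition is
  -- the trivial one, which matches the default value 0 of `j`.
  have hcenter : ∀ b w, w ∈ U b → w ∉ D₀ → w = b := by
    intro b w hw hw0
    by_contra hne
    exact hw0 (hball b ⟨hw, hne⟩)
  have hself : ∀ b w, j b b w = 0 := by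
    intro b w
    by_cases h : w ∈ U b ∧ w ∈ D₀
    · exact hjuniq b b w 0 h.1 h.1 h.2 fun x _ => by simp
    · simp only [j]
      rw [dif_neg]
      tauto
  -- The exponents `j` form a locally constant cocycle on the discs, and hence define a bundle over
  -- ℂ with discrete fibre ℤ/k.
  let Z : FiberBundleCore ℂ ℂ (ZMod k) :=
    { baseSet := U
      isOpen_baseSet := hU
      indexAt := fun b => b
      mem_baseSet_at := hbU
      coordChange := fun b b' w v => v + j b b' w
      coordChange_self := fun b w _ v => by simp [hself]
      continuousOn_coordChange := by
        intro b b'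
        rintro ⟨w, v⟩ ⟨⟨hw, hw'⟩, -⟩
        have hconst : ∀ᶠ w' in 𝓝 w, j b b' w' = j b b' w := by
          by_cases hw0 : w ∈ D₀
          · have := (hφ b).eventually_transition hT hR0 hD₀ ((hU b).inter hD₀) ((hU b').inter hD₀)
              (hφ b') ⟨hw, hw0⟩ ⟨hw', hw0⟩ hw0 (hj b b' w hw hw' hw0)
            filter_upwards [this, (hU b).mem_nhds hw, (hU b').mem_nhds hw', hD₀.mem_nhds hw0] with
              w' h1 h2 h3 h4
            exact hjuniq b b' w' _ h2 h3 h4 h1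
          · obtain rfl := hcenter b w hw hw0
            obtain rfl := hcenter b' w hw' hw0
            exact Eventually.of_forall fun w' => by rw [hself, hself]
        refine ContinuousAt.continuousWithinAt ?_
        have h1 : ContinuousAt (fun p : ℂ × ZMod k => p.2 + j b b' w) (w, v) := by fun_prop
        refine h1.congr ?_
        have h2 : ∀ᶠ p : ℂ × ZMod k in 𝓝 (w, v), j b b' p.1 = j b b' w :=
          (continuous_fst.tendsto (w, v)).eventually hconst
        filter_upwards [h2] with p hp
        rw [hp]
      coordChange_comp := by
        rintro b b' b'' w ⟨⟨hw, hw'⟩, hw''⟩ v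
        by_cases hw0 : w ∈ D₀
        · rw [add_assoc]
          congr 1
          refine (hjuniq b b'' w _ hw hw'' hw0 fun x hx => ?_).symm
          rw [hj b b' w hw hw' hw0 x hx, hj b' b'' w hw' hw'' hw0 x hx, AddChar.map_add_eq_mul,
            mul_assoc]
        · obtain rfl := hcenter b w hw hw0
          obtain rfl := hcenter b' w hw' hw0
          obtain rfl := hcenter b'' w hw'' hw0
          simp [hself] }
  -- A bundle with discrete fibre is a covering, so over the simply connected plane it has a global
  -- section F: the cocycle is a coboundary.
  have hcov : IsCoveringMap (Z.proj) :=
    IsFiberBundle.isCoveringMap fun w => ⟨Z.localTriv w, hbU w⟩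
  obtain ⟨F, ⟨-, hF⟩, -⟩ := hcov.existsUnique_continuousMap_lifts (ContinuousMap.id ℂ) 0
    (⟨0, (0 : ZMod k)⟩ : Z.TotalSpace) rfl
  have hF1 : ∀ w, (F w).1 = w := fun w => congrFun hF w
  let v : ℂ → ZMod k := fun w => (F w).2
  have hloc : ∀ b w, w ∈ U b → ∀ᶠ w' in 𝓝 w, v w' + j w' b w' = v w + j w b w := by
    intro b w hw
    have h1 : ∀ w', (Z.localTriv b (F w')).2 = v w' + j w' b w' := by
      intro w'
      rw [FiberBundleCore.localTriv_apply]
      simp only [Z, hF1, v]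
    have h2 : ContinuousAt (fun w' => (Z.localTriv b (F w')).2) w := by
      refine continuousAt_snd.comp (ContinuousAt.comp ?_ F.continuous.continuousAt)
      refine (Z.localTriv b).continuousAt ?_
      rw [FiberBundleCore.mem_localTriv_source, hF1]
      exact hw
    simp only [h1] at h2
    exact h2.eventually_mem ((isOpen_discrete {v w + j w b w}).mem_nhds rfl)
  -- At w the function of the disc centred at w is used, corrected by v(w). By `hloc` the result
  -- near w is a constant multiple of the single function φ w.
  refine ⟨fun x => ZMod.stdAddChar (v (RiemannSphere.affineChart (π x))) *
    φ (RiemannSphere.affineChart (π x)) x, ?_, ?_, ?_⟩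
  · intro x w hw hx
    have h1 : ContinuousAt (fun y => ZMod.stdAddChar (v w + j w w w) * φ w y) x :=
      continuousAt_const.mul ((hφ w).continuousAt x w ⟨hbU w, hw⟩ hx)
    refine h1.congr ?_
    have h2 : ((↑) '' (D₀ ∩ U w ∩ {w' | v w' + j w' w w' = v w + j w w w}) : Set (OnePoint ℂ)) ∈
        𝓝 (π x) := by
      rw [hx]
      refine OnePoint.isOpenEmbedding_coe.isOpenMap.image_mem_nhds ?_
      exact inter_mem (inter_mem (hD₀.mem_nhds hw) ((hU w).mem_nhds (hbU w))) (hloc w w (hbU w))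
    filter_upwards [(hT.continuousAt hw hx).eventually_mem h2] with y hy
    obtain ⟨w', ⟨⟨hw0, hwU⟩, hw'⟩, hyw⟩ := hy
    have hw'' : v w' + j w' w w' = v w + j w w w := hw'
    rw [← hyw, RiemannSphere.affineChart_coe, hj w' w w' (hbU w') hwU hw0 y hyw.symm, ← mul_assoc,
      ← AddChar.map_add_eq_mul, hw'']
  · intro x w hw hx
    rw [hx, RiemannSphere.affineChart_coe, mul_pow, stdAddChar_pow_self, one_mul]
    exact (hφ w).pow_eq x w ⟨hbU w, hw⟩ hx
  · intro g x w hw hx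
    rw [hT.map_vadd, hx, RiemannSphere.affineChart_coe, (hφ w).vadd g x w ⟨hbU w, hw⟩ hx]
    ring

end

/-! ### The Kummer function of a finite divisor in the plane -/

section

variable {k : ℕ} [NeZero k] {X : Type*} [TopologicalSpace X] [AddAction (ZMod k) X]
  {π : X → OnePoint ℂ}

theorem exists_ball_sdiff_subset (P : Finset ℂ) (b : ℂ) :
    ∃ r > 0, Metric.ball b r \ {b} ⊆ (↑P : Set ℂ)ᶜ := by
  have h : ((P.erase b : Finset ℂ) : Set ℂ)ᶜ ∈ 𝓝 b :=
    (Finset.finite_toSet _).isClosed.isOpen_compl.mem_nhds (by simp)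
  obtain ⟨r, hr, hsub⟩ := Metric.mem_nhds_iff.1 h
  exact ⟨r, hr, fun w hw hwP => hsub hw.1 (by
    rw [Finset.mem_coe, Finset.mem_erase]
    exact ⟨hw.2, hwP⟩)⟩

theorem continuousOn_prod_zpow (P : Finset ℂ) (α : ℂ → ℤ) :
    ContinuousOn (fun w => ∏ c ∈ P, (w - c) ^ α c) (↑P : Set ℂ)ᶜ := by
  refine continuousOn_finsetProd _ fun c hc => ?_
  refine ContinuousOn.zpow₀ (by fun_prop) _ fun w hw => Or.inl (sub_ne_zero.2 ?_)
  rintro rfl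
  exact hw hc

theorem prod_zpow_ne_zero {P : Finset ℂ} (α : ℂ → ℤ) {w : ℂ} (hw : w ∉ P) :
    ∏ c ∈ P, (w - c) ^ α c ≠ 0 :=
  Finset.prod_ne_zero_iff.2 fun _ hc => zpow_ne_zero _ (sub_ne_zero.2 fun h => hw (h ▸ hc))

theorem IsTorsorOver.exists_kummer {P : Finset ℂ} {α : ℂ → ℤ}
    (hT : IsTorsorOver k π (↑P : Set ℂ)ᶜ)
    (hmono : ∀ c ∈ P, ∀ᶠ r : ℝ in 𝓝[>] (0 : ℝ), ∀ γ : ℝ → X, ContinuousOn γ (Icc 0 1) →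
      (∀ t ∈ Icc (0 : ℝ) 1, π (γ t) =
        ((c + r * Complex.exp (2 * Real.pi * Complex.I * t) : ℂ) : OnePoint ℂ)) →
      γ 1 = (α c : ZMod k) +ᵥ γ 0) :
    ∃ φ, IsKummerOn k π (fun w => ∏ c ∈ P, (w - c) ^ α c) (↑P : Set ℂ)ᶜ φ := by
  refine hT.exists_isKummerOn_of_local (fun w hw => prod_zpow_ne_zero α hw)
    (Finset.finite_toSet _).isClosed.isOpen_compl fun b => ?_
  obtain ⟨r, hr, hball⟩ := exists_ball_sdiff_subset P b
  refine ⟨r, hr, hball, ?_⟩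
  by_cases hb : b ∈ P
  · obtain ⟨r₀, hr₀, hr₀pos, hr₀r⟩ := ((hmono b hb).and (Ioo_mem_nhdsGT hr)).exists
    have herase : Metric.ball b r ⊆ (↑(P.erase b) : Set ℂ)ᶜ := by
      intro w hw hwP
      have := Finset.mem_erase.1 (Finset.mem_coe.1 hwP)
      exact hball ⟨hw, this.1⟩ this.2
    obtain ⟨φ, hφ⟩ := hT.exists_isKummerOn_punctured hr hball (α b)
      (R := fun w => ∏ c ∈ P, (w - c) ^ α c)
      ((continuousOn_prod_zpow (P.erase b) α).mono herase)
      (fun w hw => prod_zpow_ne_zero α (herase hw))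
      (fun w _ => (Finset.mul_prod_erase P (fun c => (w - c) ^ α c) hb).symm) hr₀pos hr₀r hr₀
    refine ⟨φ, hφ.mono fun w hw => ⟨hw.1, ?_⟩⟩
    rintro rfl
    exact hw.2 hb
  · have hball' : Metric.ball b r ⊆ (↑P : Set ℂ)ᶜ := by
      intro w hw
      by_cases hwb : w = b
      · rw [hwb]; exact hb
      · exact hball ⟨hw, hwb⟩
    obtain ⟨φ, hφ⟩ := hT.exists_isKummerOn_ball hr hball'
      ((continuousOn_prod_zpow P α).mono hball') (fun w hw => prod_zpow_ne_zero α (hball' hw))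
    exact ⟨φ, hφ.mono inter_subset_left⟩

end

theorem chartAt_coe (w : ℂ) : chartAt ℂ (w : OnePoint ℂ) = RiemannSphere.affineChart :=
  if_neg (OnePoint.coe_ne_infty w)

theorem chartAt_infty : chartAt ℂ (OnePoint.infty : OnePoint ℂ) = RiemannSphere.inftyChart :=
  if_pos rfl

theorem smallCircle_coe (c : ℂ) (r t : ℝ) : smallCircle (c : OnePoint ℂ) r t =
    ((c + r * Complex.exp (2 * Real.pi * Complex.I * t) : ℂ) : OnePoint ℂ) := by
  rw [smallCircle, chartAt_coe, RiemannSphere.affineChart_coe, RiemannSphere.affineChart_symm]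

namespace IsCyclicCover

variable {k s : ℕ} {a : Fin s → ZMod k} {z : Fin s → OnePoint ℂ}
    {X : Type*} [TopologicalSpace X] [ChartedSpace ℂ X] [AddAction (ZMod k) X]
    {π : X → OnePoint ℂ}

theorem isTorsorOver (h : IsCyclicCover k a z π) {P : Finset ℂ}
    (hP : ∀ c : ℂ, (c : OnePoint ℂ) ∈ range z → c ∈ P) : IsTorsorOver k π (↑P : Set ℂ)ᶜ where
  isCoveringMapOn := h.isCoveringMapOn.mono (by
    rintro _ ⟨c, hc, rfl⟩ hz
    exact hc (hP c hz))
  surjective w _ := h.surjective _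
  fiber := h.fiber
  free g x w hw hx := h.free g x fun hz => hw (hP w (hx ▸ hz))
  continuous_vadd g := (h.holomorphic_vadd g).continuous

theorem exists_kummer [NeZero k] (h : IsCyclicCover k a z π) {P : Finset ℂ}
    (hP : ∀ c : ℂ, (c : OnePoint ℂ) ∈ range z ↔ c ∈ P) {α : ℂ → ℤ}
    (hα : ∀ i, ∀ c : ℂ, z i = c → (α c : ZMod k) = a i) :
    ∃ φ, IsKummerOn k π (fun w => ∏ c ∈ P, (w - c) ^ α c) (↑P : Set ℂ)ᶜ φ := by
  refine (h.isTorsorOver fun c => (hP c).1).exists_kummer fun c hc => ?_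
  obtain ⟨i, hi⟩ := (hP c).2 hc
  filter_upwards [h.monodromy i] with r hr γ hγ hlift
  rw [hα i c hi]
  refine hr γ hγ fun t ht => ?_
  rw [hlift t ht, hi, smallCircle_coe]

end IsCyclicCover

/-! ### Meromorphic quadratic differentials on the sphere -/

namespace QuadDiff

variable {N : Type*} [TopologicalSpace N] [ChartedSpace ℂ N]

theorem toFun_congr (q : QuadDiff N) {x y : N} (hxy : x = y) (v : ℂ) :
    q.toFun x (v : TangentSpace 𝓘(ℂ) x) = q.toFun y (v : TangentSpace 𝓘(ℂ) y) := by
  subst hxy; rfl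

/-- The chain rule multiplies the tangent vector by ψ', and homogeneity of degree two squares this
factor. -/
theorem toFun_mfderiv_comp (q : QuadDiff N) {e : OpenPartialHomeomorph N ℂ} {ψ : ℂ → ℂ} {h : ℂ → N}
    {ζ : ℂ} (he : MDifferentiableAt 𝓘(ℂ) 𝓘(ℂ) e.symm (ψ ζ)) (hh : h =ᶠ[𝓝 ζ] e.symm ∘ ψ)
    (hψ : DifferentiableAt ℂ ψ ζ) :
    q.toFun (h ζ) (mfderiv 𝓘(ℂ) 𝓘(ℂ) h ζ (1 : ℂ)) = q.coeff e (ψ ζ) * deriv ψ ζ ^ 2 := by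
  have h1 : (mfderiv 𝓘(ℂ) 𝓘(ℂ) h ζ (1 : ℂ) : ℂ) =
      deriv ψ ζ • (mfderiv 𝓘(ℂ) 𝓘(ℂ) e.symm (ψ ζ) (1 : ℂ) : ℂ) := by
    have h2 : (mfderiv 𝓘(ℂ) 𝓘(ℂ) h ζ (1 : ℂ) : ℂ) = mfderiv 𝓘(ℂ) 𝓘(ℂ) (e.symm ∘ ψ) ζ (1 : ℂ) := by
      rw [hh.mfderiv_eq]; rfl
    have h3 : (mfderiv 𝓘(ℂ) 𝓘(ℂ) ψ ζ (1 : ℂ) : ℂ) = deriv ψ ζ • (1 : ℂ) := by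
      rw [mfderiv_eq_fderiv, smul_eq_mul, mul_one]
      exact fderiv_apply_one_eq_deriv (𝕜 := ℂ) (F := ℂ) (f := ψ) (x := ζ)
    exact h2.trans ((mfderiv_comp_apply ζ he hψ.mdifferentiableAt (1 : ℂ)).trans
      ((congrArg (mfderiv 𝓘(ℂ) 𝓘(ℂ) e.symm (ψ ζ)) h3).trans
        (_root_.map_smul (mfderiv 𝓘(ℂ) 𝓘(ℂ) e.symm (ψ ζ)) (deriv ψ ζ) (1 : ℂ))))
  have h4 : h ζ = e.symm (ψ ζ) := hh.eq_of_nhds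
  rw [q.toFun_congr h4 (mfderiv 𝓘(ℂ) 𝓘(ℂ) h ζ (1 : ℂ)), h1]
  rw [coeff, mul_comm]
  exact q.map_smul _ _ _

theorem pullback_coeff {M : Type*} [TopologicalSpace M] [ChartedSpace ℂ M] (q : QuadDiff N)
    {π : M → N} {e : OpenPartialHomeomorph M ℂ} {e' : OpenPartialHomeomorph N ℂ} {ψ : ℂ → ℂ} {ζ : ℂ}
    (hπ : MDifferentiableAt 𝓘(ℂ) 𝓘(ℂ) π (e.symm ζ)) (he : MDifferentiableAt 𝓘(ℂ) 𝓘(ℂ) e.symm ζ)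
    (he' : MDifferentiableAt 𝓘(ℂ) 𝓘(ℂ) e'.symm (ψ ζ))
    (hh : π ∘ e.symm =ᶠ[𝓝 ζ] e'.symm ∘ ψ) (hψ : DifferentiableAt ℂ ψ ζ) :
    (q.pullback π).coeff e ζ = q.coeff e' (ψ ζ) * deriv ψ ζ ^ 2 := by
  rw [← q.toFun_mfderiv_comp he' hh hψ]
  exact congrArg (q.toFun (π (e.symm ζ))) (mfderiv_comp_apply ζ hπ he (1 : ℂ)).symm

/-- Used to exclude that π is constant near a point of a natural chart, where the coefficient is 1
off isolated points. -/
theorem pullback_coeff_eq_zero {M : Type*} [TopologicalSpace M] [ChartedSpace ℂ M]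
    (q : QuadDiff N) {π : M → N} {e : OpenPartialHomeomorph M ℂ} {ζ : ℂ}
    (h : mfderiv 𝓘(ℂ) 𝓘(ℂ) π (e.symm ζ) (mfderiv 𝓘(ℂ) 𝓘(ℂ) e.symm ζ (1 : ℂ)) = 0) :
    (q.pullback π).coeff e ζ = 0 := by
  change q.toFun _ (mfderiv 𝓘(ℂ) 𝓘(ℂ) π (e.symm ζ) (mfderiv 𝓘(ℂ) 𝓘(ℂ) e.symm ζ (1 : ℂ))) = 0
  rw [h]
  have := q.map_smul (π (e.symm ζ)) 0 0
  simpa using this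

end QuadDiff

theorem mem_maximalAtlas_affineChart :
    RiemannSphere.affineChart ∈ IsManifold.maximalAtlas 𝓘(ℂ) ω (OnePoint ℂ) := by
  rw [← chartAt_coe 0]
  exact IsManifold.chart_mem_maximalAtlas _

theorem mem_maximalAtlas_inftyChart :
    RiemannSphere.inftyChart ∈ IsManifold.maximalAtlas 𝓘(ℂ) ω (OnePoint ℂ) := by
  rw [← chartAt_infty]
  exact IsManifold.chart_mem_maximalAtlas _

theorem affineChart_target : RiemannSphere.affineChart.target = univ := by
  simp [RiemannSphere.affineChart]

theorem mdifferentiableAt_affineChart_symm (w : ℂ) :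
    MDifferentiableAt 𝓘(ℂ) 𝓘(ℂ) RiemannSphere.affineChart.symm w :=
  mdifferentiableAt_symm_of_mem_maximalAtlas
    (IsManifold.maximalAtlas_subset_of_le (by simp) mem_maximalAtlas_affineChart)
    (by rw [affineChart_target]; trivial)

theorem coeff_inftyChart (q : QuadDiff (OnePoint ℂ)) {u : ℂ} (hu : u ≠ 0) :
    q.coeff RiemannSphere.inftyChart u = q.coeff RiemannSphere.affineChart u⁻¹ * u ^ (-4 : ℤ) := by
  have h := q.toFun_mfderiv_comp (e := RiemannSphere.affineChart) (ψ := fun u => u⁻¹)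
    (h := RiemannSphere.inftyChart.symm) (ζ := u) (mdifferentiableAt_affineChart_symm _) (by
      filter_upwards [isOpen_ne.mem_nhds hu] with v hv
      rw [RiemannSphere.inftyChart_symm, RiemannSphere.inv_coe hv]
      rfl) (differentiableAt_inv hu)
  rw [QuadDiff.coeff, h, deriv_inv]
  congr 1
  rw [zpow_neg]
  field_simp

theorem prod_zpow_eq_zpow_sum {ι : Type*} {u : ℂ} (hu : u ≠ 0) (t : Finset ι) (κ : ι → ℤ) :
    ∏ i ∈ t, u ^ κ i = u ^ ∑ i ∈ t, κ i := by
  classical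
  induction t using Finset.induction_on with
  | empty => simp
  | insert i t hi ih => rw [Finset.prod_insert hi, Finset.sum_insert hi, zpow_add₀ hu, ih]

/-- A meromorphic function on the sphere is determined up to a constant factor by its divisor. -/
theorem exists_eq_const_mul_prod {f : ℂ → ℂ} {P : Finset ℂ} {κ : ℂ → ℤ}
    (hf : ∀ w ∉ P, AnalyticAt ℂ f w) (hm : ∀ c ∈ P, MeromorphicAt f c)
    (hord : ∀ c ∈ P, meromorphicOrderAt f c = κ c) {g : ℂ → ℂ} (hg : MeromorphicAt g 0)
    (hgf : ∀ u ≠ 0, g u = f u⁻¹ * u ^ (-4 : ℤ))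
    (hgord : meromorphicOrderAt g 0 = ((-4 - ∑ c ∈ P, κ c : ℤ) : WithTop ℤ)) :
    ∃ C ≠ 0, ∀ w ∉ P, f w = C * ∏ c ∈ P, (w - c) ^ κ c := by
  -- G is f divided by the expected product; the claim is that it is constant.
  set G : ℂ → ℂ := fun w => f w * ∏ c ∈ P, (w - c) ^ (-κ c) with hG
  have hprodan : ∀ (T : Finset ℂ), ∀ w ∉ T,
      AnalyticAt ℂ (fun w => ∏ c ∈ T, (w - c) ^ (-κ c)) w := by
    intro T w hw
    refine Finset.analyticAt_fun_prod T fun c hc => ?_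
    refine AnalyticAt.zpow (by fun_prop) (sub_ne_zero.2 ?_)
    rintro rfl
    exact hw hc
  have hloc : ∀ w, ∃ A, AnalyticAt ℂ A w ∧ ∀ᶠ v in 𝓝[≠] w, G v = A v := by
    intro w
    by_cases hw : w ∈ P
    · obtain ⟨h, hh, -, hfh⟩ := (meromorphicOrderAt_eq_int_iff (hm w hw)).1 (hord w hw)
      refine ⟨fun v => h v * ∏ c ∈ P.erase w, (v - c) ^ (-κ c),
        hh.mul (hprodan _ w (by simp)), ?_⟩
      filter_upwards [hfh, self_mem_nhdsWithin] with v hv hvw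
      have hne : v - w ≠ 0 := sub_ne_zero.2 hvw
      simp only [hG]
      rw [hv, ← Finset.mul_prod_erase P (fun c => (v - c) ^ (-κ c)) hw, smul_eq_mul, zpow_neg]
      field_simp
    · exact ⟨G, (hf w hw).mul (hprodan P w hw), Eventually.of_forall fun _ => rfl⟩
  -- The limit over punctured neighbourhoods removes the singularities of G at the points of P and
  -- gives an entire function.
  let Gt : ℂ → ℂ := fun w => limUnder (𝓝[≠] w) G
  have hGt : ∀ w A, ContinuousAt A w → (∀ᶠ v in 𝓝[≠] w, G v = A v) → Gt w = A w := by
    intro w A hA hGA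
    refine Tendsto.limUnder_eq ?_
    exact (hA.tendsto.mono_left nhdsWithin_le_nhds).congr' (hGA.mono fun v hv => hv.symm)
  have hGtd : Differentiable ℂ Gt := by
    intro w
    obtain ⟨A, hA, hGA⟩ := hloc w
    refine hA.differentiableAt.congr_of_eventuallyEq ?_
    have h1 : ∀ᶠ v in 𝓝 w, ∀ᶠ v' in 𝓝[≠] v, G v' = A v' := by
      have h2 := eventually_eventually_nhdsWithin.2 hGA
      rw [eventually_nhdsWithin_iff] at h2
      filter_upwards [h2] with v hv
      by_cases hvw : v = w
      · rw [hvw]; exact hGA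
      · have h3 := hv hvw
        rw [isOpen_compl_singleton.nhdsWithin_eq hvw] at h3
        exact h3.filter_mono nhdsWithin_le_nhds
    filter_upwards [h1, hA.eventually_analyticAt] with v hv hAv
    exact hGt v A hAv.continuousAt hv
  obtain ⟨h, hh, hh0, hgh⟩ := (meromorphicOrderAt_eq_int_iff hg).1 hgord
  -- At infinity the prescribed order -4 - ∑ κ, the factor u⁴ from dw² and the degree of the product
  -- cancel, so G has the finite limit h 0 there. An entire function with a finite limit at infinity
  -- is constant.
  have hinv : ∀ᶠ u in 𝓝[≠] (0 : ℂ), G u⁻¹ = h u * ∏ c ∈ P, (1 - c * u) ^ (-κ c) := by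
    filter_upwards [hgh, self_mem_nhdsWithin] with u hu hu0
    have hu0' : u ≠ 0 := hu0
    have h1 : ∏ c ∈ P, (u⁻¹ - c) ^ (-κ c) =
        u ^ (∑ c ∈ P, κ c) * ∏ c ∈ P, (1 - c * u) ^ (-κ c) := by
      rw [← prod_zpow_eq_zpow_sum hu0', ← Finset.prod_mul_distrib]
      refine Finset.prod_congr rfl fun c _ => ?_
      rw [show u⁻¹ - c = u⁻¹ * (1 - c * u) by field_simp, mul_zpow, inv_zpow', neg_neg]
    rw [hgf u hu0', smul_eq_mul, sub_zero] at hu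
    have h2 : f u⁻¹ = u ^ (-4 - ∑ c ∈ P, κ c) * h u * u ^ (4 : ℤ) := by
      rw [← hu, mul_assoc, ← zpow_add₀ hu0', show (-4 : ℤ) + 4 = 0 by norm_num, zpow_zero, mul_one]
    simp only [hG]
    rw [h1, h2]
    have h3 : u ^ (-4 - ∑ c ∈ P, κ c) * u ^ (4 : ℤ) * u ^ (∑ c ∈ P, κ c) = 1 := by
      rw [← zpow_add₀ hu0', ← zpow_add₀ hu0', show -4 - ∑ c ∈ P, κ c + 4 + ∑ c ∈ P, κ c = 0 by ring,
        zpow_zero]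
    linear_combination (h u * ∏ c ∈ P, (1 - c * u) ^ (-κ c)) * h3
  have hlim : Tendsto (fun u => h u * ∏ c ∈ P, (1 - c * u) ^ (-κ c)) (𝓝[≠] 0) (𝓝 (h 0)) := by
    have h1 : ContinuousAt (fun u => h u * ∏ c ∈ P, (1 - c * u) ^ (-κ c)) 0 := by
      refine hh.continuousAt.mul (tendsto_finsetProd _ fun c _ => ?_)
      exact ContinuousAt.zpow₀ (by fun_prop) _ (by simp)
    have h2 := h1.tendsto.mono_left (nhdsWithin_le_nhds (s := {0}ᶜ))
    simpa using h2
  have hGlim : Tendsto Gt (cocompact ℂ) (𝓝 (h 0)) := by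
    rw [← Metric.cobounded_eq_cocompact]
    have h1 : Tendsto (fun w : ℂ => G (w⁻¹)⁻¹) (Bornology.cobounded ℂ) (𝓝 (h 0)) :=
      (hlim.congr' (hinv.mono fun u hu => hu.symm)).comp tendsto_inv₀_cobounded'
    refine h1.congr' ?_
    have h2 : ∀ᶠ w in Bornology.cobounded ℂ, w ∉ P := by
      exact Bornology.isBounded_def.1 P.finite_toSet.isBounded
    filter_upwards [h2] with w hw
    rw [inv_inv]
    exact (hGt w G ((hf w hw).mul (hprodan P w hw)).continuousAt
      (Eventually.of_forall fun _ => rfl)).symm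
  refine ⟨h 0, hh0, fun w hw => ?_⟩
  have h1 : G w = h 0 := by
    rw [← hGt w G ((hf w hw).mul (hprodan P w hw)).continuousAt (Eventually.of_forall fun _ => rfl)]
    exact hGtd.apply_eq_of_tendsto_cocompact w hGlim
  rw [← h1]
  simp only [hG]
  rw [mul_assoc, ← Finset.prod_mul_distrib, Finset.prod_eq_one, mul_one]
  intro c hc
  rw [zpow_neg, inv_mul_cancel₀]
  refine zpow_ne_zero _ (sub_ne_zero.2 ?_)
  rintro rfl
  exact hw hc

/-! ### Straight lines on translation surfaces -/

section

variable {X : Type*} [TopologicalSpace X]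

/-- The coordinate changes between the charts in `𝒟` are locally translations. -/
def IsTranslationAtlas (𝒟 : Set (OpenPartialHomeomorph X ℂ)) : Prop :=
  ∀ D ∈ 𝒟, ∀ D' ∈ 𝒟, ∀ x ∈ D.source, x ∈ D'.source → ∀ᶠ y in 𝓝 x, D' y - D y = D' x - D x

/-- Near the time `t`, the path `γ` is a straight line with velocity `V`. -/
def IsLineAt (𝒟 : Set (OpenPartialHomeomorph X ℂ)) (V : ℂ) (γ : ℝ → X) (t : ℝ) : Prop :=
  ∃ D ∈ 𝒟, γ t ∈ D.source ∧
    ∀ᶠ r in 𝓝 t, γ r ∈ D.source ∧ D (γ r) = D (γ t) + ((r - t : ℝ) : ℂ) * V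

variable {𝒟 : Set (OpenPartialHomeomorph X ℂ)} {V V' : ℂ} {γ γ' : ℝ → X} {t c : ℝ}

namespace IsLineAt

theorem continuousAt (h : IsLineAt 𝒟 V γ t) : ContinuousAt γ t := by
  obtain ⟨D, -, hx, h⟩ := h
  have h1 : ContinuousAt (fun r : ℝ => D.symm (D (γ t) + ((r - t : ℝ) : ℂ) * V)) t := by
    refine ContinuousAt.comp (g := D.symm) (D.symm.continuousAt ?_) (by fun_prop)
    simpa using D.map_source hx
  refine h1.congr ?_
  filter_upwards [h] with r hr
  rw [← hr.2, D.left_inv hr.1]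

theorem congr (h : IsLineAt 𝒟 V γ t) (hγ : γ' =ᶠ[𝓝 t] γ) : IsLineAt 𝒟 V γ' t := by
  obtain ⟨D, hD, hx, h⟩ := h
  refine ⟨D, hD, by rwa [hγ.eq_of_nhds], ?_⟩
  filter_upwards [h, hγ] with r hr hγr
  rwa [hγ.eq_of_nhds, hγr]

theorem comp_add (h : IsLineAt 𝒟 V γ (t + c)) : IsLineAt 𝒟 V (fun r => γ (r + c)) t := by
  obtain ⟨D, hD, hx, h⟩ := h
  refine ⟨D, hD, hx, ?_⟩
  have h1 : Tendsto (fun r : ℝ => r + c) (𝓝 t) (𝓝 (t + c)) :=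
    Continuous.tendsto (by fun_prop) t
  filter_upwards [h1.eventually h] with r hr
  simpa using hr

theorem comp_sub (h : IsLineAt 𝒟 V γ (c - t)) : IsLineAt 𝒟 (-V) (fun r => γ (c - r)) t := by
  obtain ⟨D, hD, hx, h⟩ := h
  refine ⟨D, hD, hx, ?_⟩
  have h1 : Tendsto (fun r : ℝ => c - r) (𝓝 t) (𝓝 (c - t)) :=
    Continuous.tendsto (by fun_prop) t
  filter_upwards [h1.eventually h] with r hr
  refine ⟨hr.1, ?_⟩
  rw [hr.2]
  push_cast
  ring

theorem eventually (h : IsLineAt 𝒟 V γ t) : ∀ᶠ r in 𝓝 t, IsLineAt 𝒟 V γ r := by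
  obtain ⟨D, hD, hx, h⟩ := h
  filter_upwards [h.eventually_nhds] with r hr
  refine ⟨D, hD, hr.self_of_nhds.1, ?_⟩
  filter_upwards [hr] with r' hr'
  refine ⟨hr'.1, ?_⟩
  rw [hr'.2, hr.self_of_nhds.2]
  push_cast
  ring

variable (h𝒟 : IsTranslationAtlas 𝒟)
include h𝒟

theorem chart (h : IsLineAt 𝒟 V γ t) {D : OpenPartialHomeomorph X ℂ} (hD : D ∈ 𝒟)
    (hx : γ t ∈ D.source) :
    ∀ᶠ r in 𝓝 t, γ r ∈ D.source ∧ D (γ r) = D (γ t) + ((r - t : ℝ) : ℂ) * V := by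
  have hc := h.continuousAt
  obtain ⟨D', hD', hx', h⟩ := h
  filter_upwards [h, hc.eventually (h𝒟 D' hD' D hD _ hx' hx),
    hc.eventually_mem (D.open_source.mem_nhds hx)] with r h1 h2 h3
  refine ⟨h3, ?_⟩
  linear_combination h2 + h1.2

theorem hasDerivAt (h : IsLineAt 𝒟 V γ t) {D : OpenPartialHomeomorph X ℂ} (hD : D ∈ 𝒟)
    (hx : γ t ∈ D.source) : HasDerivAt (fun r => D (γ r)) V t := by
  have h1 : HasDerivAt (fun r : ℝ => D (γ t) + ((r - t : ℝ) : ℂ) * V) V t := by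
    have h2 : HasDerivAt (fun r : ℝ => ((r - t : ℝ) : ℂ)) 1 t := by
      simpa using ((hasDerivAt_id t).sub_const t).ofReal_comp
    simpa using (h2.mul_const V).const_add (D (γ t))
  refine h1.congr_of_eventuallyEq ?_
  filter_upwards [h.chart h𝒟 hD hx] with r hr using hr.2

theorem unique (h : IsLineAt 𝒟 V γ t) (h' : IsLineAt 𝒟 V' γ t) : V = V' := by
  obtain ⟨D, hD, hx, -⟩ := id h
  exact (h.hasDerivAt h𝒟 hD hx).unique (h'.hasDerivAt h𝒟 hD hx)

/-- Translations preserve velocities, so the velocity is unique and locally constant on the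
connected set J. -/
theorem exists_forall {J : Set ℝ} (hJ : IsPreconnected J)
    (h : ∀ t ∈ J, ∃ V, IsLineAt 𝒟 V γ t) : ∃ V, ∀ t ∈ J, IsLineAt 𝒟 V γ t := by
  rcases J.eq_empty_or_nonempty with rfl | ⟨t₀, ht₀⟩
  · exact ⟨0, fun t ht => ht.elim⟩
  obtain ⟨V₀, hV₀⟩ := h t₀ ht₀
  refine ⟨V₀, fun t ht => ?_⟩
  by_contra hne
  have hopen : ∀ p : ℂ → Prop, IsOpen {t | ∃ V, p V ∧ IsLineAt 𝒟 V γ t} := by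
    intro p
    rw [isOpen_iff_mem_nhds]
    rintro t ⟨V, hp, hV⟩
    filter_upwards [hV.eventually] with r hr using ⟨V, hp, hr⟩
  obtain ⟨r, -, ⟨V, hV, hr⟩, V', hV', hr'⟩ := hJ _ _ (hopen (· = V₀)) (hopen (· ≠ V₀))
    (fun t ht => by
      obtain ⟨V, hV⟩ := h t ht
      by_cases hVV : V = V₀
      · exact Or.inl ⟨V, hVV, hV⟩
      · exact Or.inr ⟨V, hVV, hV⟩)
    ⟨t₀, ht₀, V₀, rfl, hV₀⟩ (by
      obtain ⟨V, hV⟩ := h t ht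
      refine ⟨t, ht, V, ?_, hV⟩
      rintro rfl
      exact hne hV)
  exact hV' ((hr'.unique h𝒟 hr).trans hV)

theorem eq_of_eq [T2Space X] (h : ∀ t, IsLineAt 𝒟 V γ t) (h' : ∀ t, IsLineAt 𝒟 V γ' t) {t₀ : ℝ}
    (h0 : γ t₀ = γ' t₀) : γ = γ' := by
  have hclosed : IsClosed {t | γ t = γ' t} :=
    isClosed_eq (continuous_iff_continuousAt.2 fun t => (h t).continuousAt)
      (continuous_iff_continuousAt.2 fun t => (h' t).continuousAt)
  have hopen : IsOpen {t | γ t = γ' t} := by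
    rw [isOpen_iff_mem_nhds]
    intro t (ht : γ t = γ' t)
    obtain ⟨D, hD, hx, -⟩ := id (h t)
    filter_upwards [(h t).chart h𝒟 hD hx, (h' t).chart h𝒟 hD (ht ▸ hx)] with r h1 h2
    exact D.injOn h1.1 h2.1 (by rw [h1.2, h2.2, ht])
  have := IsClopen.eq_univ ⟨hclosed, hopen⟩ ⟨t₀, h0⟩
  funext t
  have ht : t ∈ {t | γ t = γ' t} := this ▸ mem_univ t
  exact ht

/-- A straight path starting at a point of a chart is straight in the chart from the start. -/
theorem start {T : ℝ} (hT : 0 < T) (hc : ContinuousOn γ (Icc 0 T))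
    (h : ∀ t ∈ Ioo 0 T, IsLineAt 𝒟 V γ t) {D : OpenPartialHomeomorph X ℂ} (hD : D ∈ 𝒟)
    (hx : γ 0 ∈ D.source) :
    ∃ δ > 0, δ ≤ T ∧ ∀ t ∈ Ico 0 δ, γ t ∈ D.source ∧ D (γ t) = D (γ 0) + (t : ℂ) * V := by
  have h1 : ∀ᶠ t in 𝓝[Icc 0 T] 0, γ t ∈ D.source :=
    (hc 0 ⟨le_rfl, hT.le⟩).eventually_mem (D.open_source.mem_nhds hx)
  rw [eventually_nhdsWithin_iff, Metric.eventually_nhds_iff] at h1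
  obtain ⟨ε, hε, h1⟩ := h1
  refine ⟨min ε T, lt_min hε hT, min_le_right _ _, fun t ht => ?_⟩
  have htT : t < T := ht.2.trans_le (min_le_right _ _)
  have htε : t < ε := ht.2.trans_le (min_le_left _ _)
  have hmem : ∀ r ∈ Icc 0 t, γ r ∈ D.source := fun r hr =>
    h1 (by rw [Real.dist_eq, sub_zero, abs_of_nonneg hr.1]; exact hr.2.trans_lt htε)
      ⟨hr.1, (hr.2.trans_lt htT).le⟩
  refine ⟨hmem t ⟨ht.1, le_rfl⟩, ?_⟩
  have hcont : ContinuousOn (fun r : ℝ => D (γ r) - (r : ℂ) * V) (Icc 0 t) := by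
    refine ContinuousOn.sub ?_ (by fun_prop)
    exact D.continuousOn.comp (hc.mono (Icc_subset_Icc_right htT.le)) hmem
  have hder : ∀ r ∈ Ioo 0 t, HasDerivAt (fun r : ℝ => D (γ r) - (r : ℂ) * V) 0 r := by
    intro r hr
    have h2 := (h r ⟨hr.1, hr.2.trans htT⟩).hasDerivAt h𝒟 hD (hmem r ⟨hr.1.le, hr.2.le⟩)
    have h3 : HasDerivAt (fun r : ℝ => (r : ℂ) * V) V r := by
      simpa using ((hasDerivAt_id r).ofReal_comp).mul_const V
    have h4 := h2.sub h3
    rw [sub_self] at h4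
    exact h4
  rcases ht.1.eq_or_lt with h0 | h0
  · simp [← h0]
  -- The derivative is known only at positive times: constancy holds on [a, t] for a > 0, and then a
  -- tends to 0.
  have h5 : ∀ a ∈ Ioo 0 t, D (γ t) - (t : ℂ) * V = D (γ a) - (a : ℂ) * V := fun a ha =>
    constant_of_has_deriv_right_zero (hcont.mono (Icc_subset_Icc_left ha.1.le))
      (fun r hr => (hder r ⟨ha.1.trans_le hr.1, hr.2⟩).hasDerivWithinAt) t ⟨ha.2.le, le_rfl⟩
  have h6 : Tendsto (fun r : ℝ => D (γ r) - (r : ℂ) * V) (𝓝[Ioo 0 t] 0)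
      (𝓝 (D (γ 0) - ((0 : ℝ) : ℂ) * V)) :=
    (hcont 0 ⟨le_rfl, h0.le⟩).mono_left (nhdsWithin_mono _ Ioo_subset_Icc_self)
  have h7 : (𝓝[Ioo 0 t] (0 : ℝ)).NeBot := by
    rw [nhdsWithin_Ioo_eq_nhdsGT h0]; infer_instance
  have := tendsto_nhds_unique (h6.congr' (by
    filter_upwards [self_mem_nhdsWithin] with a ha using (h5 a ha).symm)) tendsto_const_nhds
  rw [Complex.ofReal_zero, zero_mul, sub_zero] at this
  linear_combination -this

/-- A straight path that closes up extends to a periodic straight line. -/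
theorem exists_periodic {T : ℝ} (hT : 0 < T) (hc : ContinuousOn γ (Icc 0 T)) (h0 : γ 0 = γ T)
    (h : ∀ t ∈ Ioo 0 T, IsLineAt 𝒟 V γ t) {D : OpenPartialHomeomorph X ℂ} (hD : D ∈ 𝒟)
    (hx : γ 0 ∈ D.source) :
    ∃ γ' : ℝ → X, (∀ t ∈ Icc 0 T, γ' t = γ t) ∧ Function.Periodic γ' T ∧
      ∀ t, IsLineAt 𝒟 V γ' t := by
  obtain ⟨γ', hdef⟩ : ∃ γ' : ℝ → X, ∀ t, γ' t = γ (toIcoMod hT 0 t) := ⟨_, fun _ => rfl⟩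
  have hper : Function.Periodic γ' T := fun t => by
    rw [hdef, hdef, toIcoMod_add_right]
  have hIco : ∀ t ∈ Ico 0 T, γ' t = γ t := fun t ht => by
    rw [hdef, (toIcoMod_eq_self hT).2 (by simpa using ht)]
  have hIcc : ∀ t ∈ Icc 0 T, γ' t = γ t := fun t ht => by
    rcases ht.2.eq_or_lt with h1 | h1
    · rw [h1, ← h0, ← zero_add T, hper, hIco 0 ⟨le_rfl, hT⟩]
    · exact hIco t ⟨ht.1, h1⟩
  refine ⟨γ', hIcc, hper, ?_⟩
  -- At the closing point the beginning of γ and the beginning of its reverse are read in the same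
  -- chart D; their velocities V and -V fit together to a line through time 0.
  have hzero : IsLineAt 𝒟 V γ' 0 := by
    obtain ⟨δ, hδ, hδT, h1⟩ := start h𝒟 hT hc h hD hx
    obtain ⟨δ', hδ', hδT', h2⟩ := start (γ := fun t => γ (T - t)) (V := -V) h𝒟 hT
      (hc.comp (by fun_prop) fun t ht => ⟨by linarith [ht.2], by linarith [ht.1]⟩)
      (fun t ht => (h (T - t) ⟨by linarith [ht.2], by linarith [ht.1]⟩).comp_sub) hD
      (by simpa [← h0] using hx)
    simp only [sub_zero, ← h0] at h2
    have e0 : γ' 0 = γ 0 := hIco 0 ⟨le_rfl, hT⟩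
    refine ⟨D, hD, by rwa [e0], ?_⟩
    filter_upwards [Ioo_mem_nhds (neg_lt_zero.2 hδ') hδ] with r hr
    rw [e0, sub_zero]
    rcases le_or_gt 0 r with h3 | h3
    · rw [hIco r ⟨h3, hr.2.trans_le hδT⟩]
      exact h1 r ⟨h3, hr.2⟩
    · have e1 : γ' r = γ (T - -r) := by
        rw [← hper r]
        rw [hIco (r + T) ⟨by linarith [hr.1], by linarith⟩, sub_neg_eq_add, add_comm]
      have h4 := h2 (-r) ⟨by linarith, by linarith [hr.1]⟩
      rw [e1]
      refine ⟨h4.1, ?_⟩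
      rw [h4.2]
      push_cast
      ring
  intro t
  have h1 : toIcoMod hT 0 t ∈ Ico 0 T := by simpa using toIcoMod_mem_Ico hT 0 t
  have h2 : IsLineAt 𝒟 V γ' (toIcoMod hT 0 t) := by
    rcases h1.1.eq_or_lt with h3 | h3
    · rw [← h3]; exact hzero
    · refine (h _ ⟨h3, h1.2⟩).congr ?_
      filter_upwards [Ioo_mem_nhds h3 h1.2] with r hr using hIco r ⟨hr.1.le, hr.2⟩
  have h3 : toIcoMod hT 0 t = t + (-(toIcoDiv hT 0 t • T)) := by
    rw [toIcoMod, sub_eq_add_neg]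
  rw [h3] at h2
  refine h2.comp_add.congr (Eventually.of_forall fun r => ?_)
  simp only [hdef, ← sub_eq_add_neg, toIcoMod_sub_zsmul]

end IsLineAt

end

/-! ### The flat structure of a cyclic cover -/

/-- A cyclic cover of degree `k`, in terms of a coordinate `U` of the sphere that is finite on the
open set `X₀`: the quadratic differential is `q = C * ∏ (U - c) ^ κ c * dU²`, and the cover is given
by the root `F` of `C' * ∏ (U - c) ^ α c`. -/
structure FlatCover (k : ℕ) [NeZero k] {X : Type*} [TopologicalSpace X] [ChartedSpace ℂ X]
    [IsManifold 𝓘(ℂ) ω X] [AddAction (ZMod k) X] (q : QuadDiff X) (X₀ : Set X) (Q : Finset ℂ)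
    (κ α : ℂ → ℤ) (U F : X → ℂ) (C C' : ℂ) : Prop where
  even : Even k
  isOpen : IsOpen X₀
  mdifferentiableAt : ∀ x ∈ X₀, MDifferentiableAt 𝓘(ℂ) 𝓘(ℂ) U x
  vadd_mem : ∀ (g : ZMod k), ∀ x ∈ X₀, g +ᵥ x ∈ X₀
  fiber : ∀ x ∈ X₀, ∀ y ∈ X₀, U x = U y ↔ ∃ g : ZMod k, g +ᵥ x = y
  free : ∀ (g : ZMod k), ∀ x ∈ X₀, U x ∉ Q → g +ᵥ x = x → g = 0
  mdifferentiable_vadd : ∀ g : ZMod k, MDifferentiable 𝓘(ℂ) 𝓘(ℂ) (fun x : X => g +ᵥ x)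
  continuousAt_root : ∀ x ∈ X₀, U x ∉ Q → ContinuousAt F x
  root_pow : ∀ x ∈ X₀, U x ∉ Q → F x ^ k = C' * ∏ c ∈ Q, (U x - c) ^ α c
  root_vadd : ∀ (g : ZMod k), ∀ x ∈ X₀, U x ∉ Q → F (g +ᵥ x) = ZMod.stdAddChar g * F x
  C_ne_zero : C ≠ 0
  C'_ne_zero : C' ≠ 0
  natural : ∀ e, q.IsNaturalChart e → ∀ ζ ∈ e.target, e.symm ζ ∈ X₀ →
    ∀ᶠ ζ' in 𝓝[≠] ζ, U (e.symm ζ') ∉ Q ∧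
      C * (∏ c ∈ Q, (U (e.symm ζ') - c) ^ κ c) * deriv (U ∘ e.symm) ζ' ^ 2 = 1
  parity : ∀ c ∈ Q, Even (κ c) ↔ Even (α c)
  generator : ∀ J ⊆ Q, ∑ c ∈ J, κ c = -2 → ¬ (k : ℤ) ∣ ∑ c ∈ J, α c

/-- `S` is a square root of the coefficient of the quadratic differential, on which the deck group
acts through signs `ε`. -/
structure IsSqrtCoeff (k : ℕ) {X : Type*} [TopologicalSpace X] [AddAction (ZMod k) X] (X₀ : Set X)
    (Q : Finset ℂ) (κ : ℂ → ℤ) (U : X → ℂ) (C : ℂ) (S : X → ℂ) (ε : ZMod k → ℂ) : Prop where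
  continuousAt : ∀ x ∈ X₀, U x ∉ Q → ContinuousAt S x
  sq_eq : ∀ x ∈ X₀, U x ∉ Q → S x ^ 2 = C * ∏ c ∈ Q, (U x - c) ^ κ c
  vadd : ∀ (g : ZMod k), ∀ x ∈ X₀, U x ∉ Q → S (g +ᵥ x) = ε g * S x
  sign_sq : ∀ g, ε g ^ 2 = 1

theorem isPreconnected_ball_sdiff_singleton (c : ℂ) {r : ℝ} (hr : 0 < r) :
    IsPreconnected (Metric.ball c r \ {c}) := by
  have h : (fun s => c + Complex.exp s) '' {s : ℂ | s.re < Real.log r} = Metric.ball c r \ {c} := by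
    ext w
    constructor
    · rintro ⟨s, hs, rfl⟩
      have h1 : Real.exp s.re < r := by rw [← Real.lt_log_iff_exp_lt hr]; exact hs
      simpa [Complex.norm_exp, Complex.exp_ne_zero] using h1
    · intro hw
      have hw0 : w - c ≠ 0 := sub_ne_zero.2 hw.2
      refine ⟨Complex.log (w - c), ?_, by simp [Complex.exp_log hw0]⟩
      simp only [mem_ofPred_eq, Complex.log_re]
      exact Real.log_lt_log (norm_pos_iff.2 hw0) (by simpa [dist_eq_norm] using hw.1)
  rw [← h]
  exact (convex_halfSpace_re_lt _).isPreconnected.image _ (by fun_prop)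

theorem continuousAt_prod_zpow {Q : Finset ℂ} {A : Type*} [TopologicalSpace A] {u : A → ℂ} {a : A}
    (hu : ContinuousAt u a) (hQ : u a ∉ Q) (κ : ℂ → ℤ) :
    ContinuousAt (fun a => ∏ c ∈ Q, (u a - c) ^ κ c) a :=
  ((continuousOn_prod_zpow Q κ).continuousAt
    (Q.finite_toSet.isClosed.isOpen_compl.mem_nhds hQ)).comp hu

/-- The translation charts: holomorphic coordinates `D` in which `S * dU = dD`. -/
structure IsTransChart {X : Type*} [TopologicalSpace X] [ChartedSpace ℂ X] (X₀ : Set X)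
    (Q : Finset ℂ) (U S : X → ℂ) (D : OpenPartialHomeomorph X ℂ) : Prop where
  mdifferentiableAt : ∀ x ∈ D.source, MDifferentiableAt 𝓘(ℂ) 𝓘(ℂ) D x
  mdifferentiableAt_symm : ∀ ζ ∈ D.target, MDifferentiableAt 𝓘(ℂ) 𝓘(ℂ) D.symm ζ
  subset : D.source ⊆ X₀
  eventually_notMem : ∀ ζ ∈ D.target, ∀ᶠ ζ' in 𝓝[≠] ζ, U (D.symm ζ') ∉ Q
  deriv_eq : ∀ ζ ∈ D.target, U (D.symm ζ) ∉ Q → S (D.symm ζ) * deriv (U ∘ D.symm) ζ = 1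

section

variable {k : ℕ} [NeZero k] {X : Type*} [TopologicalSpace X] [ChartedSpace ℂ X]
    [IsManifold 𝓘(ℂ) ω X] [AddAction (ZMod k) X] {q : QuadDiff X} {X₀ : Set X} {Q : Finset ℂ}
    {κ α : ℂ → ℤ} {U F S : X → ℂ} {C C' : ℂ} {ε : ZMod k → ℂ}

namespace FlatCover

variable (h : FlatCover k q X₀ Q κ α U F C C')
include h

theorem map_vadd (g : ZMod k) {x : X} (hx : x ∈ X₀) : U (g +ᵥ x) = U x :=
  ((h.fiber x hx _ (h.vadd_mem g x hx)).2 ⟨g, rfl⟩).symm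

theorem continuousAt {x : X} (hx : x ∈ X₀) : ContinuousAt U x :=
  (h.mdifferentiableAt x hx).continuousAt

/-- With k = 2ℓ, the square of F^ℓ is C' ∏ (U - c)^α(c). Equal parities make (κ - α) / 2 integral,
and the missing factor is a square as well. On F^ℓ the deck group acts by χ(g)^ℓ, a sign. -/
theorem exists_isSqrtCoeff : ∃ S ε, IsSqrtCoeff k X₀ Q κ U C S ε := by
  obtain ⟨ℓ, hℓ⟩ := h.even
  obtain ⟨b, hb⟩ := IsAlgClosed.exists_pow_nat_eq (C / C') two_pos
  refine ⟨fun x => b * F x ^ ℓ * ∏ c ∈ Q, (U x - c) ^ ((κ c - α c) / 2),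
    fun g => ZMod.stdAddChar g ^ ℓ, ?_, ?_, ?_, ?_⟩
  · intro x hx hxQ
    exact (continuousAt_const.mul ((h.continuousAt_root x hx hxQ).pow ℓ)).mul
      (continuousAt_prod_zpow (h.continuousAt hx) hxQ _)
  · intro x hx hxQ
    have h1 : (F x ^ ℓ) ^ 2 = C' * ∏ c ∈ Q, (U x - c) ^ α c := by
      rw [← h.root_pow x hx hxQ, hℓ, ← pow_mul, mul_two]
    have h2 : (∏ c ∈ Q, (U x - c) ^ ((κ c - α c) / 2)) ^ 2 * ∏ c ∈ Q, (U x - c) ^ α c =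
        ∏ c ∈ Q, (U x - c) ^ κ c := by
      rw [← Finset.prod_pow, ← Finset.prod_mul_distrib]
      refine Finset.prod_congr rfl fun c hc => ?_
      have hne : U x - c ≠ 0 := sub_ne_zero.2 fun h3 => hxQ (h3 ▸ hc)
      rw [← zpow_natCast, ← zpow_mul, ← zpow_add₀ hne]
      congr 1
      have h4 : (2 : ℤ) ∣ κ c - α c := by
        rw [← even_iff_two_dvd, Int.even_sub]; exact h.parity c hc
      push_cast
      omega
    have h3 : b ^ 2 * C' = C := by rw [hb, div_mul_cancel₀ _ h.C'_ne_zero]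
    rw [mul_pow, mul_pow, h1, ← h3, ← h2]
    ring
  · intro g x hx hxQ
    rw [h.root_vadd g x hx hxQ, h.map_vadd g hx]
    ring
  · intro g
    rw [← pow_mul, mul_two, ← hℓ]
    exact stdAddChar_pow_self g

theorem differentiableAt_comp_symm {D : OpenPartialHomeomorph X ℂ} {ζ : ℂ} (hX : D.symm ζ ∈ X₀)
    (hD : MDifferentiableAt 𝓘(ℂ) 𝓘(ℂ) D.symm ζ) : DifferentiableAt ℂ (U ∘ D.symm) ζ :=
  ((h.mdifferentiableAt _ hX).comp ζ hD).differentiableAt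

end FlatCover

namespace IsTransChart

variable {D D' : OpenPartialHomeomorph X ℂ} (h : FlatCover k q X₀ Q κ α U F C C')
include h

theorem differentiableOn (hD : IsTransChart X₀ Q U S D) :
    DifferentiableOn ℂ (U ∘ D.symm) D.target := fun ζ hζ =>
  (h.differentiableAt_comp_symm (hD.subset (D.map_target hζ))
    (hD.mdifferentiableAt_symm ζ hζ)).differentiableWithinAt

theorem analyticAt (hD : IsTransChart X₀ Q U S D) {ζ : ℂ} (hζ : ζ ∈ D.target) :
    AnalyticAt ℂ (U ∘ D.symm) ζ :=
  (hD.differentiableOn h).analyticAt (D.open_target.mem_nhds hζ)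

/-- Coordinate changes between translation charts are locally translations. -/
theorem eventually_sub_eq (hD : IsTransChart X₀ Q U S D) (hD' : IsTransChart X₀ Q U S D') {x : X}
    (hx : x ∈ D.source) (hx' : x ∈ D'.source) : ∀ᶠ y in 𝓝 x, D' y - D y = D' x - D x := by
  set W : Set ℂ := D.target ∩ D.symm ⁻¹' D'.source with hW
  have hWo : IsOpen W := D.isOpen_inter_preimage_symm D'.open_source
  have hxW : D x ∈ W := ⟨D.map_source hx, by simpa [D.left_inv hx] using hx'⟩
  have hdiff : DifferentiableOn ℂ (D' ∘ D.symm) W := fun ζ hζ =>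
    ((hD'.mdifferentiableAt _ hζ.2).comp ζ
      (hD.mdifferentiableAt_symm ζ hζ.1)).differentiableAt.differentiableWithinAt
  have hderiv : ∀ ζ ∈ W, U (D.symm ζ) ∉ Q → deriv (D' ∘ D.symm) ζ = 1 := by
    intro ζ hζ hQ
    have e1 : U ∘ D.symm =ᶠ[𝓝 ζ] (U ∘ D'.symm) ∘ (D' ∘ D.symm) := by
      filter_upwards [hWo.mem_nhds hζ] with ζ' hζ'
      simp [D'.left_inv hζ'.2]
    have hζ2 : (D' ∘ D.symm) ζ ∈ D'.target := D'.map_source hζ.2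
    have e2 : D'.symm ((D' ∘ D.symm) ζ) = D.symm ζ := D'.left_inv hζ.2
    have e3 := hD.deriv_eq ζ hζ.1 hQ
    have e4 := hD'.deriv_eq _ hζ2 (by rwa [e2])
    rw [e1.deriv_eq, deriv_comp ζ
      ((hD'.differentiableOn h).differentiableAt (D'.open_target.mem_nhds hζ2))
      (hdiff.differentiableAt (hWo.mem_nhds hζ)), ← mul_assoc, ← e2, e4, one_mul] at e3
    exact e3
  have han : AnalyticAt ℂ (deriv (D' ∘ D.symm)) (D x) :=
    (hdiff.analyticAt (hWo.mem_nhds hxW)).deriv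
  have hpunct : ∀ᶠ ζ in 𝓝[≠] (D x), deriv (D' ∘ D.symm) ζ = 1 := by
    filter_upwards [hD.eventually_notMem _ hxW.1, nhdsWithin_le_nhds (hWo.mem_nhds hxW)]
      with ζ h1 h2
    exact hderiv ζ h2 h1
  -- Away from `Q` the equalities S dU = dD = dD' give derivative 1; the identity theorem extends
  -- this over the points above `Q`.
  have hfull : ∀ᶠ ζ in 𝓝 (D x), deriv (D' ∘ D.symm) ζ = 1 :=
    (han.frequently_eq_iff_eventually_eq analyticAt_const).1 hpunct.frequently
  obtain ⟨r, hr, hball⟩ := Metric.mem_nhds_iff.1 (inter_mem hfull (hWo.mem_nhds hxW))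
  have hconst : ∀ ζ ∈ Metric.ball (D x) r, (D' ∘ D.symm) ζ - ζ = (D' ∘ D.symm) (D x) - D x := by
    intro ζ hζ
    refine Metric.isOpen_ball.is_const_of_deriv_eq_zero (f := fun ζ => (D' ∘ D.symm) ζ - ζ)
      (convex_ball _ _).isPreconnected
      ((hdiff.mono fun ζ hζ => (hball hζ).2).sub differentiableOn_id) (fun ζ' hζ' => ?_) hζ
      (Metric.mem_ball_self hr)
    have h1 := hdiff.differentiableAt (hWo.mem_nhds (hball hζ').2)
    have h2 : deriv (D' ∘ D.symm) ζ' = 1 := (hball hζ').1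
    have h3 := (h1.hasDerivAt.sub (hasDerivAt_id ζ')).deriv
    rw [h2, sub_self] at h3
    exact h3
  have hcont : ContinuousAt D x := D.continuousAt hx
  filter_upwards [hcont.eventually_mem (Metric.ball_mem_nhds _ hr), D.open_source.mem_nhds hx]
    with y hy hys
  have := hconst _ hy
  simpa [D.left_inv hys, D.left_inv hx] using this

theorem isTranslationAtlas : IsTranslationAtlas {D | IsTransChart X₀ Q U S D} :=
  fun _ hD _ hD' _ hx hx' => IsTransChart.eventually_sub_eq h hD hD' hx hx'

end IsTransChart

end

section

set_option linter.unusedSectionVars false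

variable {k : ℕ} [NeZero k] {X : Type*} [TopologicalSpace X] [ChartedSpace ℂ X]
    [IsManifold 𝓘(ℂ) ω X] [AddAction (ZMod k) X] {q : QuadDiff X} {X₀ : Set X} {Q : Finset ℂ}
    {κ α : ℂ → ℤ} {U F S : X → ℂ} {C C' : ℂ} {ε : ZMod k → ℂ}

namespace QuadDiff.IsNaturalChart

variable {e : OpenPartialHomeomorph X ℂ} (he : q.IsNaturalChart e)
include he

theorem mdifferentiableAt {x : X} (hx : x ∈ e.source) : MDifferentiableAt 𝓘(ℂ) 𝓘(ℂ) e x :=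
  mdifferentiableAt_of_mem_maximalAtlas (IsManifold.maximalAtlas_subset_of_le (by simp) he.1) hx

theorem mdifferentiableAt_symm {ζ : ℂ} (hζ : ζ ∈ e.target) :
    MDifferentiableAt 𝓘(ℂ) 𝓘(ℂ) e.symm ζ :=
  mdifferentiableAt_symm_of_mem_maximalAtlas
    (IsManifold.maximalAtlas_subset_of_le (by simp) he.1) hζ

end QuadDiff.IsNaturalChart

namespace IsSqrtCoeff

variable (hS : IsSqrtCoeff k X₀ Q κ U C S ε)
include hS

theorem sign_ne_zero (g : ZMod k) : ε g ≠ 0 := by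
  intro h0
  have := hS.sign_sq g
  simp [h0] at this

theorem sign_eq (g : ZMod k) : ε g = 1 ∨ ε g = -1 := 
  eq_or_eq_neg_of_sq_eq_sq _ 1 (by rw [hS.sign_sq, one_pow])

/-- Near every point, a natural coordinate is a translation chart up to sign. -/
theorem exists_isTransChart (h : FlatCover k q X₀ Q κ α U F C C')
    {e : OpenPartialHomeomorph X ℂ} (he : q.IsNaturalChart e) {x : X} (hx : x ∈ e.source)
    (hxX : x ∈ X₀) : ∃ s : ℂ, s ^ 2 = 1 ∧ ∃ D, IsTransChart X₀ Q U S D ∧ x ∈ D.source ∧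
      D.source ⊆ e.source ∧ ∀ y, D y = s * e y := by
  have hW : IsOpen (e.target ∩ e.symm ⁻¹' X₀) := e.isOpen_inter_preimage_symm h.isOpen
  have hxW : e x ∈ e.target ∩ e.symm ⁻¹' X₀ :=
    ⟨e.map_source hx, by simpa [e.left_inv hx] using hxX⟩
  have hnat := h.natural e he (e x) hxW.1 hxW.2
  rw [eventually_nhdsWithin_iff] at hnat
  obtain ⟨r, hr, hball⟩ := Metric.mem_nhds_iff.1 (inter_mem (hW.mem_nhds hxW) hnat)
  have hdiff : DifferentiableOn ℂ (U ∘ e.symm) (Metric.ball (e x) r) := fun ζ hζ =>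
    (h.differentiableAt_comp_symm (hball hζ).1.2
      (he.mdifferentiableAt_symm (hball hζ).1.1)).differentiableWithinAt
  have hyc : ∀ ζ ∈ Metric.ball (e x) r, U (e.symm ζ) ∉ Q →
      ContinuousAt (fun ζ => S (e.symm ζ) * deriv (U ∘ e.symm) ζ) ζ := by
    intro ζ hζ hQ
    refine ContinuousAt.mul ?_ ?_
    · exact (hS.continuousAt _ (hball hζ).1.2 hQ).comp (e.symm.continuousAt (hball hζ).1.1)
    · exact (hdiff.analyticAt (Metric.isOpen_ball.mem_nhds hζ)).deriv.continuousAt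
  -- In a natural coordinate S dU has square 1, so its coefficient is one sign s on the connected
  -- punctured disc; D = s e is then a translation chart.
  obtain ⟨s, hs, hys⟩ : ∃ s : ℂ, s ^ 2 = 1 ∧ ∀ ζ ∈ Metric.ball (e x) r \ {e x},
      S (e.symm ζ) * deriv (U ∘ e.symm) ζ = s := by
    have h1 := (isPreconnected_ball_sdiff_singleton (e x) hr).eq_one_or_eq_neg_one_of_sq_eq
      (f := fun ζ => S (e.symm ζ) * deriv (U ∘ e.symm) ζ)
      (fun ζ hζ => (hyc ζ hζ.1 ((hball hζ.1).2 hζ.2).1).continuousWithinAt)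
      (fun ζ hζ => by
        have h2 := (hball hζ.1).2 hζ.2
        change (S (e.symm ζ) * deriv (U ∘ e.symm) ζ) ^ 2 = 1
        rw [mul_pow, hS.sq_eq _ (hball hζ.1).1.2 h2.1]
        exact h2.2)
    rcases h1 with h1 | h1
    · exact ⟨1, by norm_num, fun ζ hζ => h1 hζ⟩
    · exact ⟨-1, by norm_num, fun ζ hζ => h1 hζ⟩
  have hs0 : s ≠ 0 := by rintro rfl; norm_num at hs
  have hys' : ∀ ζ ∈ Metric.ball (e x) r, U (e.symm ζ) ∉ Q →
      S (e.symm ζ) * deriv (U ∘ e.symm) ζ = s := by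
    intro ζ hζ hQ
    by_cases hζx : ζ = e x
    · subst hζx
      refine tendsto_nhds_unique ((hyc _ hζ hQ).tendsto.mono_left nhdsWithin_le_nhds)
        (tendsto_const_nhds.congr' (f₁ := fun _ => s) (l₁ := 𝓝[≠] (e x)) ?_)
      filter_upwards [self_mem_nhdsWithin, nhdsWithin_le_nhds (Metric.ball_mem_nhds _ hr)]
        with ζ h1 h2 using (hys ζ ⟨h2, h1⟩).symm
    · exact hys ζ ⟨hζ, hζx⟩
  obtain ⟨D, hDs, hDt, hDe, hDsymm⟩ : ∃ D : OpenPartialHomeomorph X ℂ,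
      D.source = e.source ∩ e ⁻¹' Metric.ball (e x) r ∧
      D.target = {ζ | s⁻¹ * ζ ∈ e.target ∩ Metric.ball (e x) r} ∧
      (∀ y, D y = s * e y) ∧ ∀ ζ, D.symm ζ = e.symm (s⁻¹ * ζ) :=
    ⟨(e.symm.restrOpen _ Metric.isOpen_ball).symm.transHomeomorph (Homeomorph.mulLeft₀ s hs0),
      rfl, rfl, fun _ => rfl, fun _ => rfl⟩
  have hDsymm' : (D.symm : ℂ → X) = e.symm ∘ fun ζ => s⁻¹ * ζ := funext hDsymm
  refine ⟨s, hs, D, ⟨?_, ?_, ?_, ?_, ?_⟩, ?_, ?_, hDe⟩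
  · intro y hy
    rw [hDs] at hy
    have h1 : (D : X → ℂ) = (fun ζ => s * ζ) ∘ e := funext hDe
    rw [h1]
    exact (DifferentiableAt.mdifferentiableAt (by fun_prop)).comp y (he.mdifferentiableAt hy.1)
  · intro ζ hζ
    rw [hDt] at hζ
    rw [hDsymm']
    exact (he.mdifferentiableAt_symm hζ.1).comp ζ
      (DifferentiableAt.mdifferentiableAt (f := fun ζ => s⁻¹ * ζ) (by fun_prop))
  · intro y hy
    rw [hDs] at hy
    have := (hball hy.2).1.2
    simpa [e.left_inv hy.1] using this
  · intro ζ hζ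
    rw [hDt] at hζ
    have h1 := h.natural e he _ hζ.1 (hball hζ.2).1.2
    have h2 : Tendsto (fun ζ => s⁻¹ * ζ) (𝓝[≠] ζ) (𝓝[≠] (s⁻¹ * ζ)) :=
      (Continuous.continuousAt (by fun_prop)).continuousWithinAt.tendsto_nhdsWithin
        fun ζ' h3 => fun h4 => h3 (mul_left_cancel₀ (inv_ne_zero hs0) h4)
    filter_upwards [h2.eventually h1] with ζ' hζ'
    rw [hDsymm]
    exact hζ'.1
  · intro ζ hζ hQ
    rw [hDt] at hζ
    rw [hDsymm] at hQ
    have h1 : U ∘ D.symm = fun ζ => (U ∘ e.symm) (s⁻¹ * ζ) := by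
      funext ζ; simp [hDsymm]
    rw [h1, deriv_comp_mul_left, hDsymm, smul_eq_mul, mul_left_comm, hys' _ hζ.2 hQ,
      inv_mul_cancel₀ hs0]
  · rw [hDs]
    exact ⟨hx, Metric.mem_ball_self hr⟩
  · rw [hDs]
    exact inter_subset_left

/-- The image of a translation chart under the deck group. -/
theorem exists_isTransChart_vadd (h : FlatCover k q X₀ Q κ α U F C C')
    {D : OpenPartialHomeomorph X ℂ} (hD : IsTransChart X₀ Q U S D) (g : ZMod k) :
    ∃ D', IsTransChart X₀ Q U S D' ∧ (∀ y, y ∈ D'.source ↔ g +ᵥ y ∈ D.source) ∧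
      ∀ y, D' y = ε g * D (g +ᵥ y) := by
  have hg := hS.sign_ne_zero g
  let A : X ≃ₜ X :=
    { toEquiv := AddAction.toPerm g
      continuous_toFun := (h.mdifferentiable_vadd g).continuous
      continuous_invFun := (h.mdifferentiable_vadd (-g)).continuous }
  obtain ⟨D', hDs, hDt, hDe, hDsymm⟩ : ∃ D' : OpenPartialHomeomorph X ℂ,
      D'.source = (fun y => g +ᵥ y) ⁻¹' D.source ∧
      D'.target = {ζ | (ε g)⁻¹ * ζ ∈ D.target} ∧
      (∀ y, D' y = ε g * D (g +ᵥ y)) ∧ ∀ ζ, D'.symm ζ = -g +ᵥ D.symm ((ε g)⁻¹ * ζ) :=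
    ⟨(A.transOpenPartialHomeomorph D).transHomeomorph (Homeomorph.mulLeft₀ (ε g) hg),
      rfl, rfl, fun _ => rfl, fun _ => rfl⟩
  have hX : ∀ ζ ∈ D.target, D.symm ζ ∈ X₀ := fun ζ hζ => hD.subset (D.map_target hζ)
  have hU : ∀ ζ ∈ D'.target, U (D'.symm ζ) = U (D.symm ((ε g)⁻¹ * ζ)) := by
    intro ζ hζ
    rw [hDt] at hζ
    rw [hDsymm, h.map_vadd _ (hX _ hζ)]
  refine ⟨D', ⟨?_, ?_, ?_, ?_, ?_⟩, fun y => by rw [hDs]; rfl, hDe⟩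
  · intro y hy
    rw [hDs] at hy
    have h1 : (D' : X → ℂ) = (fun ζ => ε g * ζ) ∘ D ∘ fun y => g +ᵥ y := funext hDe
    rw [h1]
    exact (DifferentiableAt.mdifferentiableAt (f := fun ζ => ε g * ζ) (by fun_prop)).comp y
      ((hD.mdifferentiableAt _ hy).comp y (h.mdifferentiable_vadd g y))
  · intro ζ hζ
    rw [hDt] at hζ
    have h1 : (D'.symm : ℂ → X) = (fun y => -g +ᵥ y) ∘ D.symm ∘ fun ζ => (ε g)⁻¹ * ζ :=
      funext hDsymm
    rw [h1]
    exact (h.mdifferentiable_vadd (-g) _).comp ζ ((hD.mdifferentiableAt_symm _ hζ).comp ζ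
      (DifferentiableAt.mdifferentiableAt (f := fun ζ => (ε g)⁻¹ * ζ) (by fun_prop)))
  · intro y hy
    rw [hDs] at hy
    have := h.vadd_mem (-g) _ (hD.subset hy)
    simpa using this
  · intro ζ hζ
    have hζ' := hζ
    rw [hDt] at hζ'
    have h2 : Tendsto (fun ζ => (ε g)⁻¹ * ζ) (𝓝[≠] ζ) (𝓝[≠] ((ε g)⁻¹ * ζ)) :=
      (Continuous.continuousAt (by fun_prop)).continuousWithinAt.tendsto_nhdsWithin
        fun ζ' h3 => fun h4 => h3 (mul_left_cancel₀ (inv_ne_zero hg) h4)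
    filter_upwards [h2.eventually (hD.eventually_notMem _ hζ'),
      nhdsWithin_le_nhds (D'.open_target.mem_nhds hζ)] with ζ' h3 h4
    rwa [hU ζ' h4]
  · intro ζ hζ hQ
    have hζ' := hζ
    rw [hDt] at hζ'
    rw [hU ζ hζ] at hQ
    have h1 : U ∘ D'.symm =ᶠ[𝓝 ζ] fun ζ => (U ∘ D.symm) ((ε g)⁻¹ * ζ) := by
      filter_upwards [D'.open_target.mem_nhds hζ] with ζ' h4 using hU ζ' h4
    have h2 : S (D.symm ((ε g)⁻¹ * ζ)) = ε g * S (D'.symm ζ) := by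
      rw [← hS.vadd g (D'.symm ζ), hDsymm, vadd_vadd, add_neg_cancel, zero_vadd]
      · rw [hDsymm]; exact h.vadd_mem _ _ (hX _ hζ')
      · rwa [hU ζ hζ]
    have h3 := hD.deriv_eq _ hζ' hQ
    rw [h1.deriv_eq, deriv_comp_mul_left, smul_eq_mul]
    rw [h2] at h3
    have h4 : (ε g)⁻¹ = ε g := inv_eq_of_mul_eq_one_left (by rw [← sq]; exact hS.sign_sq g)
    rw [h4] at h3 ⊢
    linear_combination h3

/-- In the chart transported by -g, the translate of γ is read as ε(-g) times the reading of γ: deck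
transformations preserve lines and change velocities by a sign. -/
theorem isLineAt_vadd (h : FlatCover k q X₀ Q κ α U F C C') {V : ℂ} {γ : ℝ → X} {t : ℝ}
    (hγ : IsLineAt {D | IsTransChart X₀ Q U S D} V γ t) (g : ZMod k) :
    IsLineAt {D | IsTransChart X₀ Q U S D} (ε (-g) * V) (fun r => g +ᵥ γ r) t := by
  obtain ⟨D, hD, hx, hγ⟩ := hγ
  obtain ⟨D', hD', hsource, hval⟩ := hS.exists_isTransChart_vadd h hD (-g)
  refine ⟨D', hD', by simpa [hsource] using hx, ?_⟩
  filter_upwards [hγ] with r hr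
  refine ⟨by simpa [hsource] using hr.1, ?_⟩
  simp only [hval, neg_vadd_vadd]
  rw [hr.2]
  ring

end IsSqrtCoeff

end

/-! ### Ramification -/

theorem eq_zero_of_zpow_mul_eq_one {h : ℂ → ℂ} {ζ₀ : ℂ} {n : ℤ} (hh : AnalyticAt ℂ h ζ₀)
    (h0 : h ζ₀ ≠ 0) (h1 : ∀ᶠ ζ in 𝓝[≠] ζ₀, (ζ - ζ₀) ^ n * h ζ = 1) : n = 0 := by
  have hm : MeromorphicAt (fun _ : ℂ => (1 : ℂ)) ζ₀ := MeromorphicAt.const 1 ζ₀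
  have e1 : meromorphicOrderAt (fun _ : ℂ => (1 : ℂ)) ζ₀ = n :=
    (meromorphicOrderAt_eq_int_iff hm).2 ⟨h, hh, h0, h1.mono fun ζ hζ => by
      rw [smul_eq_mul, hζ]⟩
  have e2 : meromorphicOrderAt (fun _ : ℂ => (1 : ℂ)) ζ₀ = (0 : ℤ) :=
    (meromorphicOrderAt_eq_int_iff hm).2 ⟨fun _ => 1, analyticAt_const, one_ne_zero, by simp⟩
  exact_mod_cast e1.symm.trans e2

/-- On a small circle around ζ₀ the factor R has winding number 0, so k times the winding number of
Φ equals j. -/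
theorem dvd_of_pow_eq_zpow_mul {k : ℕ} {Φ R : ℂ → ℂ} {ζ₀ : ℂ} {j : ℤ} (hR : AnalyticAt ℂ R ζ₀)
    (hR0 : R ζ₀ ≠ 0) (hΦ : ∀ᶠ ζ in 𝓝[≠] ζ₀, ContinuousAt Φ ζ ∧ Φ ζ ^ k = (ζ - ζ₀) ^ j * R ζ) :
    (k : ℤ) ∣ j := by
  have h1 : ∀ᶠ ζ in 𝓝 ζ₀, ContinuousAt R ζ ∧ ‖R ζ / R ζ₀ - 1‖ < 1 := by
    refine (hR.eventually_analyticAt.mono fun _ h => h.continuousAt).and ?_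
    have h2 : ContinuousAt (fun ζ => ‖R ζ / R ζ₀ - 1‖) ζ₀ :=
      ((hR.continuousAt.div_const _).sub continuousAt_const).norm
    exact h2.eventually_lt continuousAt_const (by simp [div_self hR0])
  rw [eventually_nhdsWithin_iff] at hΦ
  obtain ⟨r, hr, hball⟩ := Metric.eventually_nhds_iff.1 (h1.and hΦ)
  set θ : ℝ → ℂ := fun s => ζ₀ + (r / 2 : ℝ) * Complex.exp (Complex.I * s) with hθ
  have hθc : Continuous θ := by fun_prop
  have hr2 : ((r / 2 : ℝ) : ℂ) ≠ 0 := Complex.ofReal_ne_zero.2 (by positivity)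
  have hθs : ∀ s, θ s - ζ₀ = (r / 2 : ℝ) * Complex.exp (Complex.I * s) := fun s => by simp [hθ]
  have hθp : ∀ s, θ (s + 2 * Real.pi) = θ s := fun s => by simp only [hθ, exp_I_periodic]
  have hmem : ∀ s, dist (θ s) ζ₀ < r := fun s => by
    rw [dist_eq_norm, hθs, norm_mul, norm_exp_I, mul_one, Complex.norm_real, Real.norm_eq_abs,
      abs_of_pos (by positivity)]
    linarith
  have hne : ∀ s, θ s ≠ ζ₀ := fun s => by
    rw [← sub_ne_zero, hθs]
    exact mul_ne_zero hr2 (Complex.exp_ne_zero _)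
  have hB := fun s => hball (hmem s)
  have wR : HasWinding (fun s => R (θ s)) 0 := by
    have h2 : HasWinding (fun s => R (θ s) / R ζ₀) 0 := by
      refine HasWinding.of_norm_sub_one_lt ?_ (fun s => (hB s).1.2) fun s => by rw [hθp]
      exact (continuous_iff_continuousAt.2 fun s =>
        (hB s).1.1.comp_of_eq hθc.continuousAt rfl).div_const _
    have h3 := h2.mul (HasWinding.const hR0)
    exact h3.congr fun s => by field_simp
  have wθ : HasWinding (fun s => θ s - ζ₀) 1 := by
    have h2 := (HasWinding.const hr2).mul HasWinding.exp_I
    rw [zero_add] at h2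
    exact h2.congr hθs
  have wRHS := (wθ.zpow j).mul wR
  have hk : ∀ s, Φ (θ s) ^ k = (θ s - ζ₀) ^ j * R (θ s) := fun s => ((hB s).2 (hne s)).2
  rcases Nat.eq_zero_or_pos k with rfl | hkpos
  · have h2 : HasWinding (fun s => (θ s - ζ₀) ^ j * R (θ s)) 0 :=
      (HasWinding.const one_ne_zero).congr fun s => by rw [← hk, pow_zero]
    have h3 := wRHS.unique h2
    simp at h3
    simp [h3]
  obtain ⟨m, hm⟩ : ∃ m, HasWinding (fun s => Φ (θ s)) m := by
    refine HasWinding.exists_of_periodic (continuous_iff_continuousAt.2 fun s =>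
      ((hB s).2 (hne s)).1.comp_of_eq hθc.continuousAt rfl) (fun s h0 => ?_)
      fun s => by rw [hθp]
    have h2 := hk s
    rw [h0, zero_pow hkpos.ne'] at h2
    exact wRHS.ne_zero s h2.symm
  have h2 := wRHS.unique ((hm.pow k).congr fun s => (hk s).symm)
  exact ⟨m, by linarith⟩

theorem exists_injOn_of_sub_eq_mul {f g : ℂ → ℂ} {ζ₀ c : ℂ} (hg : AnalyticAt ℂ g ζ₀)
    (hg0 : g ζ₀ ≠ 0) (hf : ∀ᶠ ζ in 𝓝 ζ₀, f ζ - c = (ζ - ζ₀) ^ 1 * g ζ) :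
    deriv f ζ₀ ≠ 0 ∧ ∃ N ∈ 𝓝 ζ₀, InjOn f N := by
  have hd : HasStrictDerivAt (fun ζ => (ζ - ζ₀) * g ζ + c) (g ζ₀) ζ₀ := by
    have h0 : HasStrictDerivAt (fun ζ => ζ - ζ₀) 1 ζ₀ := (hasStrictDerivAt_id ζ₀).sub_const ζ₀
    have h1 := (h0.mul hg.hasStrictDerivAt).add_const c
    have h2 : 1 * g ζ₀ + (ζ₀ - ζ₀) * deriv g ζ₀ = g ζ₀ := by ring
    rw [← h2]
    exact h1
  have hd' : HasStrictDerivAt f (g ζ₀) ζ₀ := by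
    refine hd.congr_of_eventuallyEq ?_
    filter_upwards [hf] with ζ hζ
    rw [← pow_one (ζ - ζ₀), ← hζ, sub_add_cancel]
  refine ⟨by rwa [hd'.hasDerivAt.deriv], _,
    (hd'.hasStrictFDerivAt_equiv hg0).eventually_left_inverse, fun x hx y hy hxy => ?_⟩
  rw [mem_ofPred_eq] at hx hy
  rw [← hx, ← hy, hxy]

/-- A function which is a double zero plus a constant is not injective. -/
theorem not_injOn_of_sq_mul {f g : ℂ → ℂ} {ζ₀ c : ℂ} (hg : AnalyticAt ℂ g ζ₀) (hg0 : g ζ₀ ≠ 0)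
    (hf : ∀ᶠ ζ in 𝓝 ζ₀, f ζ - c = (ζ - ζ₀) ^ 2 * g ζ) {N : Set ℂ} (hN : N ∈ 𝓝 ζ₀) :
    ¬ InjOn f N := by
  obtain ⟨b, hb⟩ := IsAlgClosed.exists_pow_nat_eq (g ζ₀) two_pos
  have hb0 : b ≠ 0 := by
    rintro rfl
    exact hg0 (by rw [← hb]; norm_num)
  -- With w a square root of g / g ζ₀ and b² = g ζ₀, f - c is the square of the local coordinate y =
  -- (ζ - ζ₀) b w; the points with coordinates y and -y then have the same image.
  set w : ℂ → ℂ := fun ζ => (g ζ / g ζ₀) ^ (1 / 2 : ℂ) with hw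
  have hw1 : w ζ₀ = 1 := by simp [hw, div_self hg0]
  have hwan : AnalyticAt ℂ w ζ₀ := by
    refine AnalyticAt.cpow (hg.div analyticAt_const hg0) analyticAt_const ?_
    rw [div_self hg0]
    exact Complex.one_mem_slitPlane
  have hwsq : ∀ ζ, w ζ ^ 2 = g ζ / g ζ₀ := by
    intro ζ
    rw [hw]
    simp
  have hd : HasStrictDerivAt (fun ζ => (ζ - ζ₀) * (b * w ζ)) b ζ₀ := by
    have h0 : HasStrictDerivAt (fun ζ => ζ - ζ₀) 1 ζ₀ := (hasStrictDerivAt_id ζ₀).sub_const ζ₀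
    have h1 := h0.mul
      ((hwan.hasStrictDerivAt).const_mul b)
    have h2 : 1 * (b * w ζ₀) + (ζ₀ - ζ₀) * (b * deriv w ζ₀) = b := by rw [hw1]; ring
    rw [h2] at h1
    exact h1
  intro hinj
  have hmap := hd.map_nhds_eq hb0
  rw [sub_self, zero_mul] at hmap
  have hN' : N ∩ {ζ | f ζ - c = (ζ - ζ₀) ^ 2 * g ζ} ∈ 𝓝 ζ₀ := inter_mem hN hf
  have him : ∀ᶠ y in 𝓝 (0 : ℂ), y ∈
      (fun ζ => (ζ - ζ₀) * (b * w ζ)) '' (N ∩ {ζ | f ζ - c = (ζ - ζ₀) ^ 2 * g ζ}) := by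
    have h1 := image_mem_map (m := fun ζ => (ζ - ζ₀) * (b * w ζ)) hN'
    rw [hmap] at h1
    exact h1
  have him2 : ∀ᶠ y in 𝓝 (0 : ℂ), -y ∈
      (fun ζ => (ζ - ζ₀) * (b * w ζ)) '' (N ∩ {ζ | f ζ - c = (ζ - ζ₀) ^ 2 * g ζ}) := by
    have h2 : Tendsto (fun y : ℂ => -y) (𝓝 0) (𝓝 0) := by
      simpa using (continuous_neg (G := ℂ)).tendsto 0
    exact h2.eventually him
  obtain ⟨y, ⟨⟨ζ, hζ, hy⟩, ζ', hζ', hy'⟩, hy0⟩ :=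
    ((Filter.Eventually.filter_mono nhdsWithin_le_nhds (him.and him2)).and
      (self_mem_nhdsWithin : ∀ᶠ y in 𝓝[≠] (0 : ℂ), y ≠ 0)).exists
  have hsq : ∀ ζ, ((ζ - ζ₀) * (b * w ζ)) ^ 2 = (ζ - ζ₀) ^ 2 * g ζ := by
    intro ζ
    rw [mul_pow, mul_pow, hwsq, hb]
    field_simp
  simp only at hy hy'
  have e1 : f ζ = f ζ' := by
    have h1 := hζ.2
    have h2 := hζ'.2
    simp only [mem_ofPred_eq] at h1 h2
    rw [← hsq, hy] at h1
    rw [← hsq, hy'] at h2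
    linear_combination h1 - h2
  have e2 := hinj hζ.1 hζ'.1 e1
  rw [← e2, hy] at hy'
  exact hy0 (self_eq_neg.1 hy')

theorem ramification_eq_one_or_two {κ : ℤ} {n : ℕ} (h : (κ + 2) * n = 2) :
    n = 1 ∧ κ = 0 ∨ n = 2 ∧ κ = -1 := by
  have h1 : (n : ℤ) ∣ 2 := ⟨κ + 2, by linarith⟩
  have h2 : n ∣ 2 := by exact_mod_cast h1
  rcases (Nat.dvd_prime Nat.prime_two).1 h2 with rfl | rfl
  · left; refine ⟨rfl, ?_⟩; push_cast at h; omega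
  · right; refine ⟨rfl, ?_⟩; push_cast at h; omega

section

set_option linter.unusedSectionVars false

variable {k : ℕ} [NeZero k] {X : Type*} [TopologicalSpace X] [ChartedSpace ℂ X]
    [IsManifold 𝓘(ℂ) ω X] [AddAction (ZMod k) X] {q : QuadDiff X} {X₀ : Set X} {Q : Finset ℂ}
    {κ α : ℂ → ℤ} {U F S : X → ℂ} {C C' : ℂ} {ε : ZMod k → ℂ}

namespace IsTransChart

variable {D : OpenPartialHomeomorph X ℂ} (hD : IsTransChart X₀ Q U S D)
include hD

theorem deriv_ne_zero_of_notMem {ζ : ℂ} (hζ : ζ ∈ D.target) (hQ : U (D.symm ζ) ∉ Q) :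
    deriv (U ∘ D.symm) ζ ≠ 0 := fun h0 => by
  have := hD.deriv_eq ζ hζ hQ
  simp [h0] at this

theorem coeff_mul_deriv_sq (hS : IsSqrtCoeff k X₀ Q κ U C S ε) {ζ : ℂ} (hζ : ζ ∈ D.target)
    (hQ : U (D.symm ζ) ∉ Q) :
    C * (∏ c ∈ Q, (U (D.symm ζ) - c) ^ κ c) * deriv (U ∘ D.symm) ζ ^ 2 = 1 := by
  rw [← hS.sq_eq _ (hD.subset (D.map_target hζ)) hQ, ← mul_pow, hD.deriv_eq ζ hζ hQ, one_pow]

theorem not_eventually_eq {ζ c : ℂ} (hζ : ζ ∈ D.target) (hc : c ∈ Q) :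
    ¬ ∀ᶠ ζ' in 𝓝 ζ, (U ∘ D.symm) ζ' - c = 0 := fun h => by
  obtain ⟨ζ', h1, h2⟩ := ((hD.eventually_notMem ζ hζ).and (h.filter_mono nhdsWithin_le_nhds)).exists
  rw [sub_eq_zero] at h2
  exact h1 (by rw [← h2] at hc; exact hc)

/-- The ramification index of `U` at a point of a translation chart. -/
theorem exists_ramification (h : FlatCover k q X₀ Q κ α U F C C')
    (hS : IsSqrtCoeff k X₀ Q κ U C S ε) {ζ₀ c : ℂ} (hζ : ζ₀ ∈ D.target) (hc : c ∈ Q)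
    (hU : U (D.symm ζ₀) = c) :
    ∃ (n : ℕ) (g : ℂ → ℂ), AnalyticAt ℂ g ζ₀ ∧ g ζ₀ ≠ 0 ∧
      (∀ᶠ ζ in 𝓝 ζ₀, (U ∘ D.symm) ζ - c = (ζ - ζ₀) ^ n * g ζ) ∧
      (κ c + 2) * n = 2 ∧ (k : ℤ) ∣ n * α c := by
  have hfan := hD.analyticAt h hζ
  obtain ⟨n, g, hg, hg0, hfg⟩ := (AnalyticAt.exists_eventuallyEq_pow_smul_nonzero_iff
    (hfan.sub analyticAt_const)).2 (hD.not_eventually_eq hζ hc)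
  simp only [smul_eq_mul, Pi.sub_apply] at hfg
  have hUc : (U ∘ D.symm) ζ₀ = c := hU
  have hn : n ≠ 0 := by
    rintro rfl
    have h1 := hfg.self_of_nhds
    rw [hUc, sub_self, pow_zero, one_mul] at h1
    exact hg0 h1.symm
  have herase : (U ∘ D.symm) ζ₀ ∉ Q.erase c := by
    rw [hUc]; exact Finset.notMem_erase c Q
  have hprod : ∀ β : ℂ → ℤ,
      AnalyticAt ℂ (fun ζ => ∏ c' ∈ Q.erase c, ((U ∘ D.symm) ζ - c') ^ β c') ζ₀ ∧
      ∏ c' ∈ Q.erase c, ((U ∘ D.symm) ζ₀ - c') ^ β c' ≠ 0 := by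
    refine fun β => ⟨Finset.analyticAt_fun_prod _ fun c' hc' => ?_, prod_zpow_ne_zero β herase⟩
    refine (hfan.sub analyticAt_const).zpow (sub_ne_zero.2 fun h1 => ?_)
    exact herase (h1 ▸ hc')
  have hsplit : ∀ β : ℂ → ℤ, ∀ ζ, (U ∘ D.symm) ζ - c = (ζ - ζ₀) ^ n * g ζ →
      ∏ c' ∈ Q, ((U ∘ D.symm) ζ - c') ^ β c' = (ζ - ζ₀) ^ ((n : ℤ) * β c) * (g ζ ^ β c *
        ∏ c' ∈ Q.erase c, ((U ∘ D.symm) ζ - c') ^ β c') := by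
    intro β ζ h1
    rw [← Finset.mul_prod_erase Q _ hc, h1, mul_zpow, ← zpow_natCast, ← zpow_mul, mul_assoc]
  have htarget := nhdsWithin_le_nhds (s := {ζ₀}ᶜ) (D.open_target.mem_nhds hζ)
  refine ⟨n, g, hg, hg0, hfg, ?_, ?_⟩
  -- The derivative of U vanishes to order n - 1, so the relation C ∏ (U - c)^κ U'² = 1 reads (ζ -
  -- ζ₀)^(nκ + 2(n - 1)) times a unit equals 1. The exponent must vanish.
  · have hderiv : ∀ᶠ ζ in 𝓝[≠] ζ₀, deriv (U ∘ D.symm) ζ =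
        (ζ - ζ₀) ^ ((n : ℤ) - 1) * (n * g ζ + (ζ - ζ₀) * deriv g ζ) := by
      filter_upwards [nhdsWithin_le_nhds hfg.eventually_nhds,
        nhdsWithin_le_nhds hg.eventually_analyticAt, self_mem_nhdsWithin] with ζ h1 h2 h3
      have h4 : U ∘ D.symm =ᶠ[𝓝 ζ] fun ζ => (ζ - ζ₀) ^ n * g ζ + c := by
        filter_upwards [h1] with ζ' h5
        rw [← h5, sub_add_cancel]
      have h5 : HasDerivAt (fun ζ => (ζ - ζ₀) ^ n) (n * (ζ - ζ₀) ^ (n - 1) * 1) ζ :=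
        ((hasDerivAt_id ζ).sub_const ζ₀).fun_pow n
      have h6 := ((h5.mul h2.differentiableAt.hasDerivAt).add_const c).deriv
      have h7 : ζ - ζ₀ ≠ 0 := sub_ne_zero.2 h3
      rw [h4.deriv_eq]
      refine h6.trans ?_
      obtain ⟨n, rfl⟩ := Nat.exists_eq_succ_of_ne_zero hn
      simp only [Nat.succ_eq_add_one, Nat.cast_add, Nat.cast_one, add_sub_cancel_right,
        zpow_natCast, Nat.add_sub_cancel]
      ring
    have hG : AnalyticAt ℂ (fun ζ => C * (g ζ ^ κ c *
        ∏ c' ∈ Q.erase c, ((U ∘ D.symm) ζ - c') ^ κ c') *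
          (n * g ζ + (ζ - ζ₀) * deriv g ζ) ^ 2) ζ₀ := by
      refine (analyticAt_const.mul ((hg.zpow hg0).mul (hprod κ).1)).mul ?_
      exact ((analyticAt_const.mul hg).add
        ((analyticAt_id.sub analyticAt_const).mul hg.deriv)).pow 2
    have h1 := eq_zero_of_zpow_mul_eq_one (n := n * κ c + 2 * (n - 1)) hG (by
      simp only [sub_self, zero_mul, add_zero]
      exact mul_ne_zero (mul_ne_zero h.C_ne_zero (mul_ne_zero (zpow_ne_zero _ hg0) (hprod κ).2))
        (pow_ne_zero _ (mul_ne_zero (Nat.cast_ne_zero.2 hn) hg0))) (by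
      filter_upwards [hderiv, nhdsWithin_le_nhds hfg, self_mem_nhdsWithin,
        hD.eventually_notMem _ hζ, htarget] with ζ h1 h2 h3 h4 h5
      have h6 := hD.coeff_mul_deriv_sq hS h5 h4
      have h7 : ζ - ζ₀ ≠ 0 := sub_ne_zero.2 h3
      have h8 := hsplit κ ζ h2
      simp only [Function.comp_apply] at h8 ⊢
      rw [h8, h1] at h6
      rw [← h6, zpow_add₀ h7, mul_comm (2 : ℤ), zpow_mul _ _ (2 : ℤ)]
      norm_cast
      ring)
    linarith
  -- In this coordinate F is a continuous k-th root of (ζ - ζ₀)^(nα) times a unit.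
  · refine dvd_of_pow_eq_zpow_mul (Φ := F ∘ D.symm) (R := fun ζ => C' * (g ζ ^ α c *
        ∏ c' ∈ Q.erase c, ((U ∘ D.symm) ζ - c') ^ α c'))
      (analyticAt_const.mul ((hg.zpow hg0).mul (hprod α).1))
      (mul_ne_zero h.C'_ne_zero (mul_ne_zero (zpow_ne_zero _ hg0) (hprod α).2)) ?_
    filter_upwards [nhdsWithin_le_nhds hfg, hD.eventually_notMem _ hζ, htarget] with ζ h2 h4 h5
    have hX := hD.subset (D.map_target h5)
    refine ⟨(h.continuousAt_root _ hX h4).comp (D.symm.continuousAt h5), ?_⟩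
    rw [Function.comp_apply, h.root_pow _ hX h4, mul_left_comm, ← hsplit α ζ h2]
    rfl

/-- The points with non-trivial stabilizer lie over simple poles. -/
theorem of_vadd_eq (h : FlatCover k q X₀ Q κ α U F C C') (hS : IsSqrtCoeff k X₀ Q κ U C S ε)
    {x : X} (hx : x ∈ D.source) {g : ZMod k} (hg : g ≠ 0) (hgx : g +ᵥ x = x) :
    U x ∈ Q ∧ κ (U x) = -1 ∧ (k : ℤ) ∣ 2 * α (U x) := by
  have hxX := hD.subset hx
  have hQ : U x ∈ Q := by
    by_contra hQ
    exact hg (h.free g x hxX hQ hgx)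
  have hζ := D.map_source hx
  obtain ⟨n, G, hG, hG0, hfG, hn, hk⟩ := hD.exists_ramification h hS hζ hQ (by rw [D.left_inv hx])
  -- For n = 1 the function U is injective near x. Then g, which preserves U, fixes nearby points
  -- off `Q`, against freeness.
  rcases ramification_eq_one_or_two hn with ⟨rfl, -⟩ | ⟨rfl, hκ⟩
  · exfalso
    obtain ⟨-, N, hN, hinj⟩ := exists_injOn_of_sub_eq_mul hG hG0 hfG
    have hN' : ∀ᶠ y in 𝓝 x, y ∈ D.source ∧ D y ∈ N :=
      Filter.Eventually.and (D.open_source.mem_nhds hx) ((D.continuousAt hx).eventually_mem hN)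
    have hgN : ∀ᶠ y in 𝓝 x, g +ᵥ y ∈ D.source ∧ D (g +ᵥ y) ∈ N := by
      have h1 : Tendsto (fun y : X => g +ᵥ y) (𝓝 x) (𝓝 x) := by
        have h2 := ((h.mdifferentiable_vadd g).continuous.tendsto x)
        rwa [hgx] at h2
      exact h1.eventually hN'
    have hsymm : Tendsto D.symm (𝓝[≠] (D x)) (𝓝 x) := by
      have h1 := (D.symm.continuousAt hζ).tendsto
      rw [D.left_inv hx] at h1
      exact h1.mono_left nhdsWithin_le_nhds
    obtain ⟨ζ, hζQ, h1, h2⟩ := ((hD.eventually_notMem _ hζ).and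
      (hsymm.eventually (hN'.and hgN))).exists
    refine hg (h.free g _ (hD.subset h1.1) hζQ (D.injOn h2.1 h1.1 (hinj h2.2 h1.2 ?_)))
    rw [Function.comp_apply, Function.comp_apply, D.left_inv h2.1, D.left_inv h1.1,
      h.map_vadd _ (hD.subset h1.1)]
  · exact ⟨hQ, hκ, by exact_mod_cast hk⟩

/-- At the points with trivial stabilizer, the map to the sphere is unramified. -/
theorem of_free [T2Space X] (h : FlatCover k q X₀ Q κ α U F C C')
    (hS : IsSqrtCoeff k X₀ Q κ U C S ε) {x : X} (hx : x ∈ D.source)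
    (hfree : ∀ g : ZMod k, g +ᵥ x = x → g = 0) :
    deriv (U ∘ D.symm) (D x) ≠ 0 ∧ (U x ∈ Q → κ (U x) = 0 ∧ (k : ℤ) ∣ α (U x)) := by
  have hζ := D.map_source hx
  by_cases hQ : U x ∈ Q
  swap
  · exact ⟨hD.deriv_ne_zero_of_notMem hζ (by rwa [D.left_inv hx]), fun h => (hQ h).elim⟩
  obtain ⟨n, G, hG, hG0, hfG, hn, hk⟩ := hD.exists_ramification h hS hζ hQ (by rw [D.left_inv hx])
  rcases ramification_eq_one_or_two hn with ⟨rfl, hκ⟩ | ⟨rfl, -⟩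
  · exact ⟨(exists_injOn_of_sub_eq_mul hG hG0 hfG).1, fun _ => ⟨hκ, by simpa using hk⟩⟩
  -- For n = 2 the function U is not injective near x. Two nearby points with the same U differ by
  -- some g ≠ 0; but X is Hausdorff and the group finite, so a small neighbourhood is disjoint from
  -- all its non-trivial translates.
  · exfalso
    have hN : ∃ N ∈ 𝓝 x, ∀ g : ZMod k, g ≠ 0 → ∀ y ∈ N, g +ᵥ y ∉ N := by
      have h1 : ∀ g : ZMod k, ∃ N ∈ 𝓝 x, g ≠ 0 → ∀ y ∈ N, g +ᵥ y ∉ N := by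
        intro g
        by_cases hg : g = 0
        · exact ⟨univ, univ_mem, fun h => (h hg).elim⟩
        obtain ⟨u, v, hu, hv, hxu, hxv, huv⟩ := t2_separation fun h1 => hg (hfree g h1)
        refine ⟨(fun y => g +ᵥ y) ⁻¹' u ∩ v, inter_mem
          ((h.mdifferentiable_vadd g).continuous.continuousAt.preimage_mem_nhds
            (hu.mem_nhds hxu)) (hv.mem_nhds hxv), fun _ y hy hgy => ?_⟩
        exact disjoint_left.1 huv hy.1 hgy.2
      choose N hN hN' using h1
      exact ⟨⋂ g, N g, iInter_mem.2 hN, fun g hg y hy hgy =>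
        hN' g hg y (mem_iInter.1 hy g) (mem_iInter.1 hgy g)⟩
    obtain ⟨N, hN, hNg⟩ := hN
    have hN' : D.target ∩ D.symm ⁻¹' N ∈ 𝓝 (D x) :=
      inter_mem (D.open_target.mem_nhds hζ) ((D.symm.continuousAt hζ).preimage_mem_nhds
        (by rwa [D.left_inv hx]))
    refine not_injOn_of_sq_mul hG hG0 hfG hN' fun ζ h1 ζ' h2 h12 => ?_
    obtain ⟨g, hg⟩ := (h.fiber _ (hD.subset (D.map_target h1.1)) _
      (hD.subset (D.map_target h2.1))).1 h12
    have hg0 : g = 0 := by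
      by_contra hg0
      exact hNg g hg0 _ h1.2 (hg ▸ h2.2)
    rw [hg0, zero_vadd] at hg
    exact D.symm.injOn h1.1 h2.1 hg

end IsTransChart
end

/-! ### Closed geodesics -/

theorem IsLineAt.comp_mul {X : Type*} [TopologicalSpace X] {𝒟 : Set (OpenPartialHomeomorph X ℂ)}
    {V : ℂ} {γ : ℝ → X} {t a : ℝ} (h : IsLineAt 𝒟 V γ (a * t)) :
    IsLineAt 𝒟 (a * V) (fun r => γ (a * r)) t := by
  obtain ⟨D, hD, hx, h⟩ := h
  refine ⟨D, hD, hx, ?_⟩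
  have h1 : Tendsto (fun r : ℝ => a * r) (𝓝 t) (𝓝 (a * t)) := Continuous.tendsto (by fun_prop) t
  filter_upwards [h1.eventually h] with r hr
  refine ⟨hr.1, ?_⟩
  rw [hr.2]
  push_cast
  ring

section

set_option linter.unusedSectionVars false

variable {k : ℕ} [NeZero k] {X : Type*} [TopologicalSpace X] [ChartedSpace ℂ X]
    [IsManifold 𝓘(ℂ) ω X] [AddAction (ZMod k) X] {q : QuadDiff X} {X₀ : Set X} {Q : Finset ℂ}
    {κ α : ℂ → ℤ} {U F S : X → ℂ} {C C' : ℂ} {ε : ZMod k → ℂ}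

namespace FlatCover

variable (h : FlatCover k q X₀ Q κ α U F C C') (hS : IsSqrtCoeff k X₀ Q κ U C S ε)
include h hS

theorem isLineAt_of_isLineSegment {p p' : X} {T : ℝ} {γ : ℝ → X} (hγ : q.IsLineSegment p p' T γ)
    {t : ℝ} (ht : t ∈ Ioo 0 T) (hX : γ t ∈ X₀) :
    ∃ V, ‖V‖ = 1 ∧ IsLineAt {D | IsTransChart X₀ Q U S D} V γ t := by
  obtain ⟨e, he, hx, v, hv, hline⟩ := hγ.straight t ht
  obtain ⟨s, hs, D, hD, hxD, -, hDe⟩ := hS.exists_isTransChart h he hx hX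
  have hs1 : ‖s‖ = 1 := by
    have h1 : ‖s‖ ^ 2 = 1 := by rw [← norm_pow, hs, norm_one]
    nlinarith [norm_nonneg s]
  refine ⟨s * v, by rw [norm_mul, hs1, hv, one_mul], D, hD, hxD, ?_⟩
  have hc : ContinuousAt γ t := hγ.continuousOn.continuousAt (Icc_mem_nhds ht.1 ht.2)
  filter_upwards [hline, hc.eventually_mem (D.open_source.mem_nhds hxD)] with r h1 h2
  refine ⟨h2, ?_⟩
  rw [hDe, hDe, h1]
  ring

/-- A line segment from a regular point to itself which does not meet the other points of the deck
group orbit gives a closed geodesic. -/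
theorem exists_closed_line [T2Space X] {p : X} {T : ℝ} {γ : ℝ → X} (hγ : q.IsLineSegment p p T γ)
    (hp : q.IsRegularPoint p) (hX : ∀ t ∈ Icc 0 T, γ t ∈ X₀)
    (hfree : ∀ t ∈ Icc 0 T, U (γ t) = U p → γ t = p) :
    ∃ (V : ℂ) (γ' : ℝ → X), V ≠ 0 ∧ Function.Periodic γ' (2 * Real.pi) ∧
      (∀ t, IsLineAt {D | IsTransChart X₀ Q U S D} V γ' t) ∧
      ∀ t, U (γ' t) = U (γ' 0) → ∃ n : ℤ, t = n * (2 * Real.pi) := by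
  have h𝒟 := IsTransChart.isTranslationAtlas (S := S) h
  have hT := hγ.pos
  obtain ⟨V, hV⟩ := IsLineAt.exists_forall h𝒟 (J := Ioo 0 T) (γ := γ) isPreconnected_Ioo
    fun t ht => by
      obtain ⟨V, -, hV⟩ := h.isLineAt_of_isLineSegment hS hγ ht (hX t ⟨ht.1.le, ht.2.le⟩)
      exact ⟨V, hV⟩
  have hV0 : V ≠ 0 := by
    have ht : T / 2 ∈ Ioo 0 T := ⟨by linarith, by linarith⟩
    obtain ⟨V', hV', hl⟩ := h.isLineAt_of_isLineSegment hS hγ ht (hX _ ⟨ht.1.le, ht.2.le⟩)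
    rw [(hV _ ht).unique h𝒟 hl]
    rintro rfl
    simp at hV'
  obtain ⟨e, he, hpe⟩ := hp
  have hpX : p ∈ X₀ := hγ.source ▸ hX 0 ⟨le_rfl, hT.le⟩
  obtain ⟨s, -, D, hD, hpD, -, -⟩ := hS.exists_isTransChart h he hpe hpX
  have h0D : γ 0 ∈ D.source := by rwa [hγ.source]
  obtain ⟨δ, hδ, hδT, hstart⟩ := IsLineAt.start h𝒟 hT hγ.continuousOn hV hD h0D
  have hne : ∀ t ∈ Ioo 0 δ, γ t ≠ p := by
    intro t ht h1
    have h2 := (hstart t ⟨ht.1.le, ht.2⟩).2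
    rw [h1, hγ.source, left_eq_add] at h2
    exact mul_ne_zero (Complex.ofReal_ne_zero.2 ht.1.ne') hV0 h2
  -- T' is the first return time to p. The bound δ / 2 keeps the compact set away from time 0, and
  -- no return occurs before δ.
  obtain ⟨T', ⟨⟨hT'1, hT'2⟩, hT'p⟩, hmin⟩ : ∃ T', IsLeast (Icc (δ / 2) T ∩ γ ⁻¹' {p}) T' := by
    refine IsCompact.exists_isLeast ?_ ⟨T, ⟨by linarith, le_rfl⟩, hγ.target⟩
    have h1 : ContinuousOn γ (Icc (δ / 2) T) :=
      hγ.continuousOn.mono (Icc_subset_Icc_left (by linarith))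
    exact isCompact_Icc.of_isClosed_subset
      (h1.preimage_isClosed_of_isClosed isClosed_Icc isClosed_singleton) inter_subset_left
  have hT'0 : 0 < T' := by linarith
  have hsub : Icc 0 T' ⊆ Icc 0 T := Icc_subset_Icc_right hT'2
  have hne' : ∀ t ∈ Ioo 0 T', γ t ≠ p := by
    intro t ht h1
    rcases lt_or_ge t δ with h2 | h2
    · exact hne t ⟨ht.1, h2⟩ h1
    · exact absurd (hmin ⟨⟨by linarith, by linarith [ht.2]⟩, h1⟩) (not_le.2 ht.2)
  obtain ⟨γ', hγ', hper, hline⟩ := IsLineAt.exists_periodic h𝒟 hT'0 (hγ.continuousOn.mono hsub)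
    (hγ.source.trans (mem_singleton_iff.1 hT'p).symm)
    (fun t ht => hV t ⟨ht.1, ht.2.trans_le hT'2⟩) hD h0D
  have h0 : γ' 0 = p := by rw [hγ' 0 ⟨le_rfl, hT'0.le⟩, hγ.source]
  have hU : ∀ t, U (γ' t) = U p → ∃ n : ℤ, t = n * T' := by
    intro t ht
    have h1 : toIcoMod hT'0 0 t ∈ Ico 0 T' := by simpa using toIcoMod_mem_Ico hT'0 0 t
    have h2 : γ' t = γ (toIcoMod hT'0 0 t) := by
      rw [← hγ' _ ⟨h1.1, h1.2.le⟩, toIcoMod, hper.sub_zsmul_eq]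
    have h3 : γ (toIcoMod hT'0 0 t) = p :=
      hfree _ (hsub ⟨h1.1, h1.2.le⟩) (by rw [← h2, ht])
    have h4 : toIcoMod hT'0 0 t = 0 := by
      by_contra h4
      exact hne' _ ⟨lt_of_le_of_ne h1.1 (Ne.symm h4), h1.2⟩ h3
    refine ⟨toIcoDiv hT'0 0 t, ?_⟩
    rw [toIcoMod, sub_eq_zero] at h4
    rw [← zsmul_eq_mul]
    exact h4
  have hπ : 0 < 2 * Real.pi := Real.two_pi_pos
  -- Time is rescaled to the period 2π, which multiplies the velocity.
  refine ⟨(T' / (2 * Real.pi) : ℝ) * V, fun t => γ' (T' / (2 * Real.pi) * t), ?_, ?_, ?_, ?_⟩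
  · exact mul_ne_zero (Complex.ofReal_ne_zero.2 (by positivity)) hV0
  · intro t
    have : T' / (2 * Real.pi) * (t + 2 * Real.pi) = T' / (2 * Real.pi) * t + T' := by
      field_simp
    simp only [this, hper _]
  · exact fun t => (hline _).comp_mul
  · intro t ht
    simp only [mul_zero, h0] at ht
    obtain ⟨n, hn⟩ := hU _ ht
    refine ⟨n, ?_⟩
    field_simp at hn
    linarith

end FlatCover

/-! ### Deck translates of a closed geodesic -/

section closed

variable [T2Space X] {V : ℂ} {γ : ℝ → X} (h : FlatCover k q X₀ Q κ α U F C C')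
  (hS : IsSqrtCoeff k X₀ Q κ U C S ε) (hV : V ≠ 0) (hper : Function.Periodic γ (2 * Real.pi))
  (hγ : ∀ t, IsLineAt {D | IsTransChart X₀ Q U S D} V γ t)
  (hU : ∀ t, U (γ t) = U (γ 0) → ∃ n : ℤ, t = n * (2 * Real.pi))

namespace FlatCover

omit [T2Space X] in
theorem mem_of_isLineAt {t : ℝ} (hγ : IsLineAt {D | IsTransChart X₀ Q U S D} V γ t) : γ t ∈ X₀ := by
  obtain ⟨D, hD, hx, -⟩ := hγ
  exact hD.subset hx

include h hV hγ

omit [T2Space X] in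
theorem eventually_notMem_line (t : ℝ) : ∀ᶠ r in 𝓝[≠] t, U (γ r) ∉ Q := by
  have h𝒟 := IsTransChart.isTranslationAtlas (S := S) h
  obtain ⟨D, hD, hx, hline⟩ := hγ t
  have h1 : Tendsto (fun r : ℝ => D (γ t) + ((r - t : ℝ) : ℂ) * V) (𝓝[≠] t) (𝓝[≠] (D (γ t))) := by
    have h2 : ContinuousAt (fun r : ℝ => D (γ t) + ((r - t : ℝ) : ℂ) * V) t := by fun_prop
    have h3 := h2.continuousWithinAt (s := {t}ᶜ)
    have h4 := h3.tendsto_nhdsWithin (t := {D (γ t)}ᶜ) fun r hr h5 => by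
      rw [mem_singleton_iff, add_eq_left] at h5
      exact mul_ne_zero (Complex.ofReal_ne_zero.2 (sub_ne_zero.2 hr)) hV h5
    simpa using h4
  filter_upwards [h1.eventually (hD.eventually_notMem _ (D.map_source hx)),
    nhdsWithin_le_nhds hline] with r h2 h3
  rwa [← h3.2, D.left_inv h3.1] at h2

include hS hper hU

/-- A closed geodesic through only one point of an orbit meets every orbit at most once. -/
theorem eq_zero_of_vadd_eq {g : ZMod k} {t₁ t₂ : ℝ} (hg : g +ᵥ γ t₁ = γ t₂) :
    g = 0 ∧ ∃ n : ℤ, t₂ = t₁ + n * (2 * Real.pi) := by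
  have h𝒟 := IsTransChart.isTranslationAtlas (S := S) h
  have hmem : ∀ t, γ t ∈ X₀ := fun t => mem_of_isLineAt (hγ t)
  have hline := fun t => hS.isLineAt_vadd h (hγ t) g
  -- Sign +1: gγ and a time shift of γ are lines with equal velocity and a common point, so they
  -- coincide. At time 0, `hU` makes the shift a multiple of the period, so g fixes γ pointwise, and
  -- freeness applies at a point of γ off `Q`.
  rcases hS.sign_eq (-g) with hε | hε
  · simp only [hε, one_mul] at hline
    have h1 := IsLineAt.eq_of_eq h𝒟 hline (fun t => (hγ (t + (t₂ - t₁))).comp_add) (t₀ := t₁)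
      (by simp [hg])
    have h2 := congrFun h1
    obtain ⟨n, hn⟩ := hU (t₂ - t₁) (by
      rw [← h.map_vadd g (hmem 0), h2, zero_add])
    refine ⟨?_, n, by linarith⟩
    obtain ⟨t, ht⟩ := (h.eventually_notMem_line hV hγ 0).exists
    refine h.free g _ (hmem t) ht ?_
    rw [h2, hn]
    exact hper.int_mul n t
  -- Sign -1: gγ is γ run backwards, g +ᵥ γ t = γ (-t) by `hU` and periodicity. Hence g fixes γ 0
  -- and γ π.
  · exfalso
    simp only [hε, neg_mul, one_mul] at hline
    have h1 := IsLineAt.eq_of_eq h𝒟 hline (fun t => (hγ (t₁ + t₂ - t)).comp_sub) (t₀ := t₁)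
      (by simp [hg])
    have h2 := congrFun h1
    obtain ⟨n, hn⟩ := hU (t₁ + t₂) (by rw [← h.map_vadd g (hmem 0), h2, sub_zero])
    have h3 : ∀ t, g +ᵥ γ t = γ (-t) := by
      intro t
      rw [h2, hn, sub_eq_neg_add]
      exact hper.int_mul n (-t)
    -- If g = 0, then γ equals its own reverse, so V = -V.
    have hg0 : g ≠ 0 := by
      rintro rfl
      have h4 : γ = fun t => γ (0 - t) := by
        funext t
        rw [zero_sub, ← h3, zero_vadd]
      have h5 : IsLineAt {D | IsTransChart X₀ Q U S D} (-V) γ 0 := by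
        have h6 := (hγ (0 - 0)).comp_sub
        rwa [← h4] at h6
      exact hV (self_eq_neg.1 ((hγ 0).unique h𝒟 h5))
    have e0 : g +ᵥ γ 0 = γ 0 := by rw [h3, neg_zero]
    have eπ : g +ᵥ γ Real.pi = γ Real.pi := by
      rw [h3, ← hper (-Real.pi)]
      congr 1
      ring
    obtain ⟨D, hD, hx, -⟩ := hγ 0
    obtain ⟨q0, κ0, α0⟩ := hD.of_vadd_eq h hS hx hg0 e0
    obtain ⟨D, hD, hx, -⟩ := hγ Real.pi
    obtain ⟨q1, κ1, α1⟩ := hD.of_vadd_eq h hS hx hg0 eπ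
    have hne : U (γ 0) ≠ U (γ Real.pi) := by
      intro h4
      obtain ⟨n, hn⟩ := hU _ h4.symm
      have h5 : (n : ℝ) * 2 = 1 := by
        have := Real.pi_ne_zero
        field_simp at hn
        linarith
      have h6 : n * 2 = 1 := by exact_mod_cast h5
      omega
    refine h.generator {U (γ 0), U (γ Real.pi)} ?_ ?_ ?_
    · intro c hc
      rcases Finset.mem_insert.1 hc with rfl | hc
      · exact q0
      · rwa [Finset.mem_singleton.1 hc]
    · rw [Finset.sum_pair hne, κ0, κ1]
      norm_num
    · rw [Finset.sum_pair hne]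
      have p0 := h.parity _ q0
      have p1 := h.parity _ q1
      rw [κ0] at p0
      rw [κ1] at p1
      obtain ⟨j, hj⟩ := h.even
      have hj' : (k : ℤ) = 2 * j := by rw [hj]; push_cast; ring
      have hneg : ¬ Even (-1 : ℤ) := by decide
      -- With k = 2j, an odd a such that k divides 2a is an odd multiple of j. The sum of two of
      -- these is an even multiple of j, hence divisible by k, against `generator`.
      have hodd : ∀ a : ℤ, Odd a → (k : ℤ) ∣ 2 * a → ∃ b, Odd b ∧ a = j * b := by
        rintro a ha ⟨b, hb⟩
        have h4 : a = j * b := by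
          rw [hj'] at hb
          linarith
        refine ⟨b, ?_, h4⟩
        rw [h4] at ha
        exact (Int.odd_mul.1 ha).2
      obtain ⟨b0, hb0, e0⟩ := hodd _ (Int.not_even_iff_odd.1 fun h4 => hneg (p0.2 h4)) α0
      obtain ⟨b1, hb1, e1⟩ := hodd _ (Int.not_even_iff_odd.1 fun h4 => hneg (p1.2 h4)) α1
      obtain ⟨b, hb⟩ := hb0.add_odd hb1
      refine ⟨b, ?_⟩
      rw [e0, e1, hj', ← mul_add, hb]
      ring

end FlatCover

end closed

end

/-! ### Winding numbers of closed geodesics -/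

theorem finite_setOf_pow_eq {k : ℕ} (hk : 0 < k) (c : ℂ) : {y : ℂ | y ^ k = c}.Finite :=
  (Polynomial.nthRoots k c).toFinset.finite_toSet.subset fun y (hy : y ^ k = c) => by
    simp [Polynomial.mem_nthRoots hk, hy]

/-- A continuous root of a nowhere vanishing continuous function on a punctured disc extends. -/
theorem exists_eq_mul_exp_div {k : ℕ} (hk : 0 < k) {Φ Λ : ℂ → ℂ} {ζ₀ : ℂ} {r : ℝ} (hr : 0 < r)
    (hΦ : ContinuousOn Φ (Metric.ball ζ₀ r \ {ζ₀})) (hΛ : ContinuousOn Λ (Metric.ball ζ₀ r))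
    (h : ∀ ζ ∈ Metric.ball ζ₀ r \ {ζ₀}, Φ ζ ^ k = Complex.exp (Λ ζ)) :
    ∃ a, ∀ ζ ∈ Metric.ball ζ₀ r \ {ζ₀}, Φ ζ = a * Complex.exp (Λ ζ / k) := by
  have hfin := finite_setOf_pow_eq hk 1
  have hpow : ∀ y : ℂ, Complex.exp (y / k) ^ k = Complex.exp y := fun y => by
    rw [← Complex.exp_nat_mul, mul_div_cancel₀ _ (Nat.cast_ne_zero.2 hk.ne')]
  have hmaps : MapsTo (fun ζ => Φ ζ / Complex.exp (Λ ζ / k)) (Metric.ball ζ₀ r \ {ζ₀})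
      {y : ℂ | y ^ k = 1} := fun ζ hζ => by
    simp only [mem_ofPred_eq]
    rw [div_pow, hpow, h ζ hζ, div_self (Complex.exp_ne_zero _)]
  have hcont : ContinuousOn (fun ζ => Φ ζ / Complex.exp (Λ ζ / k)) (Metric.ball ζ₀ r \ {ζ₀}) :=
    hΦ.div ((hΛ.mono sdiff_subset).div_const _).cexp fun _ _ => Complex.exp_ne_zero _
  obtain ⟨ζ₁, hζ₁⟩ : (Metric.ball ζ₀ r \ {ζ₀}).Nonempty :=
    ⟨ζ₀ + (r / 2 : ℝ), by
      rw [Metric.mem_ball, dist_eq_norm, add_sub_cancel_left, Complex.norm_real, Real.norm_eq_abs,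
        abs_of_pos (by positivity)]
      linarith, by simp [hr.ne']⟩
  refine ⟨Φ ζ₁ / Complex.exp (Λ ζ₁ / k), fun ζ hζ => ?_⟩
  have := (isPreconnected_ball_sdiff_singleton ζ₀ hr).constant_of_mapsTo hfin.isDiscrete hcont
    hmaps hζ hζ₁
  rw [← this, div_mul_cancel₀ _ (Complex.exp_ne_zero _)]

section

set_option linter.unusedSectionVars false

variable {k : ℕ} [NeZero k] {X : Type*} [TopologicalSpace X] [ChartedSpace ℂ X]
    [IsManifold 𝓘(ℂ) ω X] [AddAction (ZMod k) X] {q : QuadDiff X} {X₀ : Set X} {Q : Finset ℂ}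
    {κ α : ℂ → ℤ} {U F S : X → ℂ} {C C' : ℂ} {ε : ZMod k → ℂ}
    {V : ℂ} {γ : ℝ → X} (h : FlatCover k q X₀ Q κ α U F C C')

namespace FlatCover

include h

theorem hasDerivAt_line {t : ℝ} (hγ : IsLineAt {D | IsTransChart X₀ Q U S D} V γ t)
    {D : OpenPartialHomeomorph X ℂ} (hD : IsTransChart X₀ Q U S D) (hx : γ t ∈ D.source) :
    HasDerivAt (fun t => U (γ t)) (V * deriv (U ∘ D.symm) (D (γ t))) t := by
  have h𝒟 := IsTransChart.isTranslationAtlas (S := S) h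
  have h1 := hγ.hasDerivAt h𝒟 hD hx
  have h2 := (hD.analyticAt h (D.map_source hx)).differentiableAt.hasDerivAt
  refine (h2.scomp t h1).congr_of_eventuallyEq ?_
  filter_upwards [hγ.continuousAt.eventually_mem (D.open_source.mem_nhds hx)] with r hr
  simp [D.left_inv hr]

variable (hV : V ≠ 0) (hγ : ∀ t, IsLineAt {D | IsTransChart X₀ Q U S D} V γ t)
include hγ

theorem continuous_deriv_line : Continuous (deriv fun t => U (γ t)) := by
  rw [continuous_iff_continuousAt]
  intro t
  obtain ⟨D, hD, hx, -⟩ := id (hγ t)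
  have hc := (hγ t).continuousAt
  have h1 : ContinuousAt (fun r => V * deriv (U ∘ D.symm) (D (γ r))) t :=
    continuousAt_const.mul ((hD.analyticAt h (D.map_source hx)).deriv.continuousAt.comp_of_eq
      ((D.continuousAt hx).comp_of_eq hc rfl) rfl)
  refine h1.congr ?_
  filter_upwards [hc.eventually_mem (D.open_source.mem_nhds hx)] with r hr
  exact (h.hasDerivAt_line (hγ r) hD hr).deriv.symm

include hV

/-- The monodromy of the cover along a closed geodesic. -/
theorem dvd_sum_of_hasWinding (hper : Function.Periodic γ (2 * Real.pi)) {R : Finset ℂ} (hR : R ⊆ Q)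
    (hk : ∀ c ∈ Q, c ∉ R → (k : ℤ) ∣ α c) {n : ℂ → ℤ}
    (hn : ∀ c ∈ R, HasWinding (fun t => U (γ t) - c) (n c)) : (k : ℤ) ∣ ∑ c ∈ R, α c * n c := by
  have hk0 : 0 < k := Nat.pos_of_ne_zero (NeZero.ne k)
  have hkC : (k : ℂ) ≠ 0 := Nat.cast_ne_zero.2 hk0.ne'
  have hpow : ∀ y : ℂ, Complex.exp (y / k) ^ k = Complex.exp y := fun y => by
    rw [← Complex.exp_nat_mul, mul_div_cancel₀ _ hkC]
  have hmem : ∀ t, γ t ∈ X₀ := fun t => mem_of_isLineAt (hγ t)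
  have hRU : ∀ t, U (γ t) ∉ R := fun t ht => (hn _ ht).ne_zero t (sub_self _)
  obtain ⟨L, hL, hexpL, hLper⟩ := HasWinding.prod R (fun c hc => (hn c hc).zpow (α c))
  -- The root F need not be continuous over the points of Q on the curve. There k divides α, so
  -- their contribution to F^k is a k-th power and can be divided out.
  set G : X → ℂ := fun x => F x * ∏ c ∈ Q \ R, (U x - c) ^ (-(α c / k)) with hG
  have hGc : ∀ x ∈ X₀, U x ∉ Q → ContinuousAt G x := fun x hx hxQ =>
    (h.continuousAt_root x hx hxQ).mul (continuousAt_prod_zpow (h.continuousAt hx)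
      (fun h1 => hxQ (Finset.sdiff_subset h1)) _)
  have hGk : ∀ x ∈ X₀, U x ∉ Q → G x ^ k = C' * ∏ c ∈ R, (U x - c) ^ α c := by
    intro x hx hxQ
    have h1 : (∏ c ∈ Q \ R, (U x - c) ^ (-(α c / k))) ^ k * ∏ c ∈ Q \ R, (U x - c) ^ α c = 1 := by
      rw [← Finset.prod_pow, ← Finset.prod_mul_distrib]
      refine Finset.prod_eq_one fun c hc => ?_
      rw [Finset.mem_sdiff] at hc
      have hne : U x - c ≠ 0 := sub_ne_zero.2 fun h3 => hxQ (h3 ▸ hc.1)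
      rw [← zpow_natCast, ← zpow_mul, ← zpow_add₀ hne, neg_mul,
        Int.ediv_mul_cancel (hk c hc.1 hc.2), neg_add_cancel, zpow_zero]
    simp only [hG]
    rw [mul_pow, h.root_pow x hx hxQ, ← Finset.prod_sdiff hR]
    linear_combination (C' * ∏ c ∈ R, (U x - c) ^ α c) * h1
  -- On a punctured disc in a chart, G is a constant times a root that extends over the centre.
  -- Hence the ratio of G to exp (L / k) along γ takes the same constant value just before and just
  -- after t₀, even if γ t₀ lies over Q.
  have hlocal : ∀ t₀, ∃ a, ∀ᶠ t in 𝓝[≠] t₀, G (γ t) / Complex.exp (L t / k) = a := by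
    intro t₀
    obtain ⟨D, hD, hx, -⟩ := id (hγ t₀)
    have hc := (hγ t₀).continuousAt
    have hζ := D.map_source hx
    have hfan := hD.analyticAt h hζ
    have hfR : (U ∘ D.symm) (D (γ t₀)) ∉ R := by
      rw [Function.comp_apply, D.left_inv hx]; exact hRU t₀
    have h1 : ∀ᶠ ζ in 𝓝 (D (γ t₀)), ζ ∈ D.target ∧ (U ∘ D.symm) ζ ∉ R ∧
        (ζ ∈ ({D (γ t₀)} : Set ℂ)ᶜ → U (D.symm ζ) ∉ Q) :=
      Filter.Eventually.and (D.open_target.mem_nhds hζ)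
        ((hfan.continuousAt.eventually_mem
          (R.finite_toSet.isClosed.isOpen_compl.mem_nhds hfR)).and
          (eventually_nhdsWithin_iff.1 (hD.eventually_notMem _ hζ)))
    obtain ⟨r, hr, hball⟩ := Metric.mem_nhds_iff.1 h1
    have hX : ∀ ζ ∈ Metric.ball (D (γ t₀)) r, D.symm ζ ∈ X₀ := fun ζ hζ' =>
      hD.subset (D.map_target (hball hζ').1)
    obtain ⟨Λ, hΛ, hexpΛ⟩ := exists_continuousOn_log (convex_ball (D (γ t₀)) r)
      Metric.isOpen_ball ⟨_, Metric.mem_ball_self hr⟩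
      (g := fun ζ => C' * ∏ c ∈ R, ((U ∘ D.symm) ζ - c) ^ α c) (fun ζ hζ' =>
        (continuousAt_const.mul (continuousAt_prod_zpow
          (hD.analyticAt h (hball hζ').1).continuousAt (hball hζ').2.1 _)).continuousWithinAt)
      (fun ζ hζ' => mul_ne_zero h.C'_ne_zero (prod_zpow_ne_zero _ (hball hζ').2.1))
    obtain ⟨a, ha⟩ := exists_eq_mul_exp_div hk0 hr (Φ := fun ζ => G (D.symm ζ)) (Λ := Λ)
      (fun ζ hζ' => ((hGc _ (hX ζ hζ'.1) ((hball hζ'.1).2.2 hζ'.2)).comp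
        (D.symm.continuousAt (hball hζ'.1).1)).continuousWithinAt) hΛ
      (fun ζ hζ' => by
        rw [hexpΛ ζ hζ'.1]
        exact hGk _ (hX ζ hζ'.1) ((hball hζ'.1).2.2 hζ'.2))
    have hDγ : ContinuousAt (fun t => D (γ t)) t₀ := (D.continuousAt hx).comp_of_eq hc rfl
    have hnear : ∀ᶠ t in 𝓝 t₀, γ t ∈ D.source ∧ D (γ t) ∈ Metric.ball (D (γ t₀)) r :=
      (hc.eventually_mem (D.open_source.mem_nhds hx)).and
        (hDγ.eventually_mem (Metric.ball_mem_nhds _ hr))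
    set A : ℝ → ℂ := fun t => Complex.exp (Λ (D (γ t)) / k) / Complex.exp (L t / k) with hA
    have hAc : ContinuousAt A t₀ := by
      refine ContinuousAt.div ?_ (by fun_prop) (Complex.exp_ne_zero _)
      refine ((ContinuousAt.comp_of_eq (hΛ.continuousAt (Metric.ball_mem_nhds _ hr)) hDγ
        rfl).div_const _).cexp
    have hAk : ∀ᶠ t in 𝓝 t₀, A t ∈ {y : ℂ | y ^ k = C'} := by
      filter_upwards [hnear] with t ht
      simp only [hA]
      rw [div_pow, hpow, hpow, hexpΛ _ ht.2, hexpL, Function.comp_apply, D.left_inv ht.1,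
        mul_div_cancel_right₀ _ (prod_zpow_ne_zero α (hRU t))]
    have hAconst := eventually_eq_of_mem_finite hAc (finite_setOf_pow_eq hk0 C') hAk
    refine ⟨a * A t₀, ?_⟩
    have hpunct : ∀ᶠ t in 𝓝[≠] t₀, D (γ t) ≠ D (γ t₀) := by
      obtain ⟨D', hD', hx', hline⟩ := id (hγ t₀)
      have h𝒟 := IsTransChart.isTranslationAtlas (S := S) h
      filter_upwards [nhdsWithin_le_nhds ((hγ t₀).chart h𝒟 hD hx), self_mem_nhdsWithin] with t h2 h3
      rw [h2.2, ne_eq, add_eq_left]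
      exact mul_ne_zero (Complex.ofReal_ne_zero.2 (sub_ne_zero.2 h3)) hV
    filter_upwards [hpunct, nhdsWithin_le_nhds hnear, nhdsWithin_le_nhds hAconst] with t h2 h3 h4
    have h5 := ha _ ⟨h3.2, h2⟩
    simp only [D.left_inv h3.1] at h5
    rw [h5, ← h4, mul_div_assoc]
  choose a ha using hlocal
  -- Neighbouring constants agree where their punctured neighbourhoods overlap, so there is only
  -- one.
  have hconst : ∀ t, a t = a 0 := by
    have h1 : IsLocallyConstant a := by
      rw [IsLocallyConstant.iff_eventually_eq]
      intro t
      have h2 := eventually_eventually_nhdsWithin.2 (ha t)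
      rw [eventually_nhdsWithin_iff] at h2
      filter_upwards [h2] with r hr
      by_cases hrt : r = t
      · rw [hrt]
      have h3 := hr hrt
      rw [isOpen_compl_singleton.nhdsWithin_eq hrt] at h3
      obtain ⟨s, hs1, hs2⟩ := ((ha r).and (h3.filter_mono nhdsWithin_le_nhds)).exists
      rw [← hs1, hs2]
    exact fun t => h1.apply_eq_of_isPreconnected isPreconnected_univ trivial trivial
  have hshift : ∀ᶠ t in 𝓝[≠] (0 : ℝ),
      G (γ (t + 2 * Real.pi)) / Complex.exp (L (t + 2 * Real.pi) / k) = a (2 * Real.pi) := by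
    have h1 : Tendsto (fun t : ℝ => t + 2 * Real.pi) (𝓝[≠] 0) (𝓝[≠] (2 * Real.pi)) := by
      have h2 : ContinuousAt (fun t : ℝ => t + 2 * Real.pi) 0 := by fun_prop
      have h3 := (h2.continuousWithinAt (s := {0}ᶜ)).tendsto_nhdsWithin (t := {2 * Real.pi}ᶜ)
        fun t ht h4 => ht (by simpa using h4)
      simpa using h3
    exact h1.eventually (ha _)
  obtain ⟨t, ⟨h1, h2⟩, h3⟩ := (((ha 0).and hshift).and
    (h.eventually_notMem_line hV hγ 0)).exists
  -- Over one period G returns to its value while L grows by 2πi ∑ α n; equality of the ratios says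
  -- exp (2πi ∑ α n / k) = 1.
  rw [hconst, ← h1, hper, hLper] at h2
  have hG0 : G (γ t) ≠ 0 := by
    intro h4
    have h5 := hGk _ (hmem t) h3
    rw [h4, zero_pow hk0.ne'] at h5
    exact mul_ne_zero h.C'_ne_zero (prod_zpow_ne_zero _ (hRU t)) h5.symm
  rw [div_eq_div_iff (Complex.exp_ne_zero _) (Complex.exp_ne_zero _)] at h2
  have h4 := (mul_left_cancel₀ hG0 h2)
  rw [add_div, Complex.exp_add, left_eq_mul₀ (Complex.exp_ne_zero _), Complex.exp_eq_one_iff] at h4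
  obtain ⟨j, hj⟩ := h4
  refine ⟨j, ?_⟩
  have hπ := Complex.two_pi_I_ne_zero
  rw [mul_div_right_comm] at hj
  have h5 := mul_right_cancel₀ hπ hj
  rw [div_eq_iff hkC] at h5
  have h6 : (∑ c ∈ R, α c * n c) = j * k := by exact_mod_cast h5
  rw [h6, mul_comm]

end FlatCover

end

/-! ### Non-existence of the closed geodesic -/

section

set_option linter.unusedSectionVars false

variable {k : ℕ} [NeZero k] {X : Type*} [TopologicalSpace X] [ChartedSpace ℂ X]
    [IsManifold 𝓘(ℂ) ω X] [AddAction (ZMod k) X] [T2Space X] {q : QuadDiff X} {X₀ : Set X}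
    {Q : Finset ℂ} {κ α : ℂ → ℤ} {U F S : X → ℂ} {C C' : ℂ} {ε : ZMod k → ℂ}
    {V : ℂ} {γ : ℝ → X} (h : FlatCover k q X₀ Q κ α U F C C')

namespace FlatCover

include h

/-- No closed geodesic meets some deck group orbit exactly once. -/
theorem false_of_closed_line (hS : IsSqrtCoeff k X₀ Q κ U C S ε) (hV : V ≠ 0)
    (hper : Function.Periodic γ (2 * Real.pi))
    (hγ : ∀ t, IsLineAt {D | IsTransChart X₀ Q U S D} V γ t)
    (hU : ∀ t, U (γ t) = U (γ 0) → ∃ n : ℤ, t = n * (2 * Real.pi)) : False := by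
  classical
  have hmem : ∀ t, γ t ∈ X₀ := fun t => mem_of_isLineAt (hγ t)
  have hfree : ∀ t, ∃ D, IsTransChart X₀ Q U S D ∧ γ t ∈ D.source ∧
      deriv (U ∘ D.symm) (D (γ t)) ≠ 0 ∧
        (U (γ t) ∈ Q → κ (U (γ t)) = 0 ∧ (k : ℤ) ∣ α (U (γ t))) := by
    intro t
    obtain ⟨D, hD, hx, -⟩ := hγ t
    exact ⟨D, hD, hx, hD.of_free h hS hx fun g hg =>
      (h.eq_zero_of_vadd_eq hS hV hper hγ hU hg).1⟩
  set w : ℝ → ℂ := fun t => U (γ t) with hw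
  -- Points of γ with the same U differ by a deck transformation, and then they coincide up to a
  -- period. This gives injectivity, and trivial stabilizers give a non-zero derivative.
  have hcurve : IsSimpleClosedCurve w (deriv w) := by
    refine ⟨fun t => ?_, h.continuous_deriv_line hγ, fun t => ?_, fun t => ?_, fun t₁ t₂ h12 => ?_⟩
    · obtain ⟨D, hD, hx, -⟩ := hfree t
      exact (h.hasDerivAt_line (hγ t) hD hx).differentiableAt.hasDerivAt
    · obtain ⟨D, hD, hx, hd, -⟩ := hfree t
      rw [(h.hasDerivAt_line (hγ t) hD hx).deriv]
      exact mul_ne_zero hV hd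
    · simp only [hw, hper t]
    · obtain ⟨g, hg⟩ := (h.fiber _ (hmem t₂) _ (hmem t₁)).1 h12.symm
      exact (h.eq_zero_of_vadd_eq hS hV hper hγ hU hg).2
  obtain ⟨m, hm, hw', hind⟩ := hcurve.exists_winding
  -- R consists of the points of Q off the curve. Those on the curve have κ = 0 and k ∣ α, and so
  -- drop out of both winding counts.
  set R : Finset ℂ := {c ∈ Q | ∀ t, w t ≠ c} with hRdef
  have hRQ : R ⊆ Q := Finset.filter_subset _ _
  have hwR : ∀ t, w t ∉ R := fun t ht => (Finset.mem_filter.1 ht).2 t rfl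
  have hon : ∀ c ∈ Q, c ∉ R → κ c = 0 ∧ (k : ℤ) ∣ α c := by
    intro c hc hcR
    obtain ⟨t, rfl⟩ : ∃ t, w t = c := by
      by_contra! hne
      exact hcR (Finset.mem_filter.2 ⟨hc, hne⟩)
    obtain ⟨-, -, -, -, h1⟩ := hfree t
    exact h1 hc
  have hn : ∀ c, ∃ n : ℤ, c ∈ R → HasWinding (fun t => w t - c) n ∧ (n = m ∨ n = m + 1) := by
    intro c
    by_cases hc : c ∈ R
    · rcases hind c (Finset.mem_filter.1 hc).2 with h1 | h1
      · exact ⟨m, fun _ => ⟨h1, Or.inl rfl⟩⟩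
      · exact ⟨m + 1, fun _ => ⟨h1, Or.inr rfl⟩⟩
    · exact ⟨0, fun h1 => (hc h1).elim⟩
  choose n hn using hn
  have hα : (k : ℤ) ∣ ∑ c ∈ R, α c * n c :=
    h.dvd_sum_of_hasWinding hV hγ hper hRQ (fun c hc hcR => (hon c hc hcR).2)
      fun c hc => (hn c hc).1
  -- The quadratic differential takes the constant value V² on the velocity; at times when w meets Q
  -- this follows by continuity.
  have hconst : ∀ t, C * (∏ c ∈ R, (w t - c) ^ κ c) * deriv w t ^ 2 = V ^ 2 := by
    have h1 : ∀ t, w t ∉ Q → C * (∏ c ∈ R, (w t - c) ^ κ c) * deriv w t ^ 2 = V ^ 2 := by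
      intro t ht
      obtain ⟨D, hD, hx, -⟩ := hfree t
      have h2 := hD.coeff_mul_deriv_sq hS (D.map_source hx) (by rwa [D.left_inv hx])
      rw [D.left_inv hx] at h2
      rw [(h.hasDerivAt_line (hγ t) hD hx).deriv, Finset.prod_subset hRQ fun c hc hcR => by
        rw [(hon c hc hcR).1, zpow_zero]]
      linear_combination V ^ 2 * h2
    have h2 : Continuous fun t => C * (∏ c ∈ R, (w t - c) ^ κ c) * deriv w t ^ 2 := by
      refine Continuous.mul (continuous_const.mul ?_) (hcurve.continuous_deriv.pow 2)
      exact continuous_iff_continuousAt.2 fun t =>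
        continuousAt_prod_zpow hcurve.continuous.continuousAt (hwR t) κ
    intro t
    refine tendsto_nhds_unique ((h2.tendsto t).mono_left (nhdsWithin_le_nhds (s := {t}ᶜ)))
      (tendsto_const_nhds.congr' ?_)
    filter_upwards [h.eventually_notMem_line hV hγ t] with r hr using (h1 r hr).symm
  -- Winding numbers of both sides of `hconst`, the derivative of w winding 2m + 1 times.
  have hκ : ∑ c ∈ R, κ c * n c + 2 * (2 * m + 1) = 0 := by
    have h1 := ((HasWinding.const h.C_ne_zero).mul
      (HasWinding.prod R fun c hc => (hn c hc).1.zpow (κ c))).mul (hw'.pow 2)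
    have h2 := h1.unique ((HasWinding.const (pow_ne_zero 2 hV)).congr hconst)
    push_cast at h2
    linarith
  -- σ = 2m + 1 is the orientation of the curve. The winding numbers are 0 outside and σ inside, so
  -- the enclosed points have total order -2 and total monodromy divisible by k.
  have hJ : ∀ (σ : ℤ), σ ^ 2 = 1 → (∀ c ∈ R, n c = 0 ∨ n c = σ) →
      ∑ c ∈ R, κ c * n c = -2 * σ → False := by
    intro σ hσ hnσ hsum
    have h1 : ∀ β : ℂ → ℤ, ∑ c ∈ R, β c * n c = σ * ∑ c ∈ R with n c ≠ 0, β c := by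
      intro β
      rw [Finset.sum_filter (s := R) (fun c => n c ≠ 0) β, Finset.mul_sum]
      refine Finset.sum_congr rfl fun c hc => ?_
      rcases hnσ c hc with h2 | h2
      · simp [h2]
      · have hσ0 : σ ≠ 0 := by rintro rfl; norm_num at hσ
        rw [h2, if_pos hσ0, mul_comm]
    rw [h1] at hsum hα
    refine h.generator {c ∈ R | n c ≠ 0} ((Finset.filter_subset _ _).trans hRQ) ?_ ?_
    · linear_combination σ * hsum - (∑ c ∈ R with n c ≠ 0, κ c + 2) * hσ
    · have h2 := hα.mul_left σ
      rwa [← mul_assoc, ← sq, hσ, one_mul] at h2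
  rcases hm with rfl | rfl
  · exact hJ 1 (by norm_num) (fun c hc => by simpa using (hn c hc).2) (by linarith)
  · exact hJ (-1) (by norm_num) (fun c hc => by simpa [or_comm] using (hn c hc).2) (by linarith)

/-- Every line segment from a regular point to itself meets the other points of its orbit. -/
theorem exists_vadd_eq_of_isLineSegment {p : X} {T : ℝ} {γ : ℝ → X} (hγ : q.IsLineSegment p p T γ)
    (hp : q.IsRegularPoint p) (hX : ∀ t ∈ Icc 0 T, γ t ∈ X₀) :
    ∃ t ∈ Icc 0 T, (∃ g : ZMod k, g +ᵥ p = γ t) ∧ γ t ≠ p := by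
  obtain ⟨S, ε, hS⟩ := h.exists_isSqrtCoeff
  by_contra! hcon
  have hpX : p ∈ X₀ := hγ.source ▸ hX 0 ⟨le_rfl, hγ.pos.le⟩
  obtain ⟨V, γ', hV, hper, hline, hU⟩ := h.exists_closed_line hS hγ hp hX fun t ht hUt =>
    hcon t ht ((h.fiber _ hpX _ (hX t ht)).1 hUt.symm)
  exact h.false_of_closed_line hS hV hper hline hU

end FlatCover

end

/-! ### A coordinate of the sphere with pole at a given finite point -/

namespace RiemannSphere

/-- The coordinate `1 / (w - w₀)` of the Riemann sphere. -/
noncomputable def coordAway (w₀ : ℂ) : OnePoint ℂ → ℂ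
  | OnePoint.infty => 0
  | OnePoint.some w => (w - w₀)⁻¹

variable {w₀ : ℂ}

@[simp] theorem coordAway_infty : coordAway w₀ OnePoint.infty = 0 := rfl

@[simp] theorem coordAway_coe (w : ℂ) : coordAway w₀ (w : OnePoint ℂ) = (w - w₀)⁻¹ := rfl

theorem coordAway_eq_zero_iff {x : OnePoint ℂ} (hx : x ≠ w₀) :
    coordAway w₀ x = 0 ↔ x = OnePoint.infty := by
  induction x using OnePoint.rec with
  | infty => simp
  | coe w =>
    have hw : w - w₀ ≠ 0 := sub_ne_zero.2 fun h => hx (by rw [h])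
    simp [hw]

theorem coordAway_eq_iff {x : OnePoint ℂ} {u : ℂ} (hu : u ≠ 0) :
    coordAway w₀ x = u ↔ x = ((w₀ + u⁻¹ : ℂ) : OnePoint ℂ) := by
  induction x using OnePoint.rec with
  | infty => simpa using hu.symm
  | coe w =>
    rw [coordAway_coe, OnePoint.coe_eq_coe, inv_eq_iff_eq_inv, sub_eq_iff_eq_add']

theorem coordAway_injOn : InjOn (coordAway w₀) {(w₀ : OnePoint ℂ)}ᶜ := by
  intro x hx y hy hxy
  by_cases hy0 : coordAway w₀ y = 0
  · rw [(coordAway_eq_zero_iff hy).1 hy0]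
    exact (coordAway_eq_zero_iff hx).1 (hxy.trans hy0)
  · rw [(coordAway_eq_iff hy0).1 rfl]
    exact (coordAway_eq_iff hy0).1 hxy

theorem mdifferentiableAt_affineChart {x : OnePoint ℂ} (hx : x ≠ OnePoint.infty) :
    MDifferentiableAt 𝓘(ℂ) 𝓘(ℂ) affineChart x := by
  refine mdifferentiableAt_of_mem_maximalAtlas
    (IsManifold.maximalAtlas_subset_of_le (by simp) mem_maximalAtlas_affineChart) ?_
  rw [affineChart_source]
  exact OnePoint.ne_infty_iff_exists.1 hx

theorem mdifferentiableAt_coordAway {x : OnePoint ℂ} (hx : x ≠ w₀) :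
    MDifferentiableAt 𝓘(ℂ) 𝓘(ℂ) (coordAway w₀) x := by
  induction x using OnePoint.rec with
  | infty =>
    have hd : DifferentiableAt ℂ (fun u : ℂ => u / (1 - w₀ * u)) (inftyChart OnePoint.infty) := by
      have h0 : inftyChart OnePoint.infty = 0 := by
        rw [inftyChart_apply, inv_infty, affineChart_coe]
      rw [h0]
      exact differentiableAt_id.div (by fun_prop) (by simp)
    have hc : MDifferentiableAt 𝓘(ℂ) 𝓘(ℂ) inftyChart OnePoint.infty := by
      refine mdifferentiableAt_of_mem_maximalAtlas
        (IsManifold.maximalAtlas_subset_of_le (by simp) mem_maximalAtlas_inftyChart) ?_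
      rw [← chartAt_infty]
      exact mem_chart_source _ _
    refine (hd.mdifferentiableAt.comp OnePoint.infty hc).congr_of_eventuallyEq ?_
    have hne : ∀ᶠ x : OnePoint ℂ in 𝓝 OnePoint.infty, x ≠ ((0 : ℂ) : OnePoint ℂ) :=
      isOpen_ne.mem_nhds (OnePoint.infty_ne_coe 0)
    filter_upwards [hne] with x hx0
    induction x using OnePoint.rec with
    | infty => simp [inftyChart_apply, affineChart_coe]
    | coe w =>
      have hw : w ≠ 0 := fun h => hx0 (by rw [h])
      rw [Function.comp_apply, inftyChart_apply, inv_coe hw, affineChart_coe, coordAway_coe]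
      field_simp
  | coe w =>
    have hw : w - w₀ ≠ 0 := sub_ne_zero.2 fun h => hx (by rw [h])
    have hd : DifferentiableAt ℂ (fun w : ℂ => (w - w₀)⁻¹) (affineChart (w : OnePoint ℂ)) := by
      rw [affineChart_coe]
      exact (differentiableAt_id.sub_const w₀).inv hw
    refine (hd.mdifferentiableAt.comp (w : OnePoint ℂ)
      (mdifferentiableAt_affineChart (OnePoint.coe_ne_infty w))).congr_of_eventuallyEq ?_
    filter_upwards [isOpen_ne.mem_nhds (OnePoint.coe_ne_infty w)] with x hx
    obtain ⟨v, rfl⟩ := OnePoint.ne_infty_iff_exists.1 hx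
    rw [Function.comp_apply, affineChart_coe, coordAway_coe]

end RiemannSphere

/-- The points of the divisor `∑ c ∈ P, A c • c` in the coordinate `1 / (w - w₀)`. -/
noncomputable def awayPoints (w₀ : ℂ) (P : Finset ℂ) : Finset ℂ :=
  insert 0 (P.image fun c => (c - w₀)⁻¹)

/-- The orders of the divisor `∑ c ∈ P, A c • c` in the coordinate `1 / (w - w₀)`, with an order
at infinity that makes the degree equal to `d`. -/
noncomputable def awayOrder (w₀ : ℂ) (P : Finset ℂ) (d : ℤ) (A : ℂ → ℤ) (u : ℂ) : ℤ :=
  if u = 0 then d - ∑ c ∈ P, A c else A (w₀ + u⁻¹)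

section

variable {w₀ : ℂ} {P : Finset ℂ} {d : ℤ} {A : ℂ → ℤ}

theorem awayOrder_inv_sub {c : ℂ} (hc : c ≠ w₀) : awayOrder w₀ P d A (c - w₀)⁻¹ = A c := by
  rw [awayOrder, if_neg (inv_ne_zero (sub_ne_zero.2 hc)), _root_.inv_inv, add_sub_cancel]

theorem mem_awayPoints {c : ℂ} (hc : c ∈ P) : (c - w₀)⁻¹ ∈ awayPoints w₀ P :=
  Finset.mem_insert_of_mem (Finset.mem_image_of_mem _ hc)

/-- Each factor satisfies (w - w₀)⁻¹ - (c - w₀)⁻¹ = (w - c) / ((w₀ - c)(w - w₀)); the leftover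
powers of (w - w₀)⁻¹ collect at the new point 0, the image of ∞. It is used with d = -4 for the
differential and d = 0 for the root. -/
theorem exists_prod_away (hP : w₀ ∉ P) (d : ℤ) (A : ℂ → ℤ) : ∃ C ≠ 0, ∀ w, w ≠ w₀ → w ∉ P →
    (∏ c ∈ P, (w - c) ^ A c) * (w - w₀)⁻¹ ^ d =
      C * ∏ c ∈ awayPoints w₀ P, ((w - w₀)⁻¹ - c) ^ awayOrder w₀ P d A c := by
  have hne : ∀ c ∈ P, c - w₀ ≠ 0 := fun c hc => sub_ne_zero.2 fun h => hP (h ▸ hc)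
  refine ⟨∏ c ∈ P, (w₀ - c) ^ A c, prod_zpow_ne_zero A hP, fun w hw hwP => ?_⟩
  have hw0 : w - w₀ ≠ 0 := sub_ne_zero.2 hw
  have h0 : (0 : ℂ) ∉ P.image fun c => (c - w₀)⁻¹ := by
    simp only [Finset.mem_image, inv_eq_zero, not_exists, not_and]
    exact hne
  rw [awayPoints, Finset.prod_insert h0, Finset.prod_image (by
    intro c _ c' _ h
    simpa using h)]
  have h1 : ∏ c ∈ P, ((w - w₀)⁻¹ - (c - w₀)⁻¹) ^ awayOrder w₀ P d A (c - w₀)⁻¹ =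
      ∏ c ∈ P, ((w - c) ^ A c * ((w₀ - c) ^ A c)⁻¹ * (w - w₀)⁻¹ ^ A c) := by
    refine Finset.prod_congr rfl fun c hc => ?_
    rw [awayOrder_inv_sub (sub_ne_zero.1 (hne c hc)), ← inv_zpow, ← mul_zpow, ← mul_zpow]
    congr 1
    have := hne c hc
    have h2 : w₀ - c ≠ 0 := by rw [← neg_sub]; exact neg_ne_zero.2 this
    field_simp
    ring
  rw [h1, Finset.prod_mul_distrib, Finset.prod_mul_distrib, Finset.prod_inv_distrib,
    prod_zpow_eq_zpow_sum (inv_ne_zero hw0), awayOrder, if_pos rfl, sub_zero,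
    zpow_sub₀ (inv_ne_zero hw0)]
  have h2 := prod_zpow_ne_zero A hP
  have h3 : (w - w₀)⁻¹ ^ ∑ c ∈ P, A c ≠ 0 := zpow_ne_zero _ (inv_ne_zero hw0)
  field_simp

end

open RiemannSphere in
/-- A line segment on a cover of the sphere does not fill the sphere. -/
theorem QuadDiff.IsLineSegment.exists_notMem {X : Type*} [TopologicalSpace X] [ChartedSpace ℂ X]
    [IsManifold 𝓘(ℂ) ω X] {q : QuadDiff X} {p p' : X} {T : ℝ} {γ : ℝ → X}
    (hγ : q.IsLineSegment p p' T γ) {π : X → OnePoint ℂ} (hπ : MDifferentiable 𝓘(ℂ) 𝓘(ℂ) π)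
    (P : Set ℂ) (hP : P.Finite) : ∃ w ∉ P, ∀ t ∈ Icc 0 T, π (γ t) ≠ (w : OnePoint ℂ) := by
  set s : Set ℝ := {t ∈ Ioo 0 T | π (γ t) ≠ OnePoint.infty} with hs
  set f : ℝ → ℂ := fun t => affineChart (π (γ t)) with hf
  have hlip : ∀ t ∈ s, ∃ K, ∃ v ∈ 𝓝[s] t, LipschitzOnWith K f v := by
    rintro t ⟨ht, htπ⟩
    obtain ⟨e, he, hx, v, -, hline⟩ := hγ.straight t ht
    have hζ := e.map_source hx
    have hopen : IsOpen (e.target ∩ e.symm ⁻¹' (π ⁻¹' {OnePoint.infty}ᶜ)) :=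
      e.isOpen_inter_preimage_symm (isOpen_compl_singleton.preimage hπ.continuous)
    have hmem : e (γ t) ∈ e.target ∩ e.symm ⁻¹' (π ⁻¹' {OnePoint.infty}ᶜ) :=
      ⟨hζ, by simpa [e.left_inv hx] using htπ⟩
    have hd : DifferentiableOn ℂ (affineChart ∘ π ∘ e.symm)
        (e.target ∩ e.symm ⁻¹' (π ⁻¹' {OnePoint.infty}ᶜ)) := fun ζ hζ' =>
      ((mdifferentiableAt_affineChart hζ'.2).comp ζ ((hπ _).comp ζ
        (he.mdifferentiableAt_symm hζ'.1))).differentiableAt.differentiableWithinAt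
    have h1 : ContDiffAt ℝ 1 (affineChart ∘ π ∘ e.symm) (e (γ t)) :=
      ((hd.analyticAt (hopen.mem_nhds hmem)).contDiffAt).restrict_scalars ℝ
    have h2 : ContDiffAt ℝ 1 (fun r : ℝ => e (γ t) + ((r - t : ℝ) : ℂ) * v) t := by
      refine contDiffAt_const.add (ContDiffAt.mul ?_ contDiffAt_const)
      exact (Complex.ofRealCLM.contDiff.contDiffAt).comp t (contDiffAt_id.sub contDiffAt_const)
    have h3 : ContDiffAt ℝ 1 f t := by
      refine (ContDiffAt.comp (g := affineChart ∘ π ∘ e.symm) t (by simpa using h1)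
        h2).congr_of_eventuallyEq ?_
      have hc : ContinuousAt γ t := hγ.continuousOn.continuousAt (Icc_mem_nhds ht.1 ht.2)
      filter_upwards [hline, hc.eventually_mem (e.open_source.mem_nhds hx)] with r hr hre
      simp only [hf, Function.comp_apply]
      rw [← hr, e.left_inv hre]
    obtain ⟨K, v, hv, hK⟩ := h3.exists_lipschitzOnWith
    exact ⟨K, v, nhdsWithin_le_nhds hv, hK⟩
  -- Away from the endpoints and ∞ the projected path is locally Lipschitz, so its image has
  -- Hausdorff dimension at most 1 and a dense complement in the plane.
  have hdim : dimH (f '' s) < Module.finrank ℝ ℂ := by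
    have h1 : dimH (f '' s) ≤ dimH (univ : Set ℝ) :=
      (dimH_image_le_of_locally_lipschitzOn hlip).trans (dimH_mono (subset_univ _))
    rw [Real.dimH_univ] at h1
    refine h1.trans_lt ?_
    rw [Complex.finrank_real_complex]
    norm_num
  have hfin : (P ∪ {affineChart (π (γ 0)), affineChart (π (γ T))}).Finite := hP.union (by simp)
  obtain ⟨w, hw1, hw2⟩ := ((dense_compl_of_dimH_lt_finrank hdim).sdiff_finite hfin).nonempty
  refine ⟨w, fun h => hw2 (Or.inl h), fun t ht h => ?_⟩
  have hw : affineChart (π (γ t)) = w := by rw [h, affineChart_coe]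
  rcases ht.1.eq_or_lt with rfl | h0
  · exact hw2 (Or.inr (by simp [hw]))
  rcases ht.2.eq_or_lt with rfl | hT
  · exact hw2 (Or.inr (by simp [hw]))
  · exact hw1 ⟨t, ⟨⟨h0, hT⟩, by rw [h]; exact OnePoint.coe_ne_infty w⟩, hw⟩

/-! ### Cyclic covers of the sphere as flat covers -/

open RiemannSphere in
-- With U = (w - w₀)⁻¹ one has dw² = U⁻⁴ dU², so the exponent -4 in `hC₁` turns the formula for q in
-- w into one in U.
theorem QuadDiff.eventually_eq_one_of_isNaturalChart {X : Type*} [TopologicalSpace X]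
    [ChartedSpace ℂ X] [IsManifold 𝓘(ℂ) ω X] {q : QuadDiff (OnePoint ℂ)} {π : X → OnePoint ℂ}
    (hπ : MDifferentiable 𝓘(ℂ) 𝓘(ℂ) π) {P : Finset ℂ} {K : ℂ → ℤ} {C C₁ w₀ : ℂ}
    (hC : ∀ w ∉ P, q.coeff affineChart w = C * ∏ c ∈ P, (w - c) ^ K c)
    (hC₁ : ∀ w, w ≠ w₀ → w ∉ P → (∏ c ∈ P, (w - c) ^ K c) * (w - w₀)⁻¹ ^ (-4 : ℤ) =
      C₁ * ∏ c ∈ awayPoints w₀ P, ((w - w₀)⁻¹ - c) ^ awayOrder w₀ P (-4) K c)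
    {e : OpenPartialHomeomorph X ℂ} (he : (q.pullback π).IsNaturalChart e) {ζ : ℂ}
    (hζ : ζ ∈ e.target) (hw₀ : π (e.symm ζ) ≠ w₀) :
    ∀ᶠ ζ' in 𝓝[≠] ζ, coordAway w₀ (π (e.symm ζ')) ∉ awayPoints w₀ P ∧
      C * C₁ * (∏ c ∈ awayPoints w₀ P, (coordAway w₀ (π (e.symm ζ')) - c) ^
        awayOrder w₀ P (-4) K c) * deriv ((coordAway w₀ ∘ π) ∘ e.symm) ζ' ^ 2 = 1 := by
  have hWo : IsOpen (e.target ∩ e.symm ⁻¹' (π ⁻¹' {(w₀ : OnePoint ℂ)}ᶜ)) :=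
    e.isOpen_inter_preimage_symm (isOpen_compl_singleton.preimage hπ.continuous)
  have hWζ : ∀ᶠ ζ' in 𝓝 ζ, ζ' ∈ e.target ∧ π (e.symm ζ') ≠ w₀ := hWo.mem_nhds ⟨hζ, hw₀⟩
  have hπe : ∀ ζ' ∈ e.target, MDifferentiableAt 𝓘(ℂ) 𝓘(ℂ) (π ∘ e.symm) ζ' := fun ζ' hζ' =>
    (hπ _).comp ζ' (he.mdifferentiableAt_symm hζ')
  have hd : DifferentiableOn ℂ ((coordAway w₀ ∘ π) ∘ e.symm)
      (e.target ∩ e.symm ⁻¹' (π ⁻¹' {(w₀ : OnePoint ℂ)}ᶜ)) := fun ζ' hζ' =>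
    ((mdifferentiableAt_coordAway hζ'.2).comp ζ'
      (hπe ζ' hζ'.1)).differentiableAt.differentiableWithinAt
  have han := hd.analyticAt (hWo.mem_nhds ⟨hζ, hw₀⟩)
  have hcoeff : ∀ᶠ ζ' in 𝓝[≠] ζ, (q.pullback π).coeff e ζ' = 1 := he.2 ζ hζ
  -- An analytic function either avoids c near ζ or is constant there. In the second case π would be
  -- locally constant and the pull-back would vanish, whereas its coefficient is 1.
  have hQ : ∀ c ∈ awayPoints w₀ P, ∀ᶠ ζ' in 𝓝[≠] ζ, coordAway w₀ (π (e.symm ζ')) ≠ c := by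
    intro c _
    refine (han.eventually_eq_or_eventually_ne analyticAt_const).resolve_left fun hc => ?_
    have hconst : ∀ᶠ ζ' in 𝓝 ζ, (π ∘ e.symm) ζ' = π (e.symm ζ) := by
      filter_upwards [hc, hWζ] with ζ' h1 h2
      exact coordAway_injOn h2.2 hw₀ (h1.trans hc.self_of_nhds.symm)
    obtain ⟨ζ', h1, h2, h3⟩ := (hcoeff.and (nhdsWithin_le_nhds
      (hconst.eventually_nhds.and hWζ))).exists
    refine one_ne_zero (h1.symm.trans (q.pullback_coeff_eq_zero ?_))
    have h4 : π ∘ e.symm =ᶠ[𝓝 ζ'] fun _ => π (e.symm ζ) := h2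
    have h5 := mfderiv_comp_apply ζ' (hπ (e.symm ζ')) (he.mdifferentiableAt_symm h3.1) (1 : ℂ)
    refine h5.symm.trans ?_
    have h6 : (mfderiv 𝓘(ℂ) 𝓘(ℂ) (π ∘ e.symm) ζ' (1 : ℂ) : ℂ) =
        mfderiv 𝓘(ℂ) 𝓘(ℂ) (fun _ : ℂ => π (e.symm ζ)) ζ' (1 : ℂ) := by
      rw [h4.mfderiv_eq]; rfl
    refine h6.trans ?_
    rw [mfderiv_const]
    rfl
  filter_upwards [hcoeff, nhdsWithin_le_nhds hWζ, (Finset.eventually_all _).2 hQ]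
    with ζ' h1 h2 h3
  have hQ' : coordAway w₀ (π (e.symm ζ')) ∉ awayPoints w₀ P := fun h4 => h3 _ h4 rfl
  refine ⟨hQ', ?_⟩
  have hinf : π (e.symm ζ') ≠ OnePoint.infty := by
    intro h4
    rw [h4, coordAway_infty] at hQ'
    exact hQ' (Finset.mem_insert_self _ _)
  set ψ : ℂ → ℂ := affineChart ∘ π ∘ e.symm with hψdef
  have hnear : ∀ᶠ v in 𝓝 ζ', π (e.symm v) ≠ OnePoint.infty :=
    (hπe ζ' h2.1).continuousAt.eventually_mem (isOpen_compl_singleton.mem_nhds hinf)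
  have hψ : ∀ v, π (e.symm v) ≠ OnePoint.infty → π (e.symm v) = (ψ v : OnePoint ℂ) := by
    intro v hv
    obtain ⟨w, hw⟩ := OnePoint.ne_infty_iff_exists.1 hv
    simp only [hψdef, Function.comp_apply]
    rw [← hw, affineChart_coe]
  have hψd : DifferentiableAt ℂ ψ ζ' :=
    ((mdifferentiableAt_affineChart hinf).comp ζ' (hπe ζ' h2.1)).differentiableAt
  have hψ0 : ψ ζ' ≠ w₀ := fun h4 => h2.2 (by rw [hψ _ hinf, h4])
  have hψP : ψ ζ' ∉ P := fun h4 => hQ' (by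
    rw [hψ _ hinf, coordAway_coe]
    exact mem_awayPoints h4)
  have e1 := q.pullback_coeff (hπ (e.symm ζ')) (he.mdifferentiableAt_symm h2.1)
    (mdifferentiableAt_affineChart_symm (ψ ζ')) (hnear.mono fun v hv => hψ v hv) hψd
  rw [h1, hC _ hψP] at e1
  have e2 : (coordAway w₀ ∘ π) ∘ e.symm =ᶠ[𝓝 ζ'] fun v => (ψ v - w₀)⁻¹ := by
    filter_upwards [hnear] with v hv
    simp only [Function.comp_apply]
    rw [hψ v hv, coordAway_coe]
  have hne : ψ ζ' - w₀ ≠ 0 := sub_ne_zero.2 hψ0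
  have e3 : deriv (fun v => (ψ v - w₀)⁻¹) ζ' = -deriv ψ ζ' / (ψ ζ' - w₀) ^ 2 :=
    ((hψd.hasDerivAt.sub_const w₀).inv hne).deriv
  have e4 := hC₁ _ hψ0 hψP
  rw [hψ _ hinf, coordAway_coe, mul_assoc C C₁, ← e4, e2.deriv_eq, e3, e1, inv_zpow', neg_neg]
  norm_cast
  field_simp

open Classical in
theorem sum_eq_sum_filter_ne_infty {s : ℕ} {z : Fin s → OnePoint ℂ} (hz : Function.Injective z)
    {P : Finset ℂ} (hP : ∀ c : ℂ, (c : OnePoint ℂ) ∈ range z ↔ c ∈ P) {M : Type*} [AddCommMonoid M]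
    {B : ℂ → M} {b : Fin s → M} (hB : ∀ i, ∀ c : ℂ, z i = c → B c = b i) :
    ∑ c ∈ P, B c = ∑ i with z i ≠ OnePoint.infty, b i := by
  have hval : ∀ i, z i ≠ OnePoint.infty → z i = (RiemannSphere.affineChart (z i) : ℂ) := by
    intro i hi
    obtain ⟨w, hw⟩ := OnePoint.ne_infty_iff_exists.1 hi
    rw [← hw, RiemannSphere.affineChart_coe]
  symm
  refine Finset.sum_nbij (fun i => RiemannSphere.affineChart (z i)) ?_ ?_ ?_ ?_
  · intro i hi
    rw [Finset.mem_filter] at hi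
    exact (hP _).1 ⟨i, hval i hi.2⟩
  · intro i hi j hj hij
    simp only [Finset.coe_filter, Finset.mem_univ, true_and, mem_ofPred_eq] at hi hj
    exact hz ((hval i hi).trans ((congrArg _ hij).trans (hval j hj).symm))
  · intro c hc
    obtain ⟨i, hi⟩ := (hP c).2 hc
    exact ⟨i, by simp [hi], by simp only [hi, RiemannSphere.affineChart_coe]⟩
  · intro i hi
    rw [Finset.mem_filter] at hi
    exact (hB i _ (hval i hi.2)).symm

section

variable {s : ℕ} {z : Fin s → OnePoint ℂ} (hz : Function.Injective z) {w₀ : ℂ}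
  (hw₀ : (w₀ : OnePoint ℂ) ∉ range z) {P : Finset ℂ}
  (hP : ∀ c : ℂ, (c : OnePoint ℂ) ∈ range z ↔ c ∈ P)
include hz hP

theorem QuadDiff.HasDivisor.exists_coeff_eq {q : QuadDiff (OnePoint ℂ)} {κ : Fin s → ℤ}
    (hq : q.HasDivisor z κ) (hκ : ∑ i, κ i = -4) {K : ℂ → ℤ}
    (hK : ∀ i, ∀ c : ℂ, z i = c → K c = κ i) :
    ∃ C ≠ 0, ∀ w ∉ P, q.coeff RiemannSphere.affineChart w = C * ∏ c ∈ P, (w - c) ^ K c := by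
  classical
  have hinf : chartAt ℂ (OnePoint.infty : OnePoint ℂ) OnePoint.infty = 0 := by
    rw [chartAt_infty, RiemannSphere.inftyChart_apply, RiemannSphere.inv_infty,
      RiemannSphere.affineChart_coe]
  have hcoe : ∀ c : ℂ, chartAt ℂ (c : OnePoint ℂ) (c : OnePoint ℂ) = c := fun c => by
    rw [chartAt_coe, RiemannSphere.affineChart_coe]
  have hdeg : -4 - ∑ c ∈ P, K c = ∑ i with z i = OnePoint.infty, κ i := by
    rw [sum_eq_sum_filter_ne_infty hz hP hK, ← hκ, sub_eq_iff_eq_add]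
    exact (Finset.sum_filter_add_sum_filter_not _ _ _).symm
  have hg : MeromorphicAt (q.coeff RiemannSphere.inftyChart) 0 ∧
      meromorphicOrderAt (q.coeff RiemannSphere.inftyChart) 0 =
        ((-4 - ∑ c ∈ P, K c : ℤ) : WithTop ℤ) := by
    rw [hdeg]
    by_cases h : OnePoint.infty ∈ range z
    · obtain ⟨i, hi⟩ := h
      have h1 := hq.meromorphicAt i
      have h2 := hq.order_eq i
      rw [hi, hinf, chartAt_infty] at h1 h2
      refine ⟨h1, h2.trans ?_⟩
      have h3 : (Finset.univ.filter fun j => z j = OnePoint.infty) = {i} := by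
        ext j
        simp [← hi, hz.eq_iff]
      rw [h3, Finset.sum_singleton]
    · have h1 := hq.analyticAt _ h
      have h2 := hq.ne_zero _ h
      rw [hinf, chartAt_infty] at h1 h2
      refine ⟨h1.meromorphicAt, (meromorphicOrderAt_eq_int_iff h1.meromorphicAt).2
        ⟨_, h1, h2, Eventually.of_forall fun u => ?_⟩⟩
      have h3 : (Finset.univ.filter fun j => z j = OnePoint.infty) = ∅ := by
        ext j
        simpa using fun h4 => h ⟨j, h4⟩
      simp [h3]
  refine exists_eq_const_mul_prod (fun w hw => ?_) (fun c hc => ?_) (fun c hc => ?_) hg.1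
    (fun u hu => coeff_inftyChart q hu) hg.2
  · have h1 := hq.analyticAt (w : OnePoint ℂ) fun h2 => hw ((hP w).1 h2)
    rwa [hcoe, chartAt_coe] at h1
  · obtain ⟨i, hi⟩ := (hP c).2 hc
    have h1 := hq.meromorphicAt i
    rwa [hi, hcoe, chartAt_coe] at h1
  · obtain ⟨i, hi⟩ := (hP c).2 hc
    have h1 := hq.order_eq i
    rwa [hi, hcoe, chartAt_coe, ← hK i c hi] at h1

include hw₀

open RiemannSphere in
-- The fibre sum treats all points alike: over u = 0 it is the order at ∞, or 0 if ∞ is not among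
-- the `z i`, because the total degree is d. It is applied over ℤ to κ and over ℤ/2ℓ to a.
theorem awayOrder_eq_sum {M : Type*} [Ring M] {b : Fin s → M} {d : ℤ} {B : ℂ → ℤ}
    (hd : (d : M) = ∑ i, b i) (hB : ∀ i, ∀ c : ℂ, z i = c → (B c : M) = b i) {u : ℂ}
    (hu : u ∈ awayPoints w₀ P) :
    (awayOrder w₀ P d B u : M) = ∑ i with coordAway w₀ (z i) = u, b i := by
  classical
  have hzw : ∀ i, z i ≠ w₀ := fun i h => hw₀ ⟨i, h⟩
  rcases Finset.mem_insert.1 hu with rfl | hu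
  · have h1 := sum_eq_sum_filter_ne_infty hz hP (B := fun c => (B c : M)) hB
    rw [awayOrder, if_pos rfl, Int.cast_sub, Int.cast_sum, h1, hd, sub_eq_iff_eq_add]
    simp only [coordAway_eq_zero_iff (hzw _)]
    exact (Finset.sum_filter_add_sum_filter_not _ _ _).symm
  · obtain ⟨c, hc, rfl⟩ := Finset.mem_image.1 hu
    obtain ⟨i, hi⟩ := (hP c).2 hc
    have hcw : c ≠ w₀ := fun h => hzw i (by rw [hi, h])
    rw [awayOrder_inv_sub hcw, hB i c hi]
    have h3 : (Finset.univ.filter fun j => coordAway w₀ (z j) = (c - w₀)⁻¹) = {i} := by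
      ext j
      simp only [Finset.mem_filter, Finset.mem_univ, true_and, Finset.mem_singleton]
      rw [coordAway_eq_iff (inv_ne_zero (sub_ne_zero.2 hcw)), _root_.inv_inv, add_sub_cancel, ← hi,
        hz.eq_iff]
    rw [h3, Finset.sum_singleton]

open RiemannSphere in
theorem sum_awayOrder_eq_sum {M : Type*} [Ring M] {b : Fin s → M} {d : ℤ} {B : ℂ → ℤ}
    (hd : (d : M) = ∑ i, b i) (hB : ∀ i, ∀ c : ℂ, z i = c → (B c : M) = b i) {J : Finset ℂ}
    (hJ : J ⊆ awayPoints w₀ P) :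
    ((∑ u ∈ J, awayOrder w₀ P d B u : ℤ) : M) = ∑ i with coordAway w₀ (z i) ∈ J, b i := by
  rw [Int.cast_sum, Finset.sum_congr rfl fun u hu => awayOrder_eq_sum hz hw₀ hP hd hB (hJ hu),
    ← Finset.sum_fiberwise_of_maps_to (t := J) (g := fun i => coordAway w₀ (z i))
      fun i hi => (Finset.mem_filter.1 hi).2]
  refine Finset.sum_congr rfl fun u hu => ?_
  rw [Finset.filter_filter]
  refine Finset.sum_congr (Finset.filter_congr fun i _ => ?_) fun _ _ => rfl
  exact ⟨fun h => ⟨h ▸ hu, h⟩, fun h => h.2⟩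

end

theorem even_intCast_zmod_iff {ℓ : ℕ} (A : ℤ) : Even (A : ZMod (2 * ℓ)) ↔ Even A := by
  refine ⟨fun ⟨r, hr⟩ => ?_, fun h => h.intCast⟩
  obtain ⟨m, rfl⟩ := ZMod.intCast_surjective r
  have h1 : ((A - (m + m) : ℤ) : ZMod (2 * ℓ)) = 0 := by
    push_cast
    rw [hr, sub_self]
  rw [ZMod.intCast_zmod_eq_zero_iff_dvd] at h1
  have h2 : (2 : ℤ) ∣ A - (m + m) := (Dvd.intro _ (by push_cast; rfl)).trans h1
  rw [even_iff_two_dvd]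
  omega

open RiemannSphere in
/-- A cyclic cover branched over a generalized Eierlegende-Wollmilchsau is a flat cover. -/
theorem IsCyclicCover.exists_flatCover {ℓ s : ℕ} {κ : Fin s → ℤ} {a : Fin s → ZMod (2 * ℓ)}
    [NeZero (2 * ℓ)] (hE : IsGeneralizedEW ℓ κ a) {q : QuadDiff (OnePoint ℂ)}
    {z : Fin s → OnePoint ℂ} (hq : q.HasDivisor z κ) {X : Type*} [TopologicalSpace X]
    [ChartedSpace ℂ X] [IsManifold 𝓘(ℂ) ω X] [AddAction (ZMod (2 * ℓ)) X] {π : X → OnePoint ℂ}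
    (hπ : IsCyclicCover (2 * ℓ) a z π) {w₀ : ℂ} (hw₀ : (w₀ : OnePoint ℂ) ∉ range z) :
    ∃ Q K A F C C', FlatCover (2 * ℓ) (q.pullback π) (π ⁻¹' {(w₀ : OnePoint ℂ)}ᶜ) Q K A
      (coordAway w₀ ∘ π) F C C' := by
  have hz := hq.injective
  obtain ⟨P, hP⟩ : ∃ P : Finset ℂ, ∀ c : ℂ, (c : OnePoint ℂ) ∈ range z ↔ c ∈ P :=
    ⟨((finite_range z).preimage OnePoint.coe_injective.injOn).toFinset, fun c => by simp⟩
  obtain ⟨K, hK⟩ : ∃ K : ℂ → ℤ, ∀ i, ∀ c : ℂ, z i = c → K c = κ i :=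
    ⟨fun c => Function.extend z κ 0 c, fun i c hi => by
      beta_reduce
      rw [← hi, hz.extend_apply]⟩
  -- A lifts the monodromies to integers, which is what exponents require.
  obtain ⟨A, hA⟩ : ∃ A : ℂ → ℤ, ∀ i, ∀ c : ℂ, z i = c → (A c : ZMod (2 * ℓ)) = a i :=
    ⟨fun c => Function.extend z (fun i => ((a i).val : ℤ)) 0 c, fun i c hi => by
      beta_reduce
      rw [← hi, hz.extend_apply]
      simp⟩
  have hw₀P : w₀ ∉ P := fun h => hw₀ ((hP w₀).2 h)
  obtain ⟨C, hC0, hC⟩ := hq.exists_coeff_eq hz hP hE.sum_order hK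
  obtain ⟨C₁, hC₁0, hC₁⟩ := exists_prod_away hw₀P (-4) K
  obtain ⟨C', hC'0, hC'⟩ := exists_prod_away hw₀P 0 A
  obtain ⟨F, hF⟩ := hπ.exists_kummer hP hA
  have hinv : ∀ (g : ZMod (2 * ℓ)) (x : X), π (g +ᵥ x) = π x := fun g x =>
    ((hπ.fiber x _).2 ⟨g, rfl⟩).symm
  have hcoe : ∀ x ∈ π ⁻¹' {(w₀ : OnePoint ℂ)}ᶜ, coordAway w₀ (π x) ∉ awayPoints w₀ P →
      ∃ w : ℂ, w ≠ w₀ ∧ w ∉ P ∧ π x = w ∧ coordAway w₀ (π x) = (w - w₀)⁻¹ := by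
    intro x hx hxQ
    have hinf : π x ≠ OnePoint.infty := by
      intro h
      rw [h, coordAway_infty] at hxQ
      exact hxQ (Finset.mem_insert_self _ _)
    obtain ⟨w, hw⟩ := OnePoint.ne_infty_iff_exists.1 hinf
    refine ⟨w, fun h => hx (by rw [← hw, h]; rfl), fun h => hxQ ?_, hw.symm, by
      rw [← hw, coordAway_coe]⟩
    rw [← hw, coordAway_coe]
    exact mem_awayPoints h
  have hcong : ∀ i, ∀ c : ℂ, z i = c → Even (K c - A c) := by
    intro i c hi
    rw [Int.even_sub, hK i c hi, hE.parity i, ← hA i c hi]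
    exact even_intCast_zmod_iff _
  refine ⟨awayPoints w₀ P, awayOrder w₀ P (-4) K, awayOrder w₀ P 0 A, F, C * C₁, C', ?_, ?_, ?_,
    ?_, ?_, ?_, hπ.holomorphic_vadd, ?_, ?_, ?_, mul_ne_zero hC0 hC₁0, hC'0, ?_, ?_, ?_⟩
  · exact even_two_mul ℓ
  · exact isOpen_compl_singleton.preimage hπ.holomorphic.continuous
  · exact fun x hx => (mdifferentiableAt_coordAway hx).comp x (hπ.holomorphic x)
  · intro g x hx
    rwa [mem_preimage, hinv]
  · exact fun x hx y hy => (coordAway_injOn.eq_iff hx hy).trans (hπ.fiber x y)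
  · intro g x hx hxQ
    obtain ⟨w, -, hwP, hw, -⟩ := hcoe x hx hxQ
    exact hπ.free g x (by rwa [hw, hP])
  · intro x hx hxQ
    obtain ⟨w, -, hwP, hw, -⟩ := hcoe x hx hxQ
    exact hF.continuousAt x w hwP hw
  · intro x hx hxQ
    obtain ⟨w, hww₀, hwP, hw, hU⟩ := hcoe x hx hxQ
    have h1 := hC' w hww₀ hwP
    rw [zpow_zero, mul_one] at h1
    rw [hF.pow_eq x w hwP hw, h1, Function.comp_apply, hU]
  · intro g x hx hxQ
    obtain ⟨w, -, hwP, hw, -⟩ := hcoe x hx hxQ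
    exact hF.vadd g x w hwP hw
  · exact fun e he ζ hζ hw =>
      QuadDiff.eventually_eq_one_of_isNaturalChart hπ.holomorphic hC hC₁ he hζ hw
  · intro u hu
    rw [← Int.even_sub]
    -- At the image of ∞ the parities agree because the degrees -4 and 0 are even and the other
    -- points match.
    rcases Finset.mem_insert.1 hu with rfl | hu
    · rw [awayOrder, awayOrder, if_pos rfl, if_pos rfl,
        show -4 - ∑ c ∈ P, K c - (0 - ∑ c ∈ P, A c) = -4 - ∑ c ∈ P, (K c - A c) by
          rw [Finset.sum_sub_distrib]; ring]
      refine Even.sub (by decide) (Finset.even_sum _ fun c hc => ?_)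
      obtain ⟨i, hi⟩ := (hP c).2 hc
      exact hcong i c hi
    · obtain ⟨c, hc, rfl⟩ := Finset.mem_image.1 hu
      have hcw : c ≠ w₀ := fun h => hw₀P (h ▸ hc)
      rw [awayOrder_inv_sub hcw, awayOrder_inv_sub hcw]
      obtain ⟨i, hi⟩ := (hP c).2 hc
      exact hcong i c hi
  -- If 2ℓ divided the sum over J, the corresponding sum of the a i would be 0 and would generate
  -- the same subgroup as 2; but 2 ≠ 0 in ℤ/2ℓ because ℓ > 1.
  · intro J hJ hsum hdvd
    have h1 := sum_awayOrder_eq_sum hz hw₀ hP (M := ℤ) (b := κ) (d := -4) (B := K)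
      (by simp [hE.sum_order]) (by simpa using hK) hJ
    have h2 := sum_awayOrder_eq_sum hz hw₀ hP (b := a) (d := 0) (B := A)
      (by simp [hE.sum_monodromy]) hA hJ
    rw [Int.cast_id, hsum] at h1
    rw [(ZMod.intCast_zmod_eq_zero_iff_dvd _ _).2 hdvd] at h2
    have h3 := hE.generator _ h1.symm
    rw [← h2, AddSubgroup.zmultiples_zero_eq_bot, eq_comm, AddSubgroup.zmultiples_eq_bot] at h3
    have h4 : ((2 : ℕ) : ZMod (2 * ℓ)) = 0 := by exact_mod_cast h3
    rw [ZMod.natCast_eq_zero_iff] at h4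
    have h5 := Nat.le_of_dvd two_pos h4
    have h6 := hE.one_lt
    omega

theorem lemmaL (ℓ s : ℕ) (κ : Fin s → ℤ) (a : Fin s → ZMod (2 * ℓ))
    (hE : IsGeneralizedEW ℓ κ a)
    (q : QuadDiff (OnePoint ℂ)) (z : Fin s → OnePoint ℂ) (hq : q.HasDivisor z κ)
    {X : Type*} [TopologicalSpace X] [ChartedSpace ℂ X] [IsManifold 𝓘(ℂ) ω X]
    [T2Space X] [CompactSpace X] [ConnectedSpace X] [AddAction (ZMod (2 * ℓ)) X]
    (π : X → OnePoint ℂ) (hπ : IsCyclicCover (2 * ℓ) a z π)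
    (p : X) (hp : (q.pullback π).IsRegularPoint p) :
    (q.pullback π).IsFinitelyBlockedBy p p (π ⁻¹' {π p} \ {p}) := by
  have : NeZero (2 * ℓ) := ⟨by have := hE.one_lt; omega⟩
  refine ⟨?_, by simp, by simp, fun T γ hγ => ?_⟩
  · refine (finite_range fun g : ZMod (2 * ℓ) => g +ᵥ p).subset fun x hx => ?_
    exact (hπ.fiber p x).1 hx.1.symm
  -- The coordinate depends on the segment: its pole w₀ is neither a branch point nor on the
  -- projection of γ.
  · obtain ⟨w₀, hw₀, hγw₀⟩ := hγ.exists_notMem hπ.holomorphic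
      ((↑) ⁻¹' range z) ((finite_range z).preimage OnePoint.coe_injective.injOn)
    obtain ⟨Q, K, A, F, C, C', h⟩ := hπ.exists_flatCover hE hq hw₀
    obtain ⟨t, ht, ⟨g, hg⟩, hne⟩ := h.exists_vadd_eq_of_isLineSegment hγ hp hγw₀
    exact ⟨t, ht, ((hπ.fiber p _).2 ⟨g, hg⟩).symm, hne⟩
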